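/- **Setting.** Let $d\ge 0$, let $\mathcal N\subseteq\mathbb Z^d$ (for instance $\mathbb Z^d$ or $\mathbb N^d$), $\mathcal Z=\mathcal N\times\{\pm1\}$, and $|n|=\max(1,n_1^2+\dots+n_d^2)^{1/2}$. For a sequence $\zeta=(\zeta_j)_{j\in\mathcal Z}$ of complex numbers write $\xi_a=\zeta_{(a,1)}$, $\eta_a=\zeta_{(a,-1)}$. For real $s$ let $\|v\|_{\ell^1_s}=\sum_{a}|a|^s|v_a|$, $\mathcal W^s=\ell^1_s\times\ell^1_s\ni\zeta=(\xi,\eta)$ with norm $\|\xi\|_{\ell^1_s}+\|\eta\|_{\ell^1_s}$, and $\mathcal B_s(R)=\{\zeta\in\mathcal W^s:\|\xi\|_{\ell^1_s}<R,\ \|\eta\|_{\ell^1_s}<R\}$. The symplectic form is $\Omega_1=-\mathrm i\sum_a \mathrm d\xi_a\wedge \mathrm d\eta_a$; the Hamiltonian vector field $X_H$ has components $\mathrm i\,\partial H/\partial\eta_a$ (in direction $\xi_a$) and $-\mathrm i\,\partial H/\partial\xi_a$ (in direction $\eta_a$); and $\{F,G\}=\mathrm i\sum_a(\partial_{\xi_a}F\,\partial_{\eta_a}G-\partial_{\eta_a}F\,\partial_{\xi_a}G)$.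 "Analytic" means complex analytic. For $j=((a_1,\sigma_1),\dots,(a_l,\sigma_l))\in\mathcal Z^l$ put $\bar j=((a_1,-\sigma_1),\dots,(a_l,-\sigma_l))$, $\zeta_j=\prod_i\zeta_{(a_i,\sigma_i)}$, and let $\mathcal I_l$ be the set of $j\in\mathcal Z^l$ with $\sum_i\sigma_ia_i=0$. The class $\mathcal P_k$ consists of the polynomials $\sum_{l=2}^k\sum_{j\in\mathcal I_l}c_j\zeta_j$ with $c_{\bar j}=\overline{c_j}$ and $\sup_j|c_j|<\infty$. The class $\mathcal Q^m$ consists of the quadratic forms $\sum_{j\in\mathcal I_2}c_j\zeta_j$ with $c_{\bar j}=\overline{c_j}$ and $|c_j|\le C|a_1|^m$ for all $j=((a_1,\sigma_1),(a_2,\sigma_2))\in\mathcal I_2$; so $\mathcal Q^0=\mathcal P_2$. **Hypotheses.** Let $R>0$, $s_1\ge1$, $\frac{-3+\sqrt5}{2}<\nu\le0$, $k\ge3$ an integer, $\delta_0>0$. * (PER) $h_0$ is $C^1$ on $\mathcal W^{s}$ for all $s\ge s_1$, and $X_{h_0}$ generates a linear flow $\Phi^\tau$ which maps $\mathcal W^s$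 isometrically into itself for every $s\ge1$ and is periodic with period $T>0$: $\Phi^{\tau+T}=\Phi^\tau$. (For $\zeta\in\mathcal W^{s_1}$, $\frac{\mathrm d}{\mathrm d\tau}\Phi^\tau(\zeta)=X_{h_0}(\Phi^\tau(\zeta))$ holds in each component.) * (INV) For all integers $j\ge0$, $\Phi^\tau$ leaves invariant the space of sequences in $\mathcal W^s$ supported on $|n|\le j$, $s\ge1$, and commutes with the projection on the modes $j-1\le|n|<j$. * (HVF) For $0<\delta<\delta_0$ let $F=F_\delta\in\mathcal P_k$. There are $R^*>0$, integers $\mathtt k_1\ge\mathtt k_2\ge\cdots\ge 0$ with $\mathtt k_1=k$, forms $F_{1j}\in\mathcal Q^{2j}$ and polynomials $F_{2j}\in\mathcal P_{\mathtt k_j}$ ($j\ge1$), independent of $\delta$, such that for all $s\ge s_1$ and $j,r\ge1$: $X_{F_{1j}}$ is analytic from $\mathcal B_{s+2j}(R^*)$ to $\mathcal W^s$; $X_{F_{2j}}$ is analytic from $\mathcal B_s(R^*)$ to $\mathcal W^s$; the vector field of $F-\sum_{j=1}^r\delta^{j-1}(F_{1j}+\delta^\nu F_{2j})$ is analytic from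 $\mathcal B_{s+2(r+1)}(R^*)$ to $\mathcal W^s$; and, with a constant $C=C(r,s)$, the $\mathcal W^s$-norm of that vector field is at most $C\delta^{r+\nu}$ on $\mathcal B_{s+2(r+1)}(R^*)$ for all sufficiently small $\delta>0$. **Theorem (Averaging Theorem).** Under these hypotheses there is $s_0>0$ such that for every $s\ge s_1$ there are $\delta_s\in(0,\delta_0]$ and $C'_s>0$ such that for every $0<\delta<\delta_s$ there is an analytic canonical transformation $\mathcal T_\delta:\mathcal B_s(R)\to\mathcal B_s(2R)$ (that is, an analytic map, with analytic inverse on its open image, that preserves $\Omega_1$) such that on $\mathcal B_s(R)$ $$H\circ\mathcal T_\delta=h_0+\delta\mathcal Z_{11}+\delta^{1+\nu}\mathcal Z_{21}+\delta^{(2+\nu)(1+\nu)}\mathcal R^{(1)},\qquad H=h_0+\delta F ,$$ with $\mathcal R^{(1)}$ analytic on $\mathcal B_s(R)$, and such that the following hold. 1. For $j=1,2$, $\mathcal Z_{j1}=\langle F_{j1}\rangle$ on $\mathcal W^1$, where $\langle F_{j1}\rangle(\zeta)=\frac1T\int_0^TF_{j1}(\Phi^\tau(\zeta))\,\mathrm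 d\tau$. Moreover $\mathcal Z_{11}\in\mathcal Q^2$, with $\mathcal Z_{11}\in\mathcal P_2$ if $F_{11}\in\mathcal P_2$, and $\mathcal Z_{21}\in\mathcal P_k$. 2. $\{\mathcal Z_{11},h_0\}=\{\mathcal Z_{21},h_0\}=0$ on $\mathcal W^{s+s_0}$. 3. $\sup_{\mathcal B_{s+s_0}(R)}\|X_{\mathcal Z_{11}}\|_{\mathcal W^s}$, $\sup_{\mathcal B_{s+s_0}(R)}\|X_{\mathcal Z_{21}}\|_{\mathcal W^s}$ and $\sup_{\mathcal B_{s+s_0}(R)}\|X_{\mathcal R^{(1)}}\|_{\mathcal W^s}$ are at most $C'_s$. 4. $\|\mathcal T_\delta(\zeta)-\zeta\|_{\mathcal W^s}\le C'_s\,\delta^{1+\nu}$ for all $\zeta\in\mathcal B_{s+s_0}(R)$; and if $\nu<0$ or $F_{11}\in\mathcal P_2$, then this holds for all $\zeta\in\mathcal B_s(R)$. -/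

import Mathlib

open Set Filter Topology

noncomputable section

namespace GalerkinAveraging

/-! ### Weighted sequence spaces -/

/-- `|n| = max(1, n₁² + ⋯ + n_d²)^{1/2}`. -/
def modulus {d : ℕ} (n : Fin d → ℤ) : ℝ := Real.sqrt (max 1 (∑ i, (n i : ℝ) ^ 2))

/-- The index set `𝒵 = 𝒩 × {±1}`. -/
abbrev Idx {d : ℕ} (𝒩 : Set (Fin d → ℤ)) : Type := 𝒩 × ℤˣ

/-- Sequences `ζ = (ζ_j)_{j ∈ 𝒵}`; `ζ (a, 1) = ξ_a` and `ζ (a, -1) = η_a`. -/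
abbrev SeqSp {d : ℕ} (𝒩 : Set (Fin d → ℤ)) : Type := Idx 𝒩 → ℂ

/-- Hamiltonian functions. They are evaluated only at points of the spaces `𝒲^s`. -/
abbrev Ham {d : ℕ} (𝒩 : Set (Fin d → ℤ)) : Type := SeqSp 𝒩 → ℂ

theorem modulus_nonneg {d : ℕ} (n : Fin d → ℤ) : 0 ≤ modulus n := Real.sqrt_nonneg _

theorem modulus_pos {d : ℕ} (n : Fin d → ℤ) : 0 < modulus n :=
  Real.sqrt_pos.2 (lt_of_lt_of_le one_pos (le_max_left _ _))

/-- The `ℓ¹_s` norm of the component `ξ` (`σ = 1`) or `η` (`σ = -1`) of `ζ`. -/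
def compNorm {d : ℕ} {𝒩 : Set (Fin d → ℤ)} (s : ℝ) (ζ : SeqSp 𝒩) (σ : ℤˣ) : ℝ :=
  ∑' a : 𝒩, modulus a.1 ^ s * ‖ζ (a, σ)‖

/-- `ζ = (ξ, η)` belongs to `𝒲^s = ℓ¹_s × ℓ¹_s`. -/
def MemW {d : ℕ} {𝒩 : Set (Fin d → ℤ)} (s : ℝ) (ζ : SeqSp 𝒩) : Prop :=
  ∀ σ : ℤˣ, Summable fun a : 𝒩 => modulus a.1 ^ s * ‖ζ (a, σ)‖

/-- `‖ζ‖_{𝒲^s} = ‖ξ‖_{ℓ¹_s} + ‖η‖_{ℓ¹_s}`. -/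
def normW {d : ℕ} {𝒩 : Set (Fin d → ℤ)} (s : ℝ) (ζ : SeqSp 𝒩) : ℝ :=
  compNorm s ζ 1 + compNorm s ζ (-1)

theorem MemW.add {d : ℕ} {𝒩 : Set (Fin d → ℤ)} {s : ℝ} {ζ ζ' : SeqSp 𝒩}
    (h : MemW s ζ) (h' : MemW s ζ') : MemW s (ζ + ζ') := by
  intro σ
  refine Summable.of_nonneg_of_le (fun a => ?_) (fun a => ?_) ((h σ).add (h' σ))
  · exact mul_nonneg (Real.rpow_nonneg (modulus_nonneg _) _) (norm_nonneg _)
  · rw [← mul_add]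
    exact mul_le_mul_of_nonneg_left (norm_add_le _ _) (Real.rpow_nonneg (modulus_nonneg _) _)

theorem MemW.smul {d : ℕ} {𝒩 : Set (Fin d → ℤ)} {s : ℝ} {ζ : SeqSp 𝒩} (c : ℂ)
    (h : MemW s ζ) : MemW s (c • ζ) := by
  intro σ
  refine ((h σ).mul_left ‖c‖).congr (fun a => ?_)
  simp only [Pi.smul_apply, smul_eq_mul, norm_mul]
  ring

/-- `𝒲^s` as a linear space of sequences. -/
def submoduleW {d : ℕ} (𝒩 : Set (Fin d → ℤ)) (s : ℝ) : Submodule ℂ (SeqSp 𝒩) where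
  carrier := {ζ | MemW s ζ}
  add_mem' h h' := h.add h'
  zero_mem' := by
    intro σ
    simp [summable_zero]
  smul_mem' c _ h := h.smul c

/-- The space `𝒲^s = ℓ¹_s × ℓ¹_s`; it carries the norm `normW s`. -/
def W {d : ℕ} (𝒩 : Set (Fin d → ℤ)) (s : ℝ) : Type := submoduleW 𝒩 s

instance {d : ℕ} (𝒩 : Set (Fin d → ℤ)) (s : ℝ) : AddCommGroup (W 𝒩 s) :=
  inferInstanceAs (AddCommGroup (submoduleW 𝒩 s))

instance {d : ℕ} (𝒩 : Set (Fin d → ℤ)) (s : ℝ) : Module ℂ (W 𝒩 s) :=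
  inferInstanceAs (Module ℂ (submoduleW 𝒩 s))

/-- The sequence underlying an element of `𝒲^s`. -/
def W.seq {d : ℕ} {𝒩 : Set (Fin d → ℤ)} {s : ℝ} (ζ : W 𝒩 s) : SeqSp 𝒩 := ζ.1

theorem W.memW {d : ℕ} {𝒩 : Set (Fin d → ℤ)} {s : ℝ} (ζ : W 𝒩 s) : MemW s ζ.seq := ζ.2

instance {d : ℕ} (𝒩 : Set (Fin d → ℤ)) (s : ℝ) : Norm (W 𝒩 s) := ⟨fun ζ => normW s ζ.seq⟩

theorem W.norm_def {d : ℕ} {𝒩 : Set (Fin d → ℤ)} {s : ℝ} (ζ : W 𝒩 s) :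
    ‖ζ‖ = normW s ζ.seq := rfl

theorem compNorm_nonneg {d : ℕ} {𝒩 : Set (Fin d → ℤ)} (s : ℝ) (ζ : SeqSp 𝒩) (σ : ℤˣ) :
    0 ≤ compNorm s ζ σ :=
  tsum_nonneg fun _ => mul_nonneg (Real.rpow_nonneg (modulus_nonneg _) _) (norm_nonneg _)

theorem compNorm_smul {d : ℕ} {𝒩 : Set (Fin d → ℤ)} (s : ℝ) (c : ℂ) (ζ : SeqSp 𝒩) (σ : ℤˣ) :
    compNorm s (c • ζ) σ = ‖c‖ * compNorm s ζ σ := by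
  unfold compNorm
  rw [← tsum_mul_left]
  refine tsum_congr fun a => ?_
  simp only [Pi.smul_apply, smul_eq_mul, norm_mul]
  ring

theorem compNorm_add_le {d : ℕ} {𝒩 : Set (Fin d → ℤ)} {s : ℝ} {ζ ζ' : SeqSp 𝒩}
    (h : MemW s ζ) (h' : MemW s ζ') (σ : ℤˣ) :
    compNorm s (ζ + ζ') σ ≤ compNorm s ζ σ + compNorm s ζ' σ := by
  unfold compNorm
  rw [← (h σ).tsum_add (h' σ)]
  refine ((h.add h') σ).tsum_le_tsum (fun a => ?_) ((h σ).add (h' σ))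
  rw [← mul_add]
  exact mul_le_mul_of_nonneg_left (norm_add_le _ _) (Real.rpow_nonneg (modulus_nonneg _) _)

theorem eq_zero_of_compNorm {d : ℕ} {𝒩 : Set (Fin d → ℤ)} {s : ℝ} {ζ : SeqSp 𝒩}
    (h : MemW s ζ) {σ : ℤˣ} (h0 : compNorm s ζ σ = 0) (a : 𝒩) : ζ (a, σ) = 0 := by
  have hnn : ∀ a : 𝒩, 0 ≤ modulus a.1 ^ s * ‖ζ (a, σ)‖ := fun _ =>
    mul_nonneg (Real.rpow_nonneg (modulus_nonneg _) _) (norm_nonneg _)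
  have h1 : (fun a : 𝒩 => modulus a.1 ^ s * ‖ζ (a, σ)‖) = 0 :=
    (hasSum_zero_iff_of_nonneg hnn).1 (by
      have := (h σ).hasSum
      rwa [show (∑' a : 𝒩, modulus a.1 ^ s * ‖ζ (a, σ)‖) = 0 from h0] at this)
  have h2 := congrFun h1 a
  rcases mul_eq_zero.1 h2 with h3 | h3
  · exact absurd h3 (Real.rpow_pos_of_pos (modulus_pos _) _).ne'
  · exact norm_eq_zero.1 h3

theorem W.core {d : ℕ} (𝒩 : Set (Fin d → ℤ)) (s : ℝ) : NormedSpace.Core ℂ (W 𝒩 s) where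
  norm_nonneg ζ := add_nonneg (compNorm_nonneg _ _ _) (compNorm_nonneg _ _ _)
  norm_smul c ζ := by
    change normW s (c • ζ.seq) = ‖c‖ * normW s ζ.seq
    simp only [normW, compNorm_smul]
    ring
  norm_triangle ζ ζ' := by
    change normW s (ζ.seq + ζ'.seq) ≤ normW s ζ.seq + normW s ζ'.seq
    have h1 := compNorm_add_le ζ.memW ζ'.memW 1
    have h2 := compNorm_add_le ζ.memW ζ'.memW (-1)
    simp only [normW]
    linarith
  norm_eq_zero_iff ζ := by
    constructor
    · intro h
      have h' : compNorm s ζ.seq 1 + compNorm s ζ.seq (-1) = 0 := h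
      have p1 := compNorm_nonneg s ζ.seq 1
      have p2 := compNorm_nonneg s ζ.seq (-1)
      refine Subtype.ext (funext fun j => ?_)
      obtain ⟨a, σ⟩ := j
      rcases Int.units_eq_one_or σ with rfl | rfl
      · exact eq_zero_of_compNorm ζ.memW (by linarith) a
      · exact eq_zero_of_compNorm ζ.memW (by linarith) a
    · rintro rfl
      change normW s (0 : SeqSp 𝒩) = 0
      simp [normW, compNorm]

instance {d : ℕ} (𝒩 : Set (Fin d → ℤ)) (s : ℝ) : NormedAddCommGroup (W 𝒩 s) :=
  NormedAddCommGroup.ofCore (W.core 𝒩 s)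

instance {d : ℕ} (𝒩 : Set (Fin d → ℤ)) (s : ℝ) : NormedSpace ℂ (W 𝒩 s) :=
  NormedSpace.ofCore (W.core 𝒩 s)

/-- `ℬ_s(R) = B_s(R) × B_s(R) ⊂ 𝒲^s`, as a set of sequences. -/
def ballW {d : ℕ} (𝒩 : Set (Fin d → ℤ)) (s R : ℝ) : Set (SeqSp 𝒩) :=
  {ζ | MemW s ζ ∧ ∀ σ : ℤˣ, compNorm s ζ σ < R}

/-- `ℬ_s(R)` as a subset of the normed space `𝒲^s`. -/
def openBallW {d : ℕ} (𝒩 : Set (Fin d → ℤ)) (s R : ℝ) : Set (W 𝒩 s) :=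
  {ζ | ζ.seq ∈ ballW 𝒩 s R}

/-! ### Hamiltonian formalism -/

/-- The partial derivative `∂H/∂ζ_j`. -/
def partialDeriv {d : ℕ} {𝒩 : Set (Fin d → ℤ)} (H : Ham 𝒩) (j : Idx 𝒩) (ζ : SeqSp 𝒩) : ℂ :=
  deriv (fun z : ℂ => H (Function.update ζ j z)) (ζ j)

/-- The Hamiltonian vector field for `Ω₁ = -i ∑ dξ_a ∧ dη_a`:
its components are `i ∂H/∂η_a` (for `ξ_a`) and `-i ∂H/∂ξ_a` (for `η_a`). -/
def vectorField {d : ℕ} {𝒩 : Set (Fin d → ℤ)} (H : Ham 𝒩) (ζ : SeqSp 𝒩) : SeqSp 𝒩 :=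
  fun j => Complex.I * ((j.2 : ℤ) : ℂ) * partialDeriv H (j.1, -j.2) ζ

/-- `{F, G}(ζ) = c`, where
`{F, G} = i ∑_a (∂F/∂ξ_a ∂G/∂η_a - ∂F/∂η_a ∂G/∂ξ_a)` and the series is required to converge. -/
def HasPoissonBracket {d : ℕ} {𝒩 : Set (Fin d → ℤ)} (F G : Ham 𝒩) (ζ : SeqSp 𝒩) (c : ℂ) : Prop :=
  HasSum (fun a : 𝒩 => Complex.I *
    (partialDeriv F (a, 1) ζ * partialDeriv G (a, -1) ζ
      - partialDeriv F (a, -1) ζ * partialDeriv G (a, 1) ζ)) c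

/-- The symplectic form `Ω₁ = -i ∑ dξ_a ∧ dη_a`. -/
def symplecticForm {d : ℕ} {𝒩 : Set (Fin d → ℤ)} (u v : SeqSp 𝒩) : ℂ :=
  -Complex.I * ∑' a : 𝒩, (u (a, 1) * v (a, -1) - u (a, -1) * v (a, 1))

/-- `𝒯` is an analytic canonical transformation on the set `U ⊂ 𝒲^s`: it is an analytic
diffeomorphism of `U` onto an open set, with analytic inverse, and it preserves `Ω₁`. -/
structure IsCanonical {d : ℕ} {𝒩 : Set (Fin d → ℤ)} {s : ℝ} (𝒯 : W 𝒩 s → W 𝒩 s)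
    (U : Set (W 𝒩 s)) : Prop where
  analytic : AnalyticOnNhd ℂ 𝒯 U
  isOpen_image : IsOpen (𝒯 '' U)
  exists_inverse : ∃ 𝒮 : W 𝒩 s → W 𝒩 s, AnalyticOnNhd ℂ 𝒮 (𝒯 '' U) ∧ ∀ ζ ∈ U, 𝒮 (𝒯 ζ) = ζ
  symplectic : ∀ ζ ∈ U, ∀ u v : W 𝒩 s,
    symplecticForm (fderiv ℂ 𝒯 ζ u).seq (fderiv ℂ 𝒯 ζ v).seq = symplecticForm u.seq v.seq

/-- The vector field `X` is analytic from `ℬ_{s'}(R)` to `𝒲^s`. -/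
def IsAnalyticField {d : ℕ} {𝒩 : Set (Fin d → ℤ)} (X : SeqSp 𝒩 → SeqSp 𝒩) (s' R s : ℝ) : Prop :=
  ∃ G : W 𝒩 s' → W 𝒩 s, AnalyticOnNhd ℂ G (openBallW 𝒩 s' R) ∧
    ∀ ζ ∈ openBallW 𝒩 s' R, (G ζ).seq = X ζ.seq

/-- `sup_{ℬ_{s'}(R)} ‖X‖_{𝒲^s} ≤ C`; in particular `X` takes values in `𝒲^s` there. -/
def FieldBound {d : ℕ} {𝒩 : Set (Fin d → ℤ)} (X : SeqSp 𝒩 → SeqSp 𝒩) (s' R s C : ℝ) : Prop :=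
  ∀ ζ ∈ ballW 𝒩 s' R, MemW s (X ζ) ∧ normW s (X ζ) ≤ C

/-! ### Polynomials of zero momentum -/

/-- The conjugate index `(a, σ) ↦ (a, -σ)`. -/
def Idx.conj {d : ℕ} {𝒩 : Set (Fin d → ℤ)} (j : Idx 𝒩) : Idx 𝒩 := (j.1, -j.2)

/-- The momentum `∑ σ_i a_i` of a multi-index. -/
def momentum {d : ℕ} {𝒩 : Set (Fin d → ℤ)} {l : ℕ} (j : Fin l → Idx 𝒩) : Fin d → ℤ :=
  ∑ i, ((j i).2 : ℤ) • ((j i).1 : Fin d → ℤ)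

/-- The multi-indices of length `l` with zero momentum. -/
def zeroMomentum {d : ℕ} (𝒩 : Set (Fin d → ℤ)) (l : ℕ) : Set (Fin l → Idx 𝒩) :=
  {j | momentum j = 0}

/-- The class `𝒫_k`: real polynomials `∑_{l=2}^k ∑_{j ∈ ℐ_l} a_j ζ_j`, of zero momentum, with
bounded coefficients. -/
def PolyClass {d : ℕ} {𝒩 : Set (Fin d → ℤ)} (k : ℕ) (P : Ham 𝒩) : Prop :=
  ∃ a : (l : ℕ) → (Fin l → Idx 𝒩) → ℂ,
    (∀ l ∈ Finset.Icc 2 k, ∀ j ∈ zeroMomentum 𝒩 l,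
      a l (fun i => (j i).conj) = (starRingEnd ℂ) (a l j)) ∧
    (∃ C : ℝ, ∀ l ∈ Finset.Icc 2 k, ∀ j ∈ zeroMomentum 𝒩 l, ‖a l j‖ ≤ C) ∧
    ∀ ζ : SeqSp 𝒩, MemW 1 ζ →
      P ζ = ∑ l ∈ Finset.Icc 2 k, ∑' j : zeroMomentum 𝒩 l, a l j.1 * ∏ i, ζ (j.1 i)

/-- Real quadratic forms `∑_{j ∈ ℐ_2} a_j ζ_j` of zero momentum and of order `m`:
the coefficients satisfy `|a_j| ≤ C |j₁|^m` (note that `|j₁| = |j₂|` on `ℐ_2`), so that the linear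
vector field loses `m` derivatives. For `m = 0` this is `𝒫_2`. The series converges absolutely on
`𝒲^s` for `s ≥ m / 2`. -/
def QuadClass {d : ℕ} {𝒩 : Set (Fin d → ℤ)} (m : ℝ) (P : Ham 𝒩) : Prop :=
  ∃ a : (Fin 2 → Idx 𝒩) → ℂ,
    (∀ j ∈ zeroMomentum 𝒩 2, a (fun i => (j i).conj) = (starRingEnd ℂ) (a j)) ∧
    (∃ C : ℝ, ∀ j ∈ zeroMomentum 𝒩 2, ‖a j‖ ≤ C * modulus (j 0).1.1 ^ m) ∧
    ∀ ζ : SeqSp 𝒩, MemW (max 1 (m / 2)) ζ →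
      P ζ = ∑' j : zeroMomentum 𝒩 2, a j.1 * ∏ i, ζ (j.1 i)

/-! ### Projections and the unperturbed flow -/

/-- The shell projection `π_j`. -/
def shellProj {d : ℕ} {𝒩 : Set (Fin d → ℤ)} (j : ℕ) (ζ : SeqSp 𝒩) : SeqSp 𝒩 :=
  open scoped Classical in
  fun n => if (j : ℝ) - 1 ≤ modulus n.1.1 ∧ modulus n.1.1 < j then ζ n else 0

/-- The projection `Π_M` on the modes with `|n| ≤ M`. -/
def lowProj {d : ℕ} {𝒩 : Set (Fin d → ℤ)} (M : ℕ) (ζ : SeqSp 𝒩) : SeqSp 𝒩 :=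
  open scoped Classical in
  fun n => if modulus n.1.1 ≤ M then ζ n else 0

/-- (PER): `h₀` is a `C¹` Hamiltonian whose vector field generates the linear flow `Φ`; the flow has
period `T > 0`, acts on every `𝒲^s`, `s ≥ 1`, and is isometric there. A linear isometry is in
particular analytic. -/
structure PeriodicFlow {d : ℕ} {𝒩 : Set (Fin d → ℤ)} (s₁ : ℝ) (h₀ : Ham 𝒩)
    (Φ : ℝ → SeqSp 𝒩 → SeqSp 𝒩) (T : ℝ) : Prop where
  period_pos : 0 < T
  contDiff : ∀ s, s₁ ≤ s → ContDiff ℂ 1 fun ζ : W 𝒩 s => h₀ ζ.seq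
  mapsTo : ∀ s, 1 ≤ s → ∀ t, ∀ ζ : SeqSp 𝒩, MemW s ζ → MemW s (Φ t ζ)
  map_add : ∀ t, ∀ ζ ζ' : SeqSp 𝒩, MemW 1 ζ → MemW 1 ζ' → Φ t (ζ + ζ') = Φ t ζ + Φ t ζ'
  map_smul : ∀ t, ∀ c : ℂ, ∀ ζ : SeqSp 𝒩, MemW 1 ζ → Φ t (c • ζ) = c • Φ t ζ
  isometry : ∀ s, 1 ≤ s → ∀ t, ∀ ζ : SeqSp 𝒩, MemW s ζ → normW s (Φ t ζ) = normW s ζ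
  flow_zero : ∀ ζ : SeqSp 𝒩, MemW 1 ζ → Φ 0 ζ = ζ
  flow_add : ∀ t u, ∀ ζ : SeqSp 𝒩, MemW 1 ζ → Φ (t + u) ζ = Φ t (Φ u ζ)
  generator : ∀ ζ : SeqSp 𝒩, MemW s₁ ζ → ∀ t, ∀ j : Idx 𝒩,
    HasDerivAt (fun τ => Φ τ ζ j) (vectorField h₀ (Φ t ζ) j) t
  periodic : ∀ t, ∀ ζ : SeqSp 𝒩, MemW 1 ζ → Φ (t + T) ζ = Φ t ζ

/-- (INV): the flow leaves `Π_j 𝒲^s` invariant and commutes with `π_j`. -/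
structure FlowInvariance {d : ℕ} {𝒩 : Set (Fin d → ℤ)} (Φ : ℝ → SeqSp 𝒩 → SeqSp 𝒩) : Prop where
  invariant : ∀ s, 1 ≤ s → ∀ t, ∀ j : ℕ, ∀ ζ : SeqSp 𝒩, MemW s ζ →
    lowProj j ζ = ζ → lowProj j (Φ t ζ) = Φ t ζ
  commutes : ∀ s, 1 ≤ s → ∀ t, ∀ j : ℕ, ∀ ζ : SeqSp 𝒩, MemW s ζ →
    shellProj j (Φ t ζ) = Φ t (shellProj j ζ)

/-- The time average `⟨F⟩ = (1/T) ∫_0^T F ∘ Φ^τ dτ`. -/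
def timeAverage {d : ℕ} {𝒩 : Set (Fin d → ℤ)} (Φ : ℝ → SeqSp 𝒩 → SeqSp 𝒩) (T : ℝ) (F : Ham 𝒩) :
    Ham 𝒩 :=
  fun ζ => (T : ℂ)⁻¹ * ∫ τ in (0 : ℝ)..T, F (Φ τ ζ)

/-! ### The asymptotic expansion of the perturbation -/

/-- `F - ∑_{j=1}^r δ^{j-1} (F_{1j} + δ^ν F_{2j})`, for `F` evaluated at the parameter `δ`. -/
def expansionRemainder {d : ℕ} {𝒩 : Set (Fin d → ℤ)} (ν : ℝ) (F : ℝ → Ham 𝒩)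
    (F₁ F₂ : ℕ → Ham 𝒩) (r : ℕ) (δ : ℝ) : Ham 𝒩 :=
  fun ζ => F δ ζ - ∑ j ∈ Finset.Icc 1 r,
    ((δ ^ (j - 1) : ℝ) : ℂ) * (F₁ j ζ + ((δ ^ ν : ℝ) : ℂ) * F₂ j ζ)

/-- The expansion `F ∼ ∑_{j ≥ 1} δ^{j-1} (F_{1j} + δ^ν F_{2j})` in the sense of vector fields,
together with (HVF): the linear fields of the `F_{1j}` lose `2j` derivatives, those of the
polynomials `F_{2j}` lose none, and the remainder after `r` terms is `O(δ^{r+ν})` with a loss of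
`2(r+1)` derivatives. -/
structure AsymptoticExpansion {d : ℕ} {𝒩 : Set (Fin d → ℤ)} (s₁ ν δ₀ : ℝ) (k : ℕ)
    (F : ℝ → Ham 𝒩) (F₁ F₂ : ℕ → Ham 𝒩) (Rs : ℝ) (deg : ℕ → ℕ) : Prop where
  radius_pos : 0 < Rs
  deg_one : deg 1 = k
  deg_antitone : ∀ j, 1 ≤ j → deg (j + 1) ≤ deg j
  polynomial : ∀ δ, 0 < δ → δ < δ₀ → PolyClass k (F δ)
  quadratic₁ : ∀ j : ℕ, 1 ≤ j → QuadClass (2 * j) (F₁ j)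
  analytic₁ : ∀ j : ℕ, 1 ≤ j → ∀ s, s₁ ≤ s → IsAnalyticField (vectorField (F₁ j)) (s + 2 * j) Rs s
  polynomial₂ : ∀ j : ℕ, 1 ≤ j → PolyClass (deg j) (F₂ j)
  analytic₂ : ∀ j : ℕ, 1 ≤ j → ∀ s, s₁ ≤ s → IsAnalyticField (vectorField (F₂ j)) s Rs s
  analytic_remainder : ∀ r : ℕ, 1 ≤ r → ∀ s, s₁ ≤ s → ∀ δ, 0 < δ → δ < δ₀ →
    IsAnalyticField (vectorField (expansionRemainder ν F F₁ F₂ r δ)) (s + 2 * (r + 1)) Rs s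
  bound_remainder : ∀ r : ℕ, 1 ≤ r → ∀ s, s₁ ≤ s → ∃ C ε : ℝ, 0 < ε ∧ ∀ δ, 0 < δ → δ < ε →
    FieldBound (vectorField (expansionRemainder ν F F₁ F₂ r δ)) (s + 2 * (r + 1)) Rs s
      (C * δ ^ (r + ν))

end GalerkinAveraging

end

open GalerkinAveraging

/-! Isometry in the weighted `ℓ¹` norms, finiteness of the shells and periodicity force `Φ` to be
diagonal, with frequencies `κ n` in `(2π/T)ℤ` (`exists_diagonal`). Hence `h₀` is a quadratic form
plus a constant, averaging keeps exactly the monomials with `∑ κ (j i) = 0` (`timeAverage_polyFun`),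
and the homological equation is solved by dividing each other monomial by a nonzero integer multiple
of `2πi/T`: there are no small divisors (`norm_solMul_le`).

The field of `F₁₁` loses two derivatives, so its part of the generating function is cut at modes
`|n| ≤ M` with `M` a negative power of `δ`. On `𝒲^s` the cut field costs a factor `M²`; on smoother
points it is bounded uniformly in `M`, and the discarded modes contribute at most `M^{-(s₀-2)} ≤ δ`
once `s₀` derivatives are given up (`exists_cutoff`).

The transformation is not a time-one flow but the midpoint map `(id + Y) ∘ (id - Y)⁻¹`, with `Y`
half the generating vector field. Its differential is a Cayley transform of an operator skew for the
symplectic form, hence symplectic (`SmallField.isCanonical`). Since `h₀` is quadratic, `h₀(x + Y x)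
- h₀(x - Y x) = 2 dh₀(x)(Y x)` without remainder, so the homological equation is used exactly once
and exactly (`unperturbed_midpoint`). No Taylor expansion of `h₀`, whose field is unbounded, is
needed.

What is left is `δ F` at the image point minus its resonant part at the initial point and its low
nonresonant part at the midpoint. These points differ by `O(ε)`, `ε = δ^{1+ν}`, and the fields have
size `δ` and `δ·δ^ν = ε`; the error field is therefore `O(ε²)` from a space with `s₀ ≥ 4` more
derivatives (`norm_pullback_le`). As `ν ≤ 0`, `ε² ≤ δ^{(2+ν)(1+ν)}`. The error of the one-term
expansion of `F` is known only on a small ball; being polynomial of bounded degree, it is controlled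
on large balls by interpolation (`field_bound_extend`). -/

noncomputable section

namespace GalerkinAveraging

open scoped ContDiff

/-! ### Weighted `ℓ¹` spaces: completeness, basis, inclusions, symplectic form. -/

section

variable {d : ℕ} {𝒩 : Set (Fin d → ℤ)}

/-- The weight `|n|^s` of an index. -/
def wt (s : ℝ) (n : Idx 𝒩) : ℝ := modulus n.1.1 ^ s

theorem one_le_modulus (n : Fin d → ℤ) : 1 ≤ modulus n :=
  Real.one_le_sqrt.2 (le_max_left _ _)

theorem wt_pos (s : ℝ) (n : Idx 𝒩) : 0 < wt s n := Real.rpow_pos_of_pos (modulus_pos _) _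

theorem wt_nonneg (s : ℝ) (n : Idx 𝒩) : 0 ≤ wt s n := (wt_pos s n).le

theorem one_le_wt {s : ℝ} (hs : 0 ≤ s) (n : Idx 𝒩) : 1 ≤ wt s n :=
  Real.one_le_rpow (one_le_modulus _) hs

theorem wt_mono {s s' : ℝ} (h : s ≤ s') (n : Idx 𝒩) : wt s n ≤ wt s' n :=
  Real.rpow_le_rpow_of_exponent_le (one_le_modulus _) h

theorem wt_add (s s' : ℝ) (n : Idx 𝒩) : wt (s + s') n = wt s n * wt s' n :=
  Real.rpow_add (modulus_pos _) _ _

theorem wt_conj (s : ℝ) (n : Idx 𝒩) : wt s n.conj = wt s n := rfl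

theorem conj_conj (n : Idx 𝒩) : n.conj.conj = n := by
  simp [Idx.conj]

/-- Conjugation of indices as an equivalence. -/
def conjEquiv (𝒩 : Set (Fin d → ℤ)) : Idx 𝒩 ≃ Idx 𝒩 :=
  ⟨Idx.conj, Idx.conj, conj_conj, conj_conj⟩

theorem units_eq_pair : (Finset.univ : Finset ℤˣ) = {1, -1} := by decide

theorem summable_prod_units {f : Idx 𝒩 → ℝ} (hf : 0 ≤ f)
    (h : ∀ σ : ℤˣ, Summable fun a : 𝒩 => f (a, σ)) : Summable f := by
  have h2 : Summable fun p : ℤˣ × 𝒩 => f (p.2, p.1) :=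
    (summable_prod_of_nonneg (f := fun p : ℤˣ × 𝒩 => f (p.2, p.1)) (fun p => hf _)).2
      ⟨h, (hasSum_fintype _).summable⟩
  exact (Equiv.prodComm ℤˣ 𝒩).summable_iff.1 h2

theorem tsum_idx {E : Type*} [NormedAddCommGroup E] [CompleteSpace E] {f : Idx 𝒩 → E}
    (hf : Summable f) : ∑' n, f n = ∑' a : 𝒩, f (a, 1) + ∑' a : 𝒩, f (a, -1) := by
  have h2 : Summable fun p : ℤˣ × 𝒩 => f (p.2, p.1) :=
    (Equiv.prodComm ℤˣ 𝒩).summable_iff.2 hf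
  rw [← (Equiv.prodComm ℤˣ 𝒩).tsum_eq]
  change ∑' p : ℤˣ × 𝒩, f (p.2, p.1) = _
  rw [h2.tsum_prod, tsum_fintype, units_eq_pair, Finset.sum_pair (by decide)]

theorem memW_iff {s : ℝ} {ζ : SeqSp 𝒩} : MemW s ζ ↔ Summable fun n => wt s n * ‖ζ n‖ := by
  refine ⟨fun h => summable_prod_units (fun n => mul_nonneg (wt_nonneg _ _) (norm_nonneg _)) h,
    fun h σ => ?_⟩
  exact h.comp_injective (i := fun a : 𝒩 => (a, σ)) (fun a b hab => (Prod.ext_iff.1 hab).1)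

theorem normW_eq {s : ℝ} {ζ : SeqSp 𝒩} (h : MemW s ζ) : normW s ζ = ∑' n, wt s n * ‖ζ n‖ :=
  (tsum_idx (memW_iff.1 h)).symm

theorem MemW.mono {s s' : ℝ} (hs : s ≤ s') {ζ : SeqSp 𝒩} (h : MemW s' ζ) : MemW s ζ :=
  memW_iff.2 ((memW_iff.1 h).of_nonneg_of_le
    (fun _ => mul_nonneg (wt_nonneg _ _) (norm_nonneg _))
    (fun n => mul_le_mul_of_nonneg_right (wt_mono hs n) (norm_nonneg _)))

theorem normW_mono {s s' : ℝ} (hs : s ≤ s') {ζ : SeqSp 𝒩} (h : MemW s' ζ) :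
    normW s ζ ≤ normW s' ζ := by
  rw [normW_eq h, normW_eq (h.mono hs)]
  exact (memW_iff.1 (h.mono hs)).tsum_le_tsum
    (fun n => mul_le_mul_of_nonneg_right (wt_mono hs n) (norm_nonneg _)) (memW_iff.1 h)

/-- The element of `𝒲^s` given by a sequence. -/
def toW (s : ℝ) (ζ : SeqSp 𝒩) (h : MemW s ζ) : W 𝒩 s := ⟨ζ, h⟩

@[simp] theorem toW_seq {s : ℝ} (ζ : SeqSp 𝒩) (h : MemW s ζ) : (toW s ζ h).seq = ζ := rfl

theorem W.ext_seq {s : ℝ} {x y : W 𝒩 s} (h : x.seq = y.seq) : x = y := Subtype.ext h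

@[simp] theorem seq_add {s : ℝ} (x y : W 𝒩 s) : (x + y).seq = x.seq + y.seq := funext fun _ => rfl
@[simp] theorem seq_sub {s : ℝ} (x y : W 𝒩 s) : (x - y).seq = x.seq - y.seq := funext fun _ => rfl
@[simp] theorem seq_neg {s : ℝ} (x : W 𝒩 s) : (-x).seq = -x.seq := funext fun _ => rfl
@[simp] theorem seq_zero {s : ℝ} : (0 : W 𝒩 s).seq = 0 := funext fun _ => rfl
@[simp] theorem seq_smul {s : ℝ} (c : ℂ) (x : W 𝒩 s) : (c • x).seq = c • x.seq := funext fun _ => rfl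

theorem W.summable {s : ℝ} (x : W 𝒩 s) : Summable fun n => wt s n * ‖x.seq n‖ :=
  memW_iff.1 x.memW

theorem W.norm_eq_normW {s : ℝ} (x : W 𝒩 s) : ‖x‖ = normW s x.seq := rfl

theorem W.norm_eq {s : ℝ} (x : W 𝒩 s) : ‖x‖ = ∑' n, wt s n * ‖x.seq n‖ := by
  rw [W.norm_eq_normW, normW_eq x.memW]

theorem W.wt_mul_le {s : ℝ} (x : W 𝒩 s) (n : Idx 𝒩) : wt s n * ‖x.seq n‖ ≤ ‖x‖ := by
  rw [x.norm_eq]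
  exact x.summable.le_tsum n fun _ _ => mul_nonneg (wt_nonneg _ _) (norm_nonneg _)

/-- The coordinate functionals of `𝒲^s`. -/
def coord (s : ℝ) (n : Idx 𝒩) : W 𝒩 s →L[ℂ] ℂ :=
  LinearMap.mkContinuous
    { toFun := fun x => x.seq n
      map_add' := fun _ _ => rfl
      map_smul' := fun _ _ => rfl } (wt s n)⁻¹ (fun x => by
        have := x.wt_mul_le n
        rw [inv_mul_eq_div, le_div_iff₀ (wt_pos s n), mul_comm]
        exact this)

@[simp] theorem coord_apply {s : ℝ} (n : Idx 𝒩) (x : W 𝒩 s) : coord s n x = x.seq n := rfl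

/-- The weighted sequence, as an element of `ℓ¹`. -/
def toLp {s : ℝ} (x : W 𝒩 s) : lp (fun _ : Idx 𝒩 => ℂ) 1 :=
  ⟨fun n => (wt s n : ℂ) * x.seq n, by
    refine memℓp_gen ?_
    simpa [abs_of_pos, wt_pos] using x.summable⟩

theorem toLp_apply {s : ℝ} (x : W 𝒩 s) (n : Idx 𝒩) : toLp x n = (wt s n : ℂ) * x.seq n := rfl

/-- Multiplication by the weights identifies `𝒲^s` with `ℓ¹`. This carries over completeness, on
which the fixed point argument and the Neumann series rest. -/
theorem toLp_isometry (s : ℝ) : Isometry (toLp : W 𝒩 s → lp (fun _ : Idx 𝒩 => ℂ) 1) := by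
  refine Isometry.of_dist_eq fun x y => ?_
  rw [dist_eq_norm, dist_eq_norm, W.norm_eq, lp.norm_eq_tsum_rpow (by simp)]
  simp only [ENNReal.toReal_one, Real.rpow_one, div_one]
  refine tsum_congr fun n => ?_
  rw [lp.coeFn_sub, Pi.sub_apply, toLp_apply, toLp_apply, ← mul_sub, norm_mul,
    Complex.norm_of_nonneg (wt_nonneg s n)]
  rfl

theorem toLp_surjective (s : ℝ) :
    Function.Surjective (toLp : W 𝒩 s → lp (fun _ : Idx 𝒩 => ℂ) 1) := by
  intro y
  have hy : Summable fun n => ‖y n‖ := by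
    simpa using (lp.memℓp y).summable (by simp)
  refine ⟨toW s (fun n => (wt s n : ℂ)⁻¹ * y n) (memW_iff.2 (hy.congr fun n => ?_)), ?_⟩
  · rw [norm_mul, norm_inv, Complex.norm_of_nonneg (wt_nonneg s n),
      mul_inv_cancel_left₀ (wt_pos s n).ne']
  · refine lp.ext (funext fun n => ?_)
    rw [toLp_apply, toW_seq, mul_inv_cancel_left₀ (Complex.ofReal_ne_zero.2 (wt_pos s n).ne')]

instance (s : ℝ) : CompleteSpace (W 𝒩 s) :=
  (toLp_isometry s).isUniformInducing.completeSpace_congr (toLp_surjective s) |>.2 inferInstance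

theorem memW_of_finite {s : ℝ} {ζ : SeqSp 𝒩} (t : Finset (Idx 𝒩)) (h : ∀ n ∉ t, ζ n = 0) :
    MemW s ζ :=
  memW_iff.2 (summable_of_ne_finset_zero (s := t) fun n hn => by simp [h n hn])

open scoped Classical in
/-- The basis vectors of `𝒲^s`. -/
def basisW (s : ℝ) (n : Idx 𝒩) : W 𝒩 s :=
  toW s (Pi.single n 1) (memW_of_finite {n} fun m hm => by
    simp at hm; simp [hm])

open scoped Classical in
theorem basisW_seq (s : ℝ) (n : Idx 𝒩) : (basisW s n).seq = Pi.single n 1 := rfl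

theorem norm_basisW (s : ℝ) (n : Idx 𝒩) : ‖basisW s n‖ = wt s n := by
  rw [W.norm_eq, tsum_eq_single n]
  · simp [basisW_seq]
  · intro m hm
    simp [basisW_seq, hm]

/-- Makes a continuous linear map determined by its values on basis vectors, so that identities
between differentials are checked coordinate by coordinate. -/
theorem hasSum_basisW {s : ℝ} (x : W 𝒩 s) : HasSum (fun n => x.seq n • basisW s n) x := by
  have h : Summable fun n => x.seq n • basisW s n := by
    refine Summable.of_norm (x.summable.congr fun n => ?_)
    rw [norm_smul, norm_basisW, mul_comm]
  have h2 : ∑' n, x.seq n • basisW s n = x := by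
    refine W.ext_seq (funext fun m => ?_)
    rw [← coord_apply, (coord s m).map_tsum h, tsum_eq_single m]
    · simp [basisW_seq]
    · intro n hn
      simp [basisW_seq, hn.symm]
  simpa only [h2] using h.hasSum

theorem hasSum_apply {E : Type*} [NormedAddCommGroup E] [NormedSpace ℂ E] {s : ℝ}
    (L : W 𝒩 s →L[ℂ] E) (x : W 𝒩 s) : HasSum (fun n => x.seq n • L (basisW s n)) (L x) := by
  simpa using (hasSum_basisW x).mapL L

theorem clm_ext {E : Type*} [NormedAddCommGroup E] [NormedSpace ℂ E] {s : ℝ}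
    {L L' : W 𝒩 s →L[ℂ] E} (h : ∀ n, L (basisW s n) = L' (basisW s n)) : L = L' := by
  ext x
  have h1 := hasSum_apply L x
  simp only [h] at h1
  exact h1.unique (hasSum_apply L' x)

/-- The inclusion `𝒲^{s'} ⊂ 𝒲^s` for `s ≤ s'`, as a function. -/
def inclFun {s s' : ℝ} (h : s ≤ s') (x : W 𝒩 s') : W 𝒩 s := toW s x.seq (x.memW.mono h)

theorem inclFun_seq {s s' : ℝ} (h : s ≤ s') (x : W 𝒩 s') : (inclFun h x).seq = x.seq :=
  toW_seq _ _

theorem inclFun_add {s s' : ℝ} (h : s ≤ s') (x y : W 𝒩 s') :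
    inclFun h (x + y) = inclFun h x + inclFun h y :=
  W.ext_seq (by simp only [seq_add, inclFun_seq])

theorem inclFun_smul {s s' : ℝ} (h : s ≤ s') (c : ℂ) (x : W 𝒩 s') :
    inclFun h (c • x) = c • inclFun h x :=
  W.ext_seq (by simp only [seq_smul, inclFun_seq])

theorem norm_inclFun_le {s s' : ℝ} (h : s ≤ s') (x : W 𝒩 s') : ‖inclFun h x‖ ≤ 1 * ‖x‖ := by
  rw [one_mul, W.norm_eq_normW, W.norm_eq_normW, inclFun_seq]
  exact normW_mono h x.memW

/-- The inclusion `𝒲^{s'} ⊂ 𝒲^s` for `s ≤ s'`. -/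
def incl {s s' : ℝ} (h : s ≤ s') : W 𝒩 s' →L[ℂ] W 𝒩 s :=
  LinearMap.mkContinuous
    { toFun := inclFun h
      map_add' := inclFun_add h
      map_smul' := inclFun_smul h } 1 (norm_inclFun_le h)

theorem incl_eq {s s' : ℝ} (h : s ≤ s') (x : W 𝒩 s') : incl h x = inclFun h x := rfl

@[simp] theorem incl_seq {s s' : ℝ} (h : s ≤ s') (x : W 𝒩 s') : (incl h x).seq = x.seq := by
  rw [incl_eq, inclFun_seq]

theorem norm_incl_le {s s' : ℝ} (h : s ≤ s') (x : W 𝒩 s') : ‖incl h x‖ ≤ ‖x‖ := by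
  rw [W.norm_eq_normW, W.norm_eq_normW, incl_seq]
  exact normW_mono h x.memW

/-- Finite combinations of basis vectors lie in every space of the scale. Density extends identities
from smooth points to points where `X_{h₀}` need not belong to `𝒲^s`. -/
theorem denseRange_incl {s s' : ℝ} (h : s ≤ s') : DenseRange (incl h : W 𝒩 s' → W 𝒩 s) := by
  intro x
  refine mem_closure_of_tendsto (hasSum_basisW x) (Eventually.of_forall fun t => ?_)
  refine ⟨∑ n ∈ t, x.seq n • basisW s' n, ?_⟩
  rw [map_sum]
  refine Finset.sum_congr rfl fun n _ => ?_
  rw [map_smul]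
  exact W.ext_seq (by rw [seq_smul, seq_smul, incl_seq, basisW_seq, basisW_seq])

/-- The sign of an index, as a complex number. -/
def sgn (n : Idx 𝒩) : ℂ := ((n.2 : ℤ) : ℂ)

theorem sgn_conj (n : Idx 𝒩) : sgn n.conj = -sgn n := by simp [sgn, Idx.conj]

theorem sgn_mul_self (n : Idx 𝒩) : sgn n * sgn n = 1 := by
  rcases n with ⟨a, σ⟩
  rcases Int.units_eq_one_or σ with rfl | rfl <;> simp [sgn]

theorem norm_sgn (n : Idx 𝒩) : ‖sgn n‖ = 1 := by
  rcases n with ⟨a, σ⟩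
  rcases Int.units_eq_one_or σ with rfl | rfl <;> simp [sgn]

/-- One factor is taken in the supremum norm, which the `ℓ¹` norm dominates because the weights are
at least one, and the other in `ℓ¹`. -/
theorem norm_pairing_le {s : ℝ} (hs : 0 ≤ s) (u v : W 𝒩 s) (n : Idx 𝒩) :
    ‖Complex.I * sgn n * u.seq n.conj * v.seq n‖ ≤ ‖u‖ * (wt s n * ‖v.seq n‖) := by
  have h1 : ‖u.seq n.conj‖ ≤ ‖u‖ := le_trans
    (le_mul_of_one_le_left (norm_nonneg _) (one_le_wt hs n.conj)) (u.wt_mul_le n.conj)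
  rw [norm_mul, norm_mul, norm_mul, Complex.norm_I, norm_sgn, one_mul, one_mul]
  exact mul_le_mul h1 (le_mul_of_one_le_left (norm_nonneg _) (one_le_wt hs n))
    (norm_nonneg _) (norm_nonneg _)

theorem summable_pairing {s : ℝ} (hs : 0 ≤ s) (u v : W 𝒩 s) :
    Summable fun n : Idx 𝒩 => Complex.I * sgn n * u.seq n.conj * v.seq n :=
  Summable.of_norm_bounded (v.summable.mul_left ‖u‖) (norm_pairing_le hs u v)

/-- The symplectic form as a continuous bilinear map on `𝒲^s`. -/
def sympForm {s : ℝ} (hs : 0 ≤ s) : W 𝒩 s →L[ℂ] W 𝒩 s →L[ℂ] ℂ :=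
  LinearMap.mkContinuous₂
    (LinearMap.mk₂ ℂ (fun u v : W 𝒩 s => ∑' n : Idx 𝒩, Complex.I * sgn n * u.seq n.conj * v.seq n)
      (fun u u' v => by
        rw [← (summable_pairing hs u v).tsum_add (summable_pairing hs u' v)]
        refine tsum_congr fun n => ?_
        simp only [seq_add, Pi.add_apply]; ring)
      (fun c u v => by
        rw [smul_eq_mul, ← tsum_mul_left]
        refine tsum_congr fun n => ?_
        simp only [seq_smul, Pi.smul_apply, smul_eq_mul]; ring)
      (fun u v v' => by
        rw [← (summable_pairing hs u v).tsum_add (summable_pairing hs u v')]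
        refine tsum_congr fun n => ?_
        simp only [seq_add, Pi.add_apply]; ring)
      (fun c u v => by
        rw [smul_eq_mul, ← tsum_mul_left]
        refine tsum_congr fun n => ?_
        simp only [seq_smul, Pi.smul_apply, smul_eq_mul]; ring)) 1 (fun u v => by
        rw [one_mul]
        have := tsum_of_norm_bounded ((v.summable.mul_left ‖u‖).hasSum) (norm_pairing_le hs u v)
        rwa [tsum_mul_left, ← v.norm_eq] at this)

theorem sympForm_apply {s : ℝ} (hs : 0 ≤ s) (u v : W 𝒩 s) :
    sympForm hs u v = ∑' n : Idx 𝒩, Complex.I * sgn n * u.seq n.conj * v.seq n := rfl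

theorem sympForm_eq_symplecticForm {s : ℝ} (hs : 0 ≤ s) (u v : W 𝒩 s) :
    sympForm hs u v = symplecticForm u.seq v.seq := by
  have h := summable_pairing hs u v
  have h1 := h.comp_injective (i := fun a : 𝒩 => ((a, 1) : Idx 𝒩))
    (fun a b hab => (Prod.ext_iff.1 hab).1)
  have h2 := h.comp_injective (i := fun a : 𝒩 => ((a, -1) : Idx 𝒩))
    (fun a b hab => (Prod.ext_iff.1 hab).1)
  rw [sympForm_apply, tsum_idx h, symplecticForm, ← tsum_mul_left]
  refine (h1.tsum_add h2).symm.trans (tsum_congr fun a => ?_)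
  simp [Idx.conj, sgn]
  ring

theorem sympForm_antisymm {s : ℝ} (hs : 0 ≤ s) (u v : W 𝒩 s) : sympForm hs u v = -sympForm hs v u := by
  rw [sympForm_apply, sympForm_apply, ← (conjEquiv 𝒩).tsum_eq, ← tsum_neg]
  refine tsum_congr fun n => ?_
  change Complex.I * sgn n.conj * u.seq n.conj.conj * v.seq n.conj = _
  rw [conj_conj, sgn_conj]
  ring

theorem sympForm_basisW {s : ℝ} (hs : 0 ≤ s) (u : W 𝒩 s) (n : Idx 𝒩) :
    sympForm hs u (basisW s n) = Complex.I * sgn n * u.seq n.conj := by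
  rw [sympForm_apply, tsum_eq_single n]
  · simp [basisW_seq]
  · intro m hm
    simp [basisW_seq, hm]

theorem update_eq (ζ : SeqSp 𝒩) (s : ℝ) (n : Idx 𝒩) (z : ℂ) [DecidableEq (Idx 𝒩)] :
    Function.update ζ n z = ζ + (z - ζ n) • (basisW s n).seq := by
  funext m
  by_cases hm : m = n
  · subst hm; simp [basisW_seq]
  · simp [basisW_seq, hm]

theorem partialDeriv_eq {s : ℝ} {H : Ham 𝒩} {x : W 𝒩 s} {L : W 𝒩 s →L[ℂ] ℂ}
    (h : HasFDerivAt (fun y : W 𝒩 s => H y.seq) L x) (n : Idx 𝒩) :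
    partialDeriv H n x.seq = L (basisW s n) := by
  have h1 : HasDerivAt (fun z : ℂ => x + (z - x.seq n) • basisW s n) (basisW s n) (x.seq n) := by
    have := (((hasDerivAt_id (x.seq n)).sub_const (x.seq n)).smul_const (basisW s n)).const_add x
    simpa using this
  have h2 : HasFDerivAt (fun y : W 𝒩 s => H y.seq) L (x + (x.seq n - x.seq n) • basisW s n) := by
    simpa using h
  have h3 := h2.comp_hasDerivAt (x.seq n) h1
  refine HasDerivAt.deriv (h3.congr_of_eventuallyEq (Eventually.of_forall fun z => ?_))
  simp only [Function.comp, update_eq x.seq s n z]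
  rfl

/-- Link between the coordinatewise field and differentials: once `dH` is written as `Ω(X, ·)`, the
signs `sgn² = 1`, `I² = -1` and `sgn n.conj = -sgn n` cancel and leave `X`. -/
theorem vectorField_eq {s : ℝ} (hs : 0 ≤ s) {H : Ham 𝒩} {x X : W 𝒩 s}
    (h : HasFDerivAt (fun y : W 𝒩 s => H y.seq) (sympForm hs X) x) :
    vectorField H x.seq = X.seq := by
  funext n
  change Complex.I * sgn n * partialDeriv H n.conj x.seq = _
  rw [partialDeriv_eq h, sympForm_basisW, conj_conj, sgn_conj]
  linear_combination (- X.seq n * sgn n * sgn n) * Complex.I_mul_I + X.seq n * sgn_mul_self n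

end

/-! ### Multilinear maps defined by families of coefficients. -/

section

variable {d : ℕ} {𝒩 : Set (Fin d → ℤ)}

/-- Tonelli for nonnegative terms, by induction on the number of factors. It is the source of
absolute convergence for all the power series below. -/
theorem hasSum_prod_pi {ι : Type*} {m : ℕ} (f : Fin m → ι → ℝ) (hf : ∀ i n, 0 ≤ f i n)
    (h : ∀ i, Summable (f i)) :
    HasSum (fun j : Fin m → ι => ∏ i, f i (j i)) (∏ i, ∑' n, f i n) := by
  induction m with
  | zero =>
    simp only [Finset.univ_eq_empty, Finset.prod_empty]
    exact hasSum_unique _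
  | succ m ih =>
    have h1 := ih (fun i => f i.succ) (fun i => hf _) (fun i => h _)
    set G : (Fin m → ι) → ℝ := fun j => ∏ i : Fin m, f i.succ (j i) with hG
    have hG0 : 0 ≤ G := fun j => Finset.prod_nonneg fun i _ => hf _ _
    have h0 : 0 ≤ f 0 := hf 0
    have hs : Summable fun p : ι × (Fin m → ι) => f 0 p.1 * G p.2 :=
      Summable.mul_of_nonneg (h 0) h1.summable h0 hG0
    have h2 : HasSum (fun p : ι × (Fin m → ι) => f 0 p.1 * G p.2)
        ((∑' n, f 0 n) * ∏ i : Fin m, ∑' n, f i.succ n) :=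
      HasSum.mul (h 0).hasSum h1 hs
    rw [Fin.prod_univ_succ, ← (Fin.consEquiv fun _ => ι).hasSum_iff]
    convert h2 using 2 with p
    simp [Fin.prod_univ_succ, Fin.consEquiv, hG]

variable {E : Type*} [NormedAddCommGroup E] [NormedSpace ℂ E] {m : ℕ}

theorem norm_family_le {s C : ℝ} {b : (Fin m → Idx 𝒩) → E}
    (hb : ∀ j, ‖b j‖ ≤ C * ∏ i, wt s (j i)) (v : Fin m → W 𝒩 s) (j : Fin m → Idx 𝒩) :
    ‖(∏ i, (v i).seq (j i)) • b j‖ ≤ C * ∏ i, wt s (j i) * ‖(v i).seq (j i)‖ := by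
  rw [norm_smul, norm_prod, Finset.prod_mul_distrib]
  calc _ ≤ (∏ i, ‖(v i).seq (j i)‖) * (C * ∏ i, wt s (j i)) :=
        mul_le_mul_of_nonneg_left (hb j) (Finset.prod_nonneg fun _ _ => norm_nonneg _)
    _ = _ := by ring

theorem hasSum_prod_norm {s : ℝ} (v : Fin m → W 𝒩 s) :
    HasSum (fun j : Fin m → Idx 𝒩 => ∏ i, wt s (j i) * ‖(v i).seq (j i)‖) (∏ i, ‖v i‖) := by
  have := hasSum_prod_pi (fun i n => wt s n * ‖(v i).seq n‖)
    (fun i n => mul_nonneg (wt_nonneg _ _) (norm_nonneg _)) (fun i => (v i).summable)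
  simpa only [← W.norm_eq] using this

variable [CompleteSpace E]

theorem summable_family {s C : ℝ} {b : (Fin m → Idx 𝒩) → E}
    (hb : ∀ j, ‖b j‖ ≤ C * ∏ i, wt s (j i)) (v : Fin m → W 𝒩 s) :
    Summable fun j => (∏ i, (v i).seq (j i)) • b j :=
  Summable.of_norm_bounded ((hasSum_prod_norm v).summable.mul_left C) (norm_family_le hb v)

/-- The continuous multilinear map on `𝒲^s` with prescribed values on the basis vectors. -/
def familyMap {s C : ℝ} {b : (Fin m → Idx 𝒩) → E}
    (hb : ∀ j, ‖b j‖ ≤ C * ∏ i, wt s (j i)) :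
    ContinuousMultilinearMap ℂ (fun _ : Fin m => W 𝒩 s) E :=
  MultilinearMap.mkContinuous
    { toFun := fun v => ∑' j : Fin m → Idx 𝒩, (∏ i, (v i).seq (j i)) • b j
      map_update_add' := by
        intro _ v i x y
        rw [← (summable_family hb _).tsum_add (summable_family hb _)]
        refine tsum_congr fun j => ?_
        have := ((MultilinearMap.mkPiRing ℂ (Fin m) (b j)).compLinearMap
          (fun i => (coord s (j i)).toLinearMap)).map_update_add v i x y
        simpa only [MultilinearMap.compLinearMap_apply, MultilinearMap.mkPiRing_apply,
          ContinuousLinearMap.coe_coe, coord_apply] using this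
      map_update_smul' := by
        intro _ v i c x
        rw [← (summable_family hb _).tsum_const_smul]
        refine tsum_congr fun j => ?_
        have := ((MultilinearMap.mkPiRing ℂ (Fin m) (b j)).compLinearMap
          (fun i => (coord s (j i)).toLinearMap)).map_update_smul v i c x
        simpa only [MultilinearMap.compLinearMap_apply, MultilinearMap.mkPiRing_apply,
          ContinuousLinearMap.coe_coe, coord_apply] using this } C (fun v => by
        have := tsum_of_norm_bounded ((hasSum_prod_norm v).mul_left C) (norm_family_le hb v)
        exact this)

theorem familyMap_apply {s C : ℝ} {b : (Fin m → Idx 𝒩) → E}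
    (hb : ∀ j, ‖b j‖ ≤ C * ∏ i, wt s (j i)) (v : Fin m → W 𝒩 s) :
    familyMap hb v = ∑' j : Fin m → Idx 𝒩, (∏ i, (v i).seq (j i)) • b j := rfl

theorem norm_familyMap_apply_le {s C : ℝ} {b : (Fin m → Idx 𝒩) → E}
    (hb : ∀ j, ‖b j‖ ≤ C * ∏ i, wt s (j i)) (v : Fin m → W 𝒩 s) :
    ‖familyMap hb v‖ ≤ C * ∏ i, ‖v i‖ :=
  tsum_of_norm_bounded ((hasSum_prod_norm v).mul_left C) (norm_family_le hb v)

/-- The homogeneous polynomial map attached to a family. -/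
def familyPoly {s C : ℝ} {b : (Fin m → Idx 𝒩) → E}
    (hb : ∀ j, ‖b j‖ ≤ C * ∏ i, wt s (j i)) (x : W 𝒩 s) : E := familyMap hb fun _ => x

theorem contDiff_familyPoly {s C : ℝ} {b : (Fin m → Idx 𝒩) → E}
    (hb : ∀ j, ‖b j‖ ≤ C * ∏ i, wt s (j i)) : ContDiff ℂ ω (familyPoly hb) :=
  (familyMap hb).contDiff.comp (contDiff_pi.2 fun _ => contDiff_id)

theorem hasFDerivAt_familyPoly {s C : ℝ} {b : (Fin m → Idx 𝒩) → E}
    (hb : ∀ j, ‖b j‖ ≤ C * ∏ i, wt s (j i)) (x : W 𝒩 s) :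
    HasFDerivAt (familyPoly hb)
      (((familyMap hb).linearDeriv fun _ => x).comp
        (ContinuousLinearMap.pi fun _ => ContinuousLinearMap.id ℂ (W 𝒩 s))) x :=
  ((familyMap hb).hasFDerivAt fun _ => x).comp x
    (hasFDerivAt_pi.2 fun _ => hasFDerivAt_id x)

theorem fderiv_familyPoly {s C : ℝ} {b : (Fin m → Idx 𝒩) → E}
    (hb : ∀ j, ‖b j‖ ≤ C * ∏ i, wt s (j i)) (x v : W 𝒩 s) :
    fderiv ℂ (familyPoly hb) x v =
      ∑ i, familyMap hb (Function.update (fun _ => x) i v) := by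
  rw [(hasFDerivAt_familyPoly hb x).fderiv]
  simp

theorem norm_familyPoly_le {s C : ℝ} {b : (Fin m → Idx 𝒩) → E}
    (hb : ∀ j, ‖b j‖ ≤ C * ∏ i, wt s (j i)) (x : W 𝒩 s) :
    ‖familyPoly hb x‖ ≤ C * ‖x‖ ^ m := by
  rw [familyPoly]
  refine (norm_familyMap_apply_le hb fun _ => x).trans (le_of_eq ?_)
  rw [Finset.prod_const, Finset.card_univ, Fintype.card_fin]

theorem norm_fderiv_familyPoly_le {s C : ℝ} {b : (Fin m → Idx 𝒩) → E}
    (hb : ∀ j, ‖b j‖ ≤ C * ∏ i, wt s (j i)) (x : W 𝒩 s) :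
    ‖fderiv ℂ (familyPoly hb) x‖ ≤ |C| * m * ‖x‖ ^ (m - 1) := by
  refine ContinuousLinearMap.opNorm_le_bound _ (by positivity) fun v => ?_
  rw [fderiv_familyPoly]
  refine (norm_sum_le _ _).trans ?_
  have h : ∀ i ∈ (Finset.univ : Finset (Fin m)),
      ‖familyMap hb (Function.update (fun _ => x) i v)‖ ≤ |C| * (‖v‖ * ‖x‖ ^ (m - 1)) := by
    intro i _
    refine (norm_familyMap_apply_le hb _).trans ?_
    have : ∏ i', ‖Function.update (fun _ => x) i v i'‖ = ‖v‖ * ‖x‖ ^ (m - 1) := by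
      rw [← Finset.mul_prod_erase _ _ (Finset.mem_univ i), Function.update_self]
      congr 1
      rw [Finset.prod_congr rfl (g := fun _ => ‖x‖)]
      · simp [Finset.card_erase_of_mem]
      · intro i' hi'
        rw [Function.update_of_ne (Finset.ne_of_mem_erase hi')]
    rw [this]
    exact mul_le_mul_of_nonneg_right (le_abs_self _) (by positivity)
  refine (Finset.sum_le_sum h).trans (le_of_eq ?_)
  simp
  ring

end

/-! ### Polynomial Hamiltonians and their vector fields. -/

section

variable {d : ℕ} {𝒩 : Set (Fin d → ℤ)}

/-- Coefficients of a polynomial: `A m` belongs to the part of degree `m + 1`. -/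
abbrev Coef (𝒩 : Set (Fin d → ℤ)) : Type := (m : ℕ) → (Fin (m + 1) → Idx 𝒩) → ℂ

/-- The polynomial with coefficients `A`, of degree at most `K + 1`. -/
def polyFun (K : ℕ) (A : Coef 𝒩) (ζ : SeqSp 𝒩) : ℂ :=
  ∑ m ∈ Finset.Icc 1 K, ∑' j, A m j * ∏ i, ζ (j i)

/-- The gradient of `polyFun K A`. -/
def polyGrad (K : ℕ) (A : Coef 𝒩) (ζ : SeqSp 𝒩) (n : Idx 𝒩) : ℂ :=
  ∑ m ∈ Finset.Icc 1 K, ∑ i : Fin (m + 1), ∑' j : Fin m → Idx 𝒩,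
    A m (i.insertNth n j : Fin (m + 1) → Idx 𝒩) * ∏ i', ζ (j i')

/-- The Hamiltonian vector field of `polyFun K A`. -/
def polyField (K : ℕ) (A : Coef 𝒩) (ζ : SeqSp 𝒩) : SeqSp 𝒩 :=
  fun n => Complex.I * sgn n * polyGrad K A ζ n.conj

/-- Only monomials of zero momentum occur. -/
def HasZeroMomentum (A : Coef 𝒩) : Prop := ∀ m j, momentum j ≠ 0 → A m j = 0

/-- The bound on the coefficients that makes the polynomial bounded on `𝒲^s`. -/
def FunBound (s C : ℝ) (A : Coef 𝒩) : Prop := ∀ m j, ‖A m j‖ ≤ C * ∏ i, wt s (j i)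

/-- The bound on the coefficients that makes the vector field bounded from `𝒲^{s'}` to `𝒲^s`. -/
structure VecBound (s' s C : ℝ) (A : Coef 𝒩) : Prop where
  nonneg : 0 ≤ C
  zero : HasZeroMomentum A
  le : ∀ m (i : Fin (m + 1)) (n : Idx 𝒩) (j : Fin m → Idx 𝒩),
    wt s n * ‖A m (i.insertNth n j : Fin (m + 1) → Idx 𝒩)‖ ≤ C * ∏ i', wt s' (j i')

theorem momentum_insertNth {m : ℕ} (i : Fin (m + 1)) (n : Idx 𝒩) (j : Fin m → Idx 𝒩) :
    momentum (i.insertNth n j : Fin (m + 1) → Idx 𝒩)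
      = (n.2 : ℤ) • (n.1 : Fin d → ℤ) + momentum j := by
  simp [momentum, Fin.sum_univ_succAbove _ i]

theorem summable_and_tsum_le_of_subsingleton {ι : Type*} {f : ι → ℝ} {B : ℝ} (hB : 0 ≤ B)
    (hf : ∀ a, f a ≤ B) (h : ∀ a b, f a ≠ 0 → f b ≠ 0 → a = b) :
    Summable f ∧ ∑' a, f a ≤ B := by
  by_cases h0 : ∃ a, f a ≠ 0
  · obtain ⟨a, ha⟩ := h0
    have hz : ∀ b, b ≠ a → f b = 0 := fun b hb => by
      by_contra hb'
      exact hb (h b a hb' ha)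
    have := hasSum_single a hz
    exact ⟨this.summable, this.tsum_eq.trans_le (hf a)⟩
  · push Not at h0
    have : f = 0 := funext h0
    subst this
    exact ⟨summable_zero, by simpa using hB⟩

/-- One monomial of the vector field, as a sequence. -/
def monoSeq (A : Coef 𝒩) (m : ℕ) (i : Fin (m + 1)) (j : Fin m → Idx 𝒩) : SeqSp 𝒩 :=
  fun n => Complex.I * sgn n * A m (i.insertNth n.conj j : Fin (m + 1) → Idx 𝒩)

theorem norm_monoSeq (A : Coef 𝒩) (m : ℕ) (i : Fin (m + 1)) (j : Fin m → Idx 𝒩) (n : Idx 𝒩) :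
    ‖monoSeq A m i j n‖ = ‖A m (i.insertNth n.conj j : Fin (m + 1) → Idx 𝒩)‖ := by
  rw [monoSeq, norm_mul, norm_mul, Complex.norm_I, norm_sgn, one_mul, one_mul]

/-- Once `j` and the sign `σ` are fixed, zero momentum determines the remaining mode. The `ℓ¹_s`
norm of each component thus has at most one nonzero term, and a supremum bound on coefficients
suffices. -/
theorem monoSeq_aux {s' s C : ℝ} {A : Coef 𝒩} (h : VecBound s' s C A) (m : ℕ)
    (i : Fin (m + 1)) (j : Fin m → Idx 𝒩) (σ : ℤˣ) :
    (Summable fun a : 𝒩 => wt s (a, σ) * ‖monoSeq A m i j (a, σ)‖) ∧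
      ∑' a : 𝒩, wt s (a, σ) * ‖monoSeq A m i j (a, σ)‖ ≤ C * ∏ i', wt s' (j i') := by
  refine summable_and_tsum_le_of_subsingleton
    (mul_nonneg h.nonneg (Finset.prod_nonneg fun _ _ => wt_nonneg _ _)) (fun a => ?_) ?_
  · rw [norm_monoSeq]
    exact h.le m i (Idx.conj (a, σ)) j
  · have key : ∀ a : 𝒩, wt s (a, σ) * ‖monoSeq A m i j (a, σ)‖ ≠ 0 →
        ((-σ : ℤˣ) : ℤ) • (a : Fin d → ℤ) + momentum j = 0 := by
      intro a ha
      by_contra hne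
      refine ha ?_
      rw [norm_monoSeq, h.zero m _ (by rw [momentum_insertNth]; exact hne), norm_zero, mul_zero]
    intro a b ha hb
    have h1 := (key a ha).trans (key b hb).symm
    have h2 := add_right_cancel h1
    refine Subtype.ext (funext fun x => ?_)
    have h3 := congrFun h2 x
    simp only [Pi.smul_apply, smul_eq_mul] at h3
    exact mul_left_cancel₀ (Units.ne_zero (-σ)) h3

theorem VecBound.memW {s' s C : ℝ} {A : Coef 𝒩} (h : VecBound s' s C A) (m : ℕ)
    (i : Fin (m + 1)) (j : Fin m → Idx 𝒩) : MemW s (monoSeq A m i j) :=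
  fun σ => (monoSeq_aux h m i j σ).1

/-- One monomial of the vector field. -/
def VecBound.mono {s' s C : ℝ} {A : Coef 𝒩} (h : VecBound s' s C A) (m : ℕ)
    (i : Fin (m + 1)) (j : Fin m → Idx 𝒩) : W 𝒩 s := toW s (monoSeq A m i j) (h.memW m i j)

theorem VecBound.norm_mono_le {s' s C : ℝ} {A : Coef 𝒩} (h : VecBound s' s C A) (m : ℕ)
    (i : Fin (m + 1)) (j : Fin m → Idx 𝒩) : ‖h.mono m i j‖ ≤ 2 * C * ∏ i', wt s' (j i') := by
  rw [W.norm_eq_normW, VecBound.mono, toW_seq, normW]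
  have h1 := (monoSeq_aux h m i j 1).2
  have h2 := (monoSeq_aux h m i j (-1)).2
  change (∑' a : 𝒩, wt s (a, 1) * ‖monoSeq A m i j (a, 1)‖)
    + (∑' a : 𝒩, wt s (a, -1) * ‖monoSeq A m i j (a, -1)‖) ≤ _
  linarith

/-- The vector field of `polyFun K A` as a map from `𝒲^{s'}` to `𝒲^s`. -/
def VecBound.field {s' s C : ℝ} {A : Coef 𝒩} (h : VecBound s' s C A) (K : ℕ) (x : W 𝒩 s') :
    W 𝒩 s :=
  ∑ m ∈ Finset.Icc 1 K, ∑ i : Fin (m + 1), familyPoly (h.norm_mono_le m i) x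

theorem seq_sum {s : ℝ} {ι : Type*} (t : Finset ι) (f : ι → W 𝒩 s) (n : Idx 𝒩) :
    (∑ i ∈ t, f i).seq n = ∑ i ∈ t, (f i).seq n := map_sum (coord s n) f t

theorem VecBound.field_seq {s' s C : ℝ} {A : Coef 𝒩} (h : VecBound s' s C A) (K : ℕ)
    (x : W 𝒩 s') : (h.field K x).seq = polyField K A x.seq := by
  funext n
  rw [VecBound.field, polyField, polyGrad, seq_sum, Finset.mul_sum]
  refine Finset.sum_congr rfl fun m _ => ?_
  rw [seq_sum, Finset.mul_sum]
  refine Finset.sum_congr rfl fun i _ => ?_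
  rw [familyPoly, familyMap_apply, ← coord_apply,
    (coord s n).map_tsum (summable_family (h.norm_mono_le m i) _), ← tsum_mul_left]
  refine tsum_congr fun j => ?_
  rw [map_smul, coord_apply, VecBound.mono, toW_seq, monoSeq, smul_eq_mul]
  ring

theorem VecBound.contDiff_field {s' s C : ℝ} {A : Coef 𝒩} (h : VecBound s' s C A) (K : ℕ) :
    ContDiff ℂ ω (h.field K) :=
  ContDiff.sum fun m _ => ContDiff.sum fun i _ => contDiff_familyPoly (h.norm_mono_le m i)

/-- A constant bounding polynomial fields of degree at most `K` on the ball of radius `r`. -/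
def growth (K : ℕ) (r : ℝ) : ℝ :=
  ∑ m ∈ Finset.Icc 1 K, ∑ _i : Fin (m + 1), (2 * r ^ m + 2 * m * r ^ (m - 1))

theorem growth_nonneg (K : ℕ) {r : ℝ} (hr : 0 ≤ r) : 0 ≤ growth K r := by
  unfold growth
  positivity

theorem VecBound.norm_field_le {s' s C : ℝ} {A : Coef 𝒩} (h : VecBound s' s C A) (K : ℕ)
    {x : W 𝒩 s'} {r : ℝ} (hx : ‖x‖ ≤ r) : ‖h.field K x‖ ≤ C * growth K r := by
  have hr : 0 ≤ r := (norm_nonneg _).trans hx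
  have hC := h.nonneg
  rw [VecBound.field, growth, Finset.mul_sum]
  refine norm_sum_le_of_le _ fun m _ => ?_
  rw [Finset.mul_sum]
  refine norm_sum_le_of_le _ fun i _ => (norm_familyPoly_le (h.norm_mono_le m i) x).trans ?_
  have h1 : ‖x‖ ^ m ≤ r ^ m := pow_le_pow_left₀ (norm_nonneg _) hx m
  have h2 : 0 ≤ C * (2 * m * r ^ (m - 1)) := by positivity
  nlinarith [mul_le_mul_of_nonneg_left h1 hC]

theorem VecBound.norm_fderiv_field_le {s' s C : ℝ} {A : Coef 𝒩} (h : VecBound s' s C A) (K : ℕ)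
    {x : W 𝒩 s'} {r : ℝ} (hx : ‖x‖ ≤ r) : ‖fderiv ℂ (h.field K) x‖ ≤ C * growth K r := by
  have hr : 0 ≤ r := (norm_nonneg _).trans hx
  have hC := h.nonneg
  have hd : HasFDerivAt (h.field K) (∑ m ∈ Finset.Icc 1 K, ∑ i : Fin (m + 1),
      fderiv ℂ (familyPoly (h.norm_mono_le m i)) x) x :=
    HasFDerivAt.fun_sum fun m _ => HasFDerivAt.fun_sum fun i _ =>
      (hasFDerivAt_familyPoly (h.norm_mono_le m i) x).differentiableAt.hasFDerivAt
  rw [hd.fderiv, growth, Finset.mul_sum]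
  refine norm_sum_le_of_le _ fun m _ => ?_
  rw [Finset.mul_sum]
  refine norm_sum_le_of_le _ fun i _ => (norm_fderiv_familyPoly_le (h.norm_mono_le m i) x).trans ?_
  have h1 : ‖x‖ ^ (m - 1) ≤ r ^ (m - 1) := pow_le_pow_left₀ (norm_nonneg _) hx _
  have h2 : 0 ≤ C * (2 * r ^ m) := by positivity
  rw [abs_of_nonneg (by positivity)]
  have h3 : 2 * C * m * ‖x‖ ^ (m - 1) ≤ 2 * C * m * r ^ (m - 1) :=
    mul_le_mul_of_nonneg_left h1 (by positivity)
  linarith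

theorem VecBound.norm_field_sub_le {s' s C : ℝ} {A : Coef 𝒩} (h : VecBound s' s C A) (K : ℕ)
    {x y : W 𝒩 s'} {r : ℝ} (hx : ‖x‖ ≤ r) (hy : ‖y‖ ≤ r) :
    ‖h.field K x - h.field K y‖ ≤ C * growth K r * ‖x - y‖ :=
  (convex_closedBall (0 : W 𝒩 s') r).norm_image_sub_le_of_norm_fderiv_le (𝕜 := ℂ)
    (fun z _ => ((h.contDiff_field K).differentiable (by simp)) z)
    (fun z hz => h.norm_fderiv_field_le K (by simpa using hz)) (by simpa using hy)
    (by simpa using hx)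

theorem VecBound.mul {s' s C D : ℝ} {A q : Coef 𝒩} (h : VecBound s' s C A)
    (hq : ∀ m j, ‖q m j‖ ≤ D) (hD : 0 ≤ D) :
    VecBound s' s (C * D) (fun m j => A m j * q m j) where
  nonneg := mul_nonneg h.nonneg hD
  zero m j hj := by simp only [h.zero m j hj, zero_mul]
  le m i n j := by
    rw [norm_mul, ← mul_assoc]
    refine (mul_le_mul (h.le m i n j) (hq _ _) (norm_nonneg _)
      (mul_nonneg h.nonneg (Finset.prod_nonneg fun _ _ => wt_nonneg _ _))).trans (le_of_eq ?_)
    ring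

theorem VecBound.field_add {s' s C C' D : ℝ} {A B A' : Coef 𝒩} (h : VecBound s' s C A)
    (h' : VecBound s' s C' B) (h'' : VecBound s' s D A') (hA : ∀ m j, A' m j = A m j + B m j)
    (K : ℕ) (x : W 𝒩 s') : h''.field K x = h.field K x + h'.field K x := by
  simp only [VecBound.field, ← Finset.sum_add_distrib]
  refine Finset.sum_congr rfl fun m _ => Finset.sum_congr rfl fun i _ => ?_
  simp only [familyPoly, familyMap_apply]
  rw [← (summable_family (h.norm_mono_le m i) _).tsum_add (summable_family (h'.norm_mono_le m i) _)]
  refine tsum_congr fun j => ?_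
  rw [← smul_add]
  congr 1
  refine W.ext_seq (funext fun n => ?_)
  simp only [VecBound.mono, toW_seq, seq_add, Pi.add_apply, monoSeq, hA, mul_add]

/-- `polyFun K A` as a function on `𝒲^s`. -/
def FunBound.map {s C : ℝ} {A : Coef 𝒩} (h : FunBound s C A) (K : ℕ) (x : W 𝒩 s) : ℂ :=
  ∑ m ∈ Finset.Icc 1 K, familyPoly (h m) x

theorem FunBound.map_eq {s C : ℝ} {A : Coef 𝒩} (h : FunBound s C A) (K : ℕ) (x : W 𝒩 s) :
    polyFun K A x.seq = h.map K x := by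
  rw [polyFun, FunBound.map]
  refine Finset.sum_congr rfl fun m _ => ?_
  rw [familyPoly, familyMap_apply]
  exact tsum_congr fun j => mul_comm _ _

theorem FunBound.contDiff {s C : ℝ} {A : Coef 𝒩} (h : FunBound s C A) (K : ℕ) :
    ContDiff ℂ ω fun x : W 𝒩 s => polyFun K A x.seq := by
  simp only [h.map_eq K]
  exact ContDiff.sum fun m _ => contDiff_familyPoly (h m)

theorem FunBound.mul {s C D : ℝ} {A q : Coef 𝒩} (h : FunBound s C A)
    (hq : ∀ m j, ‖q m j‖ ≤ D) :
    FunBound s (C * D) (fun m j => A m j * q m j) := by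
  intro m j
  rw [norm_mul]
  have h1 := h m j
  refine (mul_le_mul h1 (hq _ _) (norm_nonneg _) ((norm_nonneg _).trans h1)).trans (le_of_eq ?_)
  ring

theorem FunBound.mono {s s' C : ℝ} (hs : s ≤ s') {A : Coef 𝒩} (hC : 0 ≤ C) (h : FunBound s C A) :
    FunBound s' C A := fun m j => (h m j).trans
  (mul_le_mul_of_nonneg_left (Finset.prod_le_prod (fun _ _ => wt_nonneg _ _)
    fun i _ => wt_mono hs (j i)) hC)

/-- A basis vector in slot `i` kills all multi-indices except those with `n` in that slot, which
`insertNth` parametrizes. -/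
theorem familyMap_update_basisW {s C : ℝ} {A : Coef 𝒩} (h : FunBound s C A) (m : ℕ)
    (i : Fin (m + 1)) (n : Idx 𝒩) (x : W 𝒩 s) :
    familyMap (h m) (Function.update (fun _ => x) i (basisW s n)) =
      ∑' j : Fin m → Idx 𝒩,
        A m (i.insertNth n j : Fin (m + 1) → Idx 𝒩) * ∏ i', x.seq (j i') := by
  rw [familyMap_apply]
  have hinj : Function.Injective
      fun j : Fin m → Idx 𝒩 => (i.insertNth n j : Fin (m + 1) → Idx 𝒩) := by
    intro a b hab
    have := congrArg (fun f : Fin (m + 1) → Idx 𝒩 => i.removeNth f) hab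
    simpa using this
  have hsupp : Function.support (fun j : Fin (m + 1) → Idx 𝒩 =>
      (∏ i', (Function.update (fun _ => x) i (basisW s n) i').seq (j i')) • A m j) ⊆
      Set.range fun j : Fin m → Idx 𝒩 => (i.insertNth n j : Fin (m + 1) → Idx 𝒩) := by
    intro j hj
    refine ⟨fun i' => j (i.succAbove i'), ?_⟩
    have hn : j i = n := by
      by_contra hne
      refine hj ?_
      simp only
      rw [Fin.prod_univ_succAbove _ i, Function.update_self, basisW_seq]
      simp [hne]
    subst hn
    exact Fin.insertNth_self_removeNth i j
  rw [← hinj.tsum_eq hsupp]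
  refine tsum_congr fun j => ?_
  rw [Fin.prod_univ_succAbove _ i, Function.update_self, basisW_seq]
  simp [mul_comm]

/-- Two scales are needed: the function is differentiable on `𝒲^s`, but its differential is
represented by an element of `𝒲^s` only at points of the smoother space `𝒲^{s'}`. All vector fields
with loss of derivatives are obtained this way. -/
theorem hasFDerivAt_polyFun {s s' C C' : ℝ} (hs : 0 ≤ s) (hss : s ≤ s') {A : Coef 𝒩}
    (h : FunBound s C A) (h' : VecBound s' s C' A) (K : ℕ) (x : W 𝒩 s') :
    HasFDerivAt (fun y : W 𝒩 s => polyFun K A y.seq) (sympForm hs (h'.field K x))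
      (incl hss x) := by
  have hd : HasFDerivAt (fun y : W 𝒩 s => polyFun K A y.seq) (∑ m ∈ Finset.Icc 1 K,
      fderiv ℂ (familyPoly (h m)) (incl hss x)) (incl hss x) := by
    simp only [h.map_eq K]
    exact HasFDerivAt.fun_sum fun m _ =>
      (hasFDerivAt_familyPoly (h m) _).differentiableAt.hasFDerivAt
  refine hd.congr_fderiv (clm_ext fun n => ?_)
  rw [sympForm_basisW, h'.field_seq, polyField, conj_conj, sgn_conj]
  have : Complex.I * sgn n * (Complex.I * -sgn n * polyGrad K A x.seq n)
      = polyGrad K A x.seq n := by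
    linear_combination (-polyGrad K A x.seq n * sgn n * sgn n) * Complex.I_mul_I
      + polyGrad K A x.seq n * sgn_mul_self n
  rw [this, polyGrad, sum_apply]
  refine Finset.sum_congr rfl fun m _ => ?_
  rw [fderiv_familyPoly]
  refine Finset.sum_congr rfl fun i _ => ?_
  rw [familyMap_update_basisW h, incl_seq]

end

/-! ### Inversion of `id - Y`, and the midpoint map. -/

section

section Banach

variable {E : Type*} [NormedAddCommGroup E] [NormedSpace ℂ E]

/-- The smallness conditions on `Y` under which `id ± Y` can be inverted near the ball of
radius `r`. -/
structure SmallField (Y : E → E) (r : ℝ) : Prop where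
  contDiff : ContDiff ℂ ω Y
  norm_le : ∀ x, ‖x‖ < 2 * r → ‖Y x‖ ≤ r / 4
  norm_fderiv_le : ∀ x, ‖x‖ < 2 * r → ‖fderiv ℂ Y x‖ ≤ 1 / 4

theorem SmallField.neg {Y : E → E} {r : ℝ} (h : SmallField Y r) : SmallField (fun x => -Y x) r where
  contDiff := h.contDiff.neg
  norm_le x hx := by rw [norm_neg]; exact h.norm_le x hx
  norm_fderiv_le x hx := by
    rw [fderiv_fun_neg, norm_neg]; exact h.norm_fderiv_le x hx

theorem SmallField.norm_sub_le {Y : E → E} {r : ℝ} (h : SmallField Y r) {x y : E}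
    (hx : ‖x‖ < 2 * r) (hy : ‖y‖ < 2 * r) : ‖Y x - Y y‖ ≤ 1 / 4 * ‖x - y‖ :=
  (convex_ball (0 : E) (2 * r)).norm_image_sub_le_of_norm_fderiv_le (𝕜 := ℂ)
    (fun z _ => (h.contDiff.differentiable (by simp)) z)
    (fun z hz => h.norm_fderiv_le z (by simpa using hz)) (by simpa using hy) (by simpa using hx)

theorem SmallField.injective {Y : E → E} {r : ℝ} (h : SmallField Y r) {x y : E}
    (hx : ‖x‖ < 2 * r) (hy : ‖y‖ < 2 * r) (hxy : x - Y x = y - Y y) : x = y := by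
  have h1 := h.norm_sub_le hx hy
  have h2 : x - y = Y x - Y y := by
    rw [sub_eq_sub_iff_add_eq_add] at hxy ⊢
    rw [hxy, add_comm]
  rw [← h2] at h1
  have h3 : ‖x - y‖ = 0 := le_antisymm (by linarith) (norm_nonneg _)
  exact sub_eq_zero.1 (norm_eq_zero.1 h3)

variable [CompleteSpace E]

/-- Banach fixed point theorem for `x ↦ z + Y x`. -/
theorem SmallField.exists_preimage {Y : E → E} {r : ℝ} (h : SmallField Y r) {z : E}
    (hz : ‖z‖ < r) : ∃ x, ‖x‖ < 2 * r ∧ x - Y x = z := by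
  have hr : 0 < r := (norm_nonneg _).trans_lt hz
  have hmem : ∀ x, x ∈ Metric.closedBall (0 : E) (3 / 2 * r) → ‖x‖ < 2 * r := fun x hx => by
    have : ‖x‖ ≤ 3 / 2 * r := by simpa using hx
    linarith
  -- The radius `3r/2` leaves room on both sides: `r + r/4 ≤ 3r/2 < 2r`.
  have hmaps : MapsTo (fun x => z + Y x) (Metric.closedBall (0 : E) (3 / 2 * r))
      (Metric.closedBall (0 : E) (3 / 2 * r)) := by
    intro x hx
    have h1 := h.norm_le x (hmem x hx)
    have h2 := norm_add_le z (Y x)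
    simp only [Metric.mem_closedBall, dist_zero_right]
    linarith
  have hcontr : ContractingWith (1 / 4) (hmaps.restrict (fun x => z + Y x) _ _) := by
    refine ⟨by rw [← NNReal.coe_lt_coe]; norm_num, LipschitzWith.of_dist_le_mul ?_⟩
    rintro ⟨x, hx⟩ ⟨y, hy⟩
    rw [Subtype.dist_eq, Subtype.dist_eq, MapsTo.val_restrict_apply, MapsTo.val_restrict_apply,
      dist_add_left, dist_eq_norm, dist_eq_norm]
    have := h.norm_sub_le (hmem x hx) (hmem y hy)
    simpa using this
  obtain ⟨x, hx, hfix, -⟩ := ContractingWith.exists_fixedPoint'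
    (Metric.isClosed_closedBall.isComplete) hmaps hcontr (x := 0)
    (by simp; positivity) (edist_ne_top _ _)
  exact ⟨x, hmem x hx, by rw [sub_eq_iff_eq_add]; exact hfix.symm⟩

theorem exists_equiv_one_sub {A : E →L[ℂ] E} (hA : ‖A‖ ≤ 1 / 4) :
    ∃ e : E ≃L[ℂ] E, (e : E →L[ℂ] E) = ContinuousLinearMap.id ℂ E - A :=
  ⟨ContinuousLinearEquiv.unitsEquiv ℂ E (Units.oneSub A (by linarith)), by
    ext x; simp⟩

theorem exists_solution {A : E →L[ℂ] E} (hA : ‖A‖ ≤ 1 / 4) (q : E) :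
    ∃ w, w + A w = q ∧ ‖w‖ ≤ 2 * ‖q‖ := by
  obtain ⟨e, he⟩ := exists_equiv_one_sub (A := -A) (by rwa [norm_neg])
  have h1 : ∀ w, e w = w + A w := fun w => by
    change (e : E →L[ℂ] E) w = _
    rw [he]; simp
  refine ⟨e.symm q, by rw [← h1, e.apply_symm_apply], ?_⟩
  have h2 := h1 (e.symm q)
  rw [e.apply_symm_apply] at h2
  have h3 : e.symm q = q - A (e.symm q) := by rw [eq_sub_iff_add_eq]; exact h2.symm
  have h4 := norm_sub_le q (A (e.symm q))
  rw [← h3] at h4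
  have h5 := A.le_of_opNorm_le hA (e.symm q)
  linarith [norm_nonneg (e.symm q)]

/-- The inverse of `id - Y` on the ball of radius `r`. -/
def SmallField.inv {Y : E → E} {r : ℝ} (h : SmallField Y r) (z : E) : E :=
  open scoped Classical in
  if hz : ‖z‖ < r then (h.exists_preimage hz).choose else 0

theorem SmallField.norm_inv_lt {Y : E → E} {r : ℝ} (h : SmallField Y r) {z : E} (hz : ‖z‖ < r) :
    ‖h.inv z‖ < 2 * r := by
  rw [SmallField.inv, dif_pos hz]
  exact (h.exists_preimage hz).choose_spec.1

theorem SmallField.inv_sub {Y : E → E} {r : ℝ} (h : SmallField Y r) {z : E} (hz : ‖z‖ < r) :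
    h.inv z - Y (h.inv z) = z := by
  rw [SmallField.inv, dif_pos hz]
  exact (h.exists_preimage hz).choose_spec.2

theorem SmallField.inv_eq {Y : E → E} {r : ℝ} (h : SmallField Y r) {x : E} (hx : ‖x‖ < 2 * r)
    (hz : ‖x - Y x‖ < r) : h.inv (x - Y x) = x :=
  h.injective (h.norm_inv_lt hz) hx (h.inv_sub hz)

/-- `id - Y` is close to the identity on the whole ball of radius `2r`, so it is an open partial
homeomorphism there. Its inverse agrees with `inv` by uniqueness of the preimage, and it is analytic
because the differential is invertible. -/
theorem SmallField.analyticAt_inv {Y : E → E} {r : ℝ} (h : SmallField Y r) {z : E}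
    (hz : ‖z‖ < r) : AnalyticAt ℂ h.inv z := by
  have happ : ApproximatesLinearOn (fun x => x - Y x)
      ((ContinuousLinearEquiv.refl ℂ E : E ≃L[ℂ] E) : E →L[ℂ] E)
      (Metric.ball (0 : E) (2 * r)) (1 / 4) := by
    intro x hx y hy
    have := h.norm_sub_le (x := x) (y := y) (by simpa using hx) (by simpa using hy)
    have e : x - Y x - (y - Y y) - (x - y) = -(Y x - Y y) := by abel
    simpa [e, norm_sub_rev] using this
  -- The identity has norm one only on a nontrivial space.
  have hc : Subsingleton E ∨
      (1 / 4 : NNReal) < ‖((ContinuousLinearEquiv.refl ℂ E).symm : E →L[ℂ] E)‖₊⁻¹ := by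
    rcases subsingleton_or_nontrivial E with hE | hE
    · exact Or.inl hE
    · right
      have : ‖((ContinuousLinearEquiv.refl ℂ E).symm : E →L[ℂ] E)‖₊ = 1 := by
        rw [← NNReal.coe_inj]
        exact ContinuousLinearMap.norm_id
      rw [this, ← NNReal.coe_lt_coe]
      norm_num
  set g := happ.toOpenPartialHomeomorph _ _ hc Metric.isOpen_ball with hg
  have hgx : ∀ x, g x = x - Y x := fun x => rfl
  have hsrc : g.source = Metric.ball (0 : E) (2 * r) := rfl
  have heq : ∀ y, ‖y‖ < r → y ∈ g.target ∧ g.symm y = h.inv y := by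
    intro y hy
    have hm : h.inv y ∈ g.source := by
      rw [hsrc]; simpa using h.norm_inv_lt hy
    have h1 : g (h.inv y) = y := by rw [hgx, h.inv_sub hy]
    have h2 := g.map_source hm
    have h3 := g.left_inv hm
    rw [h1] at h2 h3
    exact ⟨h2, h3⟩
  obtain ⟨ht, hs⟩ := heq z hz
  obtain ⟨e, he⟩ := exists_equiv_one_sub (h.norm_fderiv_le _ (h.norm_inv_lt hz))
  have hd : HasFDerivAt g (e : E →L[ℂ] E) (g.symm z) := by
    rw [hs, he]
    exact (hasFDerivAt_id _).sub ((h.contDiff.differentiable (by simp)) _).hasFDerivAt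
  have hcd : ContDiffAt ℂ ω g (g.symm z) := (contDiff_id.sub h.contDiff).contDiffAt
  have han := (g.contDiffAt_symm ht hd hcd).analyticAt
  refine han.congr ?_
  filter_upwards [(isOpen_lt continuous_norm continuous_const).mem_nhds hz] with y hy
  exact (heq y hy).2

theorem SmallField.fderiv_inv {Y : E → E} {r : ℝ} (h : SmallField Y r) {z : E}
    (hz : ‖z‖ < r) (v : E) :
    fderiv ℂ h.inv z v - fderiv ℂ Y (h.inv z) (fderiv ℂ h.inv z v) = v := by
  have hS := (h.analyticAt_inv hz).differentiableAt.hasFDerivAt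
  have hY := ((h.contDiff.differentiable (by simp)) (h.inv z)).hasFDerivAt
  have h1 := hS.sub (hY.comp z hS)
  have h2 : HasFDerivAt (fun y : E => y) (ContinuousLinearMap.id ℂ E) z := hasFDerivAt_id z
  have h3 := h1.congr_of_eventuallyEq (f₁ := fun y : E => y) (by
    filter_upwards [(isOpen_lt continuous_norm continuous_const).mem_nhds hz] with y hy
    exact (h.inv_sub hy).symm)
  have h4 := congrArg (fun L : E →L[ℂ] E => L v) (h3.unique h2)
  simpa using h4

/-- The midpoint map `(id + Y) ∘ (id - Y)⁻¹`. -/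
def SmallField.midpoint {Y : E → E} {r : ℝ} (h : SmallField Y r) (z : E) : E :=
  h.inv z + Y (h.inv z)

theorem SmallField.analyticAt_midpoint {Y : E → E} {r : ℝ} (h : SmallField Y r) {z : E}
    (hz : ‖z‖ < r) : AnalyticAt ℂ h.midpoint z :=
  (h.analyticAt_inv hz).add
    (((h.contDiff.analyticOnNhd (s := univ)) _ (mem_univ _)).comp (h.analyticAt_inv hz))

theorem SmallField.midpoint_sub {Y : E → E} {r : ℝ} (h : SmallField Y r) {z : E}
    (hz : ‖z‖ < r) : h.midpoint z - z = (2 : ℂ) • Y (h.inv z) := by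
  have := h.inv_sub hz
  rw [SmallField.midpoint, two_smul]
  nth_rw 3 [← this]
  abel

/-- With `x = inv z`, the initial point is `x - Y x` and the image is `x + Y x`. Changing the sign
of `Y` exchanges them and keeps `x`, so the map built from `-Y` inverts the map built from `Y`. -/
theorem SmallField.inv_neg_midpoint {Y : E → E} {r : ℝ} (h : SmallField Y r) {z : E}
    (hz : ‖z‖ < r) (hz' : ‖h.midpoint z‖ < r) : h.neg.inv (h.midpoint z) = h.inv z := by
  have e : h.inv z - -Y (h.inv z) = h.midpoint z := sub_neg_eq_add _ _
  have := h.neg.inv_eq (h.norm_inv_lt hz) (by rwa [e])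
  rwa [e] at this

theorem SmallField.midpoint_neg_midpoint {Y : E → E} {r : ℝ} (h : SmallField Y r) {z : E}
    (hz : ‖z‖ < r) (hz' : ‖h.midpoint z‖ < r) : h.neg.midpoint (h.midpoint z) = z := by
  rw [SmallField.midpoint, h.inv_neg_midpoint hz hz', ← sub_eq_add_neg, h.inv_sub hz]

theorem SmallField.isOpen_image_midpoint {Y : E → E} {r : ℝ} (h : SmallField Y r) {U : Set E}
    (hU : IsOpen U) (hUr : ∀ z ∈ U, ‖z‖ < r) (hTr : ∀ z ∈ U, ‖h.midpoint z‖ < r) :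
    IsOpen (h.midpoint '' U) := by
  have hball : IsOpen {y : E | ‖y‖ < r} := isOpen_lt continuous_norm continuous_const
  have hcont : ContinuousOn h.neg.midpoint {y : E | ‖y‖ < r} := fun y hy =>
    (h.neg.analyticAt_midpoint hy).continuousAt.continuousWithinAt
  -- The image is the preimage of `U` under the continuous inverse map.
  have : h.midpoint '' U = {y : E | ‖y‖ < r} ∩ h.neg.midpoint ⁻¹' U := by
    ext y
    constructor
    · rintro ⟨z, hz, rfl⟩
      refine ⟨hTr z hz, ?_⟩
      rw [mem_preimage, h.midpoint_neg_midpoint (hUr z hz) (hTr z hz)]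
      exact hz
    · rintro ⟨hy, hy'⟩
      have h1 := h.neg.midpoint_neg_midpoint hy (hUr _ hy')
      refine ⟨_, hy', ?_⟩
      convert h1 using 2
      simp
  rw [this]
  exact hcont.isOpen_inter_preimage hball hU

end Banach

variable {d : ℕ} {𝒩 : Set (Fin d → ℤ)}

theorem isOpen_openBallW (s R : ℝ) : IsOpen (openBallW 𝒩 s R) := by
  have hlip : ∀ σ : ℤˣ, ∀ x y : W 𝒩 s, compNorm s x.seq σ ≤ compNorm s y.seq σ + ‖x - y‖ := by
    intro σ x y
    have h1 := compNorm_add_le (x - y).memW y.memW σ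
    have h2 : compNorm s (x - y).seq σ ≤ ‖x - y‖ := by
      rw [W.norm_eq_normW, normW]
      rcases Int.units_eq_one_or σ with rfl | rfl
      · linarith [compNorm_nonneg s (x - y).seq (-1)]
      · linarith [compNorm_nonneg s (x - y).seq 1]
    rw [← seq_add, sub_add_cancel] at h1
    linarith
  rw [Metric.isOpen_iff]
  intro x hx
  have h1 := hx.2 1
  have h2 := hx.2 (-1)
  refine ⟨min (R - compNorm s x.seq 1) (R - compNorm s x.seq (-1)), lt_min (by linarith)
    (by linarith), fun y hy => ⟨y.memW, fun σ => ?_⟩⟩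
  rw [Metric.mem_ball, dist_eq_norm, lt_min_iff] at hy
  have := hlip σ y x
  rcases Int.units_eq_one_or σ with rfl | rfl <;> linarith

theorem compNorm_le_norm {s : ℝ} (x : W 𝒩 s) (σ : ℤˣ) : compNorm s x.seq σ ≤ ‖x‖ := by
  rw [W.norm_eq_normW, normW]
  rcases Int.units_eq_one_or σ with rfl | rfl
  · linarith [compNorm_nonneg s x.seq (-1)]
  · linarith [compNorm_nonneg s x.seq 1]

theorem norm_lt_of_mem_openBallW {s R : ℝ} {x : W 𝒩 s} (h : x ∈ openBallW 𝒩 s R) :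
    ‖x‖ < 2 * R := by
  rw [W.norm_eq_normW, normW]
  linarith [h.2 1, h.2 (-1)]

/-- Skewness of the differential of a Hamiltonian field is the symmetry of the second derivative of
its Hamiltonian. -/
theorem sympForm_fderiv {s : ℝ} (hs : 0 ≤ s) {f : W 𝒩 s → ℂ} {Y : W 𝒩 s → W 𝒩 s}
    (hf : ∀ x, HasFDerivAt f (sympForm hs (Y x)) x) (hY : ContDiff ℂ ω Y) (x u v : W 𝒩 s) :
    sympForm hs (fderiv ℂ Y x u) v = -sympForm hs u (fderiv ℂ Y x v) := by
  have h1 : HasFDerivAt (fun x => sympForm hs (Y x)) ((sympForm hs).comp (fderiv ℂ Y x)) x :=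
    (sympForm hs).hasFDerivAt.comp x ((hY.differentiable (by simp)) x).hasFDerivAt
  have h2 := second_derivative_symmetric hf h1 u v
  rw [← sympForm_antisymm]
  exact h2

/-- With `A` the differential of `Y`, the tangent vector `u' - A u'` is sent to `u' + A u'`. The
forms `Ω(u' + Au', v' + Av')` and `Ω(u' - Au', v' - Av')` differ by `2(Ω(Au', v') + Ω(u', Av'))`,
which vanishes since `A` is skew. -/
theorem SmallField.isCanonical {s r : ℝ} (hs : 0 ≤ s) {Y : W 𝒩 s → W 𝒩 s}
    (h : SmallField Y r)
    (hsym : ∀ x u v, sympForm hs (fderiv ℂ Y x u) v = -sympForm hs u (fderiv ℂ Y x v))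
    {U : Set (W 𝒩 s)} (hU : IsOpen U) (hUr : ∀ z ∈ U, ‖z‖ < r)
    (hTr : ∀ z ∈ U, ‖h.midpoint z‖ < r) : IsCanonical h.midpoint U where
  analytic z hz := h.analyticAt_midpoint (hUr z hz)
  isOpen_image := h.isOpen_image_midpoint hU hUr hTr
  exists_inverse := by
    refine ⟨h.neg.midpoint, ?_, fun z hz => h.midpoint_neg_midpoint (hUr z hz) (hTr z hz)⟩
    rintro _ ⟨z, hz, rfl⟩
    exact h.neg.analyticAt_midpoint (hTr z hz)
  symplectic z hz u v := by
    have hS := (h.analyticAt_inv (hUr z hz)).differentiableAt.hasFDerivAt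
    have hY := ((h.contDiff.differentiable (by simp)) (h.inv z)).hasFDerivAt
    have hT : HasFDerivAt h.midpoint _ z := hS.add (hY.comp z hS)
    have h1 : ∀ w, fderiv ℂ h.midpoint z w = fderiv ℂ h.inv z w
        + fderiv ℂ Y (h.inv z) (fderiv ℂ h.inv z w) := fun w => by
      rw [hT.fderiv]; simp
    rw [← sympForm_eq_symplecticForm hs, ← sympForm_eq_symplecticForm hs, h1, h1]
    nth_rw 3 [← h.fderiv_inv (hUr z hz) u]
    nth_rw 3 [← h.fderiv_inv (hUr z hz) v]
    simp only [map_add, map_sub, add_apply, sub_apply, hsym]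
    ring

/-- Write `v = v' - A v'`. Moving `A` across the form by skewness turns the equation for the field
`w` of the combination into `w + A w = (1 - A) Xa - (1 + A) Xb - Xc`, solvable with `‖w‖` at most
twice the right side because `‖A‖ ≤ 1/4`. -/
theorem SmallField.hasFDerivAt_pullback {s r : ℝ} (hs : 0 ≤ s) {Y : W 𝒩 s → W 𝒩 s}
    (h : SmallField Y r)
    (hsym : ∀ x u v, sympForm hs (fderiv ℂ Y x u) v = -sympForm hs u (fderiv ℂ Y x v))
    {z : W 𝒩 s} (hz : ‖z‖ < r) {a b c : W 𝒩 s → ℂ} {Xa Xb Xc : W 𝒩 s}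
    (ha : HasFDerivAt a (sympForm hs Xa) (h.midpoint z)) (hb : HasFDerivAt b (sympForm hs Xb) z)
    (hc : HasFDerivAt c (sympForm hs Xc) (h.inv z)) :
    ∃ w : W 𝒩 s, HasFDerivAt (fun y => a (h.midpoint y) - b y - c (h.inv y)) (sympForm hs w) z ∧
      ‖w‖ ≤ 2 * ‖Xa - fderiv ℂ Y (h.inv z) Xa - Xb - fderiv ℂ Y (h.inv z) Xb - Xc‖ := by
  set A := fderiv ℂ Y (h.inv z) with hA
  obtain ⟨w, hw, hwn⟩ := exists_solution (h.norm_fderiv_le _ (h.norm_inv_lt hz))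
    (Xa - A Xa - Xb - A Xb - Xc)
  refine ⟨w, ?_, hwn⟩
  have hS := (h.analyticAt_inv hz).differentiableAt.hasFDerivAt
  have hY := ((h.contDiff.differentiable (by simp)) (h.inv z)).hasFDerivAt
  have hT : HasFDerivAt h.midpoint _ z := hS.add (hY.comp z hS)
  refine (((ha.comp z hT).sub hb).sub (hc.comp z hS)).congr_fderiv ?_
  ext v
  have hv := h.fderiv_inv hz v
  set v' := fderiv ℂ h.inv z v with hv'
  rw [← hA] at hv
  have e1 : sympForm hs w v = sympForm hs (w + A w) v' := by
    rw [← hv]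
    simp only [map_add, map_sub, add_apply, hsym, hA]
    ring
  rw [e1, hw]
  simp only [sub_apply, ContinuousLinearMap.comp_apply, add_apply, ← hv', ← hA]
  nth_rw 1 [← hv]
  simp only [map_add, map_sub, sub_apply, hsym, hA]
  ring

end

/-! ### Diagonal form of the periodic flow, and `h₀` as a quadratic form. -/

section

variable {d : ℕ} {𝒩 : Set (Fin d → ℤ)}

theorem abs_le_modulus (n : Fin d → ℤ) (i : Fin d) : |(n i : ℝ)| ≤ modulus n := by
  rw [← Real.sqrt_sq_eq_abs]
  exact Real.sqrt_le_sqrt (le_max_of_le_right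
    (Finset.single_le_sum (f := fun i => (n i : ℝ) ^ 2) (fun i _ => sq_nonneg _)
      (Finset.mem_univ i)))

theorem finite_modulus_lt (J : ℕ) : {n : Idx 𝒩 | modulus n.1.1 < J}.Finite := by
  have h1 : {n : Fin d → ℤ | modulus n < J}.Finite := by
    refine (Set.finite_Icc (fun _ : Fin d => -(J : ℤ)) (fun _ => (J : ℤ))).subset fun n hn => ?_
    have h : ∀ i, |n i| ≤ (J : ℤ) := fun i => by
      have := (abs_le_modulus n i).trans (le_of_lt hn)
      exact_mod_cast this
    exact ⟨fun i => (abs_le.1 (h i)).1, fun i => (abs_le.1 (h i)).2⟩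
  have h2 : {a : 𝒩 | modulus a.1 < J}.Finite := h1.preimage Subtype.val_injective.injOn
  refine (h2.prod (Set.finite_univ (α := ℤˣ))).subset fun n hn => ⟨hn, mem_univ _⟩

theorem exp_of_deriv {f : ℝ → ℂ} {a : ℂ} (h : ∀ t, HasDerivAt f (a * f t) t) (t : ℝ) :
    f t = Complex.exp (a * t) * f 0 := by
  have h1 : ∀ t : ℝ, HasDerivAt (fun t : ℝ => Complex.exp (-a * t) * f t) 0 t := fun t => by
    have h2 : HasDerivAt (fun t : ℝ => -a * (t : ℂ)) (-a * 1) t :=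
      (Complex.ofRealCLM.hasDerivAt (x := t)).const_mul (-a)
    refine (h2.cexp.mul (h t)).congr_deriv ?_
    ring
  have h3 := is_const_of_deriv_eq_zero (fun t => (h1 t).differentiableAt)
    (fun t => (h1 t).deriv) t 0
  simp only [Complex.ofReal_zero, mul_zero, Complex.exp_zero, one_mul] at h3
  rw [← h3, ← mul_assoc, ← Complex.exp_add]
  simp

section Flow

variable {s₁ T : ℝ} {h₀ : Ham 𝒩} {Φ : ℝ → SeqSp 𝒩 → SeqSp 𝒩}

theorem generator_zero (h : PeriodicFlow s₁ h₀ Φ T) (hs₁ : 1 ≤ s₁) {ζ : SeqSp 𝒩}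
    (hζ : MemW s₁ ζ) (n : Idx 𝒩) :
    HasDerivAt (fun τ => Φ τ ζ n) (vectorField h₀ ζ n) 0 := by
  have := h.generator ζ hζ 0 n
  rwa [h.flow_zero ζ (hζ.mono hs₁)] at this

theorem basisW_memW (s s' : ℝ) (m : Idx 𝒩) : MemW s (basisW s' m).seq := by
  have := (basisW s m).memW
  rw [basisW_seq] at this ⊢
  exact this

/-- Rigidity of `ℓ¹` isometries: an off-diagonal velocity would increase the norm of `Φ t e` to
first order in `|t|`, while the norm is conserved. -/
theorem generator_offDiag (h : PeriodicFlow s₁ h₀ Φ T) (hs₁ : 1 ≤ s₁) {m n : Idx 𝒩} (hmn : n ≠ m) :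
    vectorField h₀ (basisW s₁ m).seq n = 0 := by
  set e := (basisW s₁ m).seq with he
  have heW : ∀ s, MemW s e := fun s => basisW_memW s s₁ m
  have hem : e m = 1 := by simp [he, basisW_seq]
  have hen : e n = 0 := by simp [he, basisW_seq, hmn]
  have hd := fun j => generator_zero h hs₁ (heW s₁) j
  have hnorm : ∀ t, wt 1 m * ‖Φ t e m‖ + wt 1 n * ‖Φ t e n‖ ≤ wt 1 m := by
    intro t
    have h1 := h.isometry 1 le_rfl t e (heW 1)
    have h2 : normW 1 e = wt 1 m := by rw [he, ← norm_basisW 1 m, W.norm_eq_normW, basisW_seq, basisW_seq]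
    rw [h2, normW_eq (h.mapsTo 1 le_rfl t e (heW 1))] at h1
    have := (memW_iff.1 (h.mapsTo 1 le_rfl t e (heW 1))).sum_le_tsum {m, n}
      (fun _ _ => mul_nonneg (wt_nonneg _ _) (norm_nonneg _))
    rwa [Finset.sum_pair hmn.symm, h1] at this
  -- The function differentiated is at most `wt 1 m` for every `t` and attains this at `t = 0`.
  -- Taking `c = 0, 1, I` then kills the real diagonal part and both parts of the off-diagonal
  -- velocity.
  have key : ∀ c : ℂ, ‖c‖ ≤ 1 →
      wt 1 m * (vectorField h₀ e m).re + wt 1 n * (c * vectorField h₀ e n).re = 0 := by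
    intro c hc
    have hd1 : HasDerivAt (fun t => wt 1 m * (Φ t e m).re + wt 1 n * (c * Φ t e n).re)
        (wt 1 m * (vectorField h₀ e m).re + wt 1 n * (c * vectorField h₀ e n).re) 0 :=
      ((Complex.reCLM.hasFDerivAt.comp_hasDerivAt 0 (hd m)).const_mul _).add
        ((Complex.reCLM.hasFDerivAt.comp_hasDerivAt 0 ((hd n).const_mul c)).const_mul _)
    refine IsLocalMax.hasDerivAt_eq_zero (Eventually.of_forall fun t => ?_) hd1
    simp only [h.flow_zero e (heW 1), hem, hen, mul_zero, Complex.one_re, Complex.zero_re,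
      add_zero, mul_one]
    refine le_trans (add_le_add ?_ ?_) (hnorm t)
    · exact mul_le_mul_of_nonneg_left (Complex.re_le_norm _) (wt_nonneg _ _)
    · refine mul_le_mul_of_nonneg_left ((Complex.re_le_norm _).trans ?_) (wt_nonneg _ _)
      rw [norm_mul]
      exact mul_le_of_le_one_left (norm_nonneg _) hc
  have k0 := key 0 (by simp)
  have k1 := key 1 (by simp)
  have k2 := key Complex.I (by simp)
  have hw := (wt_pos 1 n).ne'
  simp only [zero_mul, Complex.zero_re, mul_zero, add_zero] at k0
  rw [k0, zero_add] at k1 k2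
  have r1 : (vectorField h₀ e n).re = 0 := by
    simpa [hw] using k1
  have r2 : (vectorField h₀ e n).im = 0 := by
    simpa [hw] using k2
  exact Complex.ext r1 r2

theorem map_sum_flow (h : PeriodicFlow s₁ h₀ Φ T) (t : ℝ) (u : Finset (Idx 𝒩)) (c : Idx 𝒩 → ℂ) :
    Φ t (∑ m ∈ u, c m • (basisW 1 m).seq) = ∑ m ∈ u, c m • Φ t (basisW 1 m).seq := by
  classical
  have hmem : ∀ u : Finset (Idx 𝒩), MemW 1 (∑ m ∈ u, c m • (basisW 1 m).seq) := fun u =>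
    (submoduleW 𝒩 1).sum_mem fun m _ => (basisW 1 m).memW.smul (c m)
  induction u using Finset.induction_on with
  | empty =>
    have := h.map_smul t 0 0 (submoduleW 𝒩 1).zero_mem
    simpa using this
  | insert a u ha ih =>
    rw [Finset.sum_insert ha, Finset.sum_insert ha, h.map_add t _ _ ((basisW 1 a).memW.smul _)
      (hmem u), ih, h.map_smul t _ _ (basisW 1 a).memW]

/-- Commutation with the shell projection makes coordinate `n` of the flow depend only on the
finitely many modes of one shell. The generator on basis vectors then suffices, even though `ζ` is
only in `𝒲^1`. -/
theorem hasDerivAt_flow_zero (h : PeriodicFlow s₁ h₀ Φ T) (hI : FlowInvariance Φ) (hs₁ : 1 ≤ s₁)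
    {ζ : SeqSp 𝒩} (hζ : MemW 1 ζ) (n : Idx 𝒩) :
    HasDerivAt (fun τ => Φ τ ζ n) (vectorField h₀ (basisW s₁ n).seq n * ζ n) 0 := by
  classical
  -- The shell with label `J` is `J - 1 ≤ |n| < J`, hence the shift by one.
  set J : ℕ := ⌊modulus n.1.1⌋₊ + 1 with hJ
  have hn : (J : ℝ) - 1 ≤ modulus n.1.1 ∧ modulus n.1.1 < J := by
    constructor
    · have := Nat.floor_le (modulus_nonneg n.1.1)
      simpa [hJ] using this
    · have := Nat.lt_floor_add_one (modulus n.1.1)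
      simpa [hJ] using this
  set u : Finset (Idx 𝒩) := (finite_modulus_lt J).toFinset with hu
  have hnu : n ∈ u := by simpa [hu] using hn.2
  set η := shellProj J ζ with hη
  have hηn : η n = ζ n := by simp only [hη, shellProj]; rw [if_pos hn]
  have hsum : η = ∑ m ∈ u, η m • (basisW 1 m).seq := by
    funext k
    rw [Finset.sum_apply]
    by_cases hk : k ∈ u
    · rw [Finset.sum_eq_single k]
      · simp [basisW_seq]
      · intro m _ hm
        simp [basisW_seq, hm.symm]
      · exact fun h => absurd hk h
    · rw [Finset.sum_eq_zero]
      · have hk' : ¬ modulus k.1.1 < J := by simpa [hu] using hk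
        simp only [hη, shellProj]
        rw [if_neg fun h => hk' h.2]
      · intro m hm
        have : k ≠ m := fun h => hk (h ▸ hm)
        simp [basisW_seq, this]
  have hbasis : ∀ m : Idx 𝒩, (basisW 1 m).seq = (basisW s₁ m).seq := fun m => by
    rw [basisW_seq, basisW_seq]
  have heq : (fun τ => Φ τ ζ n) = fun τ => ∑ m ∈ u, η m * Φ τ (basisW s₁ m).seq n := by
    funext τ
    have h1 := congrFun (hI.commutes 1 le_rfl τ J ζ hζ) n
    have h2 : shellProj J (Φ τ ζ) n = Φ τ ζ n := by simp only [shellProj]; rw [if_pos hn]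
    have h3 := congrArg (fun x => Φ τ x n) hsum
    simp only [map_sum_flow h, Finset.sum_apply, Pi.smul_apply, smul_eq_mul] at h3
    rw [← h2, h1, ← hη, h3]
    simp only [hbasis]
  rw [heq]
  have hd := HasDerivAt.fun_sum (u := u) fun m _ =>
    (generator_zero h hs₁ (basisW s₁ m).memW n).const_mul (η m)
  refine hd.congr_deriv ?_
  rw [Finset.sum_eq_single n]
  · rw [hηn, mul_comm]
  · intro m _ hm
    rw [generator_offDiag h hs₁ hm.symm, mul_zero]
  · exact fun h => absurd hnu h

/-- The group law moves the derivative from time zero to any time, giving a scalar linear equation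
for each coordinate. -/
theorem flow_eq_exp (h : PeriodicFlow s₁ h₀ Φ T) (hI : FlowInvariance Φ) (hs₁ : 1 ≤ s₁)
    {ζ : SeqSp 𝒩} (hζ : MemW 1 ζ) (n : Idx 𝒩) (t : ℝ) :
    Φ t ζ n = Complex.exp (vectorField h₀ (basisW s₁ n).seq n * t) * ζ n := by
  have := exp_of_deriv (f := fun τ => Φ τ ζ n) (a := vectorField h₀ (basisW s₁ n).seq n)
    (fun t => ?_) t
  · simpa only [h.flow_zero ζ hζ] using this
  · have h1 := hasDerivAt_flow_zero h hI hs₁ (h.mapsTo 1 le_rfl t ζ hζ) n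
    have h2 : HasDerivAt (fun τ : ℝ => Φ (τ - t) (Φ t ζ) n)
        (vectorField h₀ (basisW s₁ n).seq n * Φ t ζ n) t :=
      HasDerivAt.comp_sub_const (f := fun τ => Φ τ (Φ t ζ) n) t t (by rwa [sub_self])
    refine h2.congr_of_eventuallyEq (Eventually.of_forall fun τ => ?_)
    simp only
    rw [← h.flow_add _ _ ζ hζ, sub_add_cancel]

/-- The flow is diagonal, with frequencies in `(2π / T) ℤ`. -/
structure Diagonal (s₁ T : ℝ) (h₀ : Ham 𝒩) (Φ : ℝ → SeqSp 𝒩 → SeqSp 𝒩) (κ : Idx 𝒩 → ℤ) : Prop where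
  flow : ∀ ζ : SeqSp 𝒩, MemW 1 ζ → ∀ n t,
    Φ t ζ n = Complex.exp (2 * Real.pi * Complex.I * (κ n * t / T)) * ζ n
  field : ∀ ζ : SeqSp 𝒩, MemW s₁ ζ → ∀ n,
    vectorField h₀ ζ n = 2 * Real.pi * Complex.I / T * κ n * ζ n

theorem exists_diagonal (h : PeriodicFlow s₁ h₀ Φ T) (hI : FlowInvariance Φ) (hs₁ : 1 ≤ s₁) :
    ∃ κ : Idx 𝒩 → ℤ, Diagonal s₁ T h₀ Φ κ := by
  have hT : (T : ℂ) ≠ 0 := Complex.ofReal_ne_zero.2 h.period_pos.ne'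
  have hk : ∀ n : Idx 𝒩, ∃ k : ℤ,
      vectorField h₀ (basisW s₁ n).seq n * T = k * (2 * Real.pi * Complex.I) := by
    intro n
    -- Periodicity of the flow on a basis vector reads `exp(λ T) = 1`.
    rw [← Complex.exp_eq_one_iff]
    have h1 := flow_eq_exp h hI hs₁ (basisW 1 n).memW n T
    have h2 := congrFun (h.periodic 0 _ (basisW 1 n).memW) n
    rw [zero_add, h1, h.flow_zero _ (basisW 1 n).memW] at h2
    have h3 : (basisW 1 n).seq n = 1 := by simp [basisW_seq]
    rwa [h3, mul_one] at h2
  choose κ hκ using hk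
  have hv : ∀ n, vectorField h₀ (basisW s₁ n).seq n = 2 * Real.pi * Complex.I / T * κ n := by
    intro n
    rw [eq_div_of_mul_eq hT (hκ n)]
    ring
  refine ⟨κ, fun ζ hζ n t => ?_, fun ζ hζ n => ?_⟩
  · rw [flow_eq_exp h hI hs₁ hζ, hv]
    congr 2
    ring
  · have h1 := (generator_zero h hs₁ hζ n).unique
      (hasDerivAt_flow_zero h hI hs₁ (hζ.mono hs₁) n)
    rw [h1, hv]

theorem partialDeriv_of_diagonal {κ : Idx 𝒩 → ℤ} (hD : Diagonal s₁ T h₀ Φ κ) {ζ : SeqSp 𝒩}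
    (hζ : MemW s₁ ζ) (n : Idx 𝒩) :
    partialDeriv h₀ n ζ = -(2 * Real.pi / T * sgn n * κ n.conj * ζ n.conj) := by
  have h1 := hD.field ζ hζ n.conj
  change Complex.I * sgn n.conj * partialDeriv h₀ n.conj.conj ζ = _ at h1
  rw [conj_conj, sgn_conj] at h1
  linear_combination (Complex.I * sgn n) * h1
    + (partialDeriv h₀ n ζ * sgn n * sgn n) * Complex.I_mul_I
    - (partialDeriv h₀ n ζ) * sgn_mul_self n
    + 2 * Real.pi / T * κ n.conj * ζ n.conj * sgn n * Complex.I_mul_I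

variable {s : ℝ}

theorem hasFDerivAt_unperturbed (h : PeriodicFlow s₁ h₀ Φ T) (hs : s₁ ≤ s) (x : W 𝒩 s) :
    HasFDerivAt (fun y : W 𝒩 s => h₀ y.seq) (fderiv ℂ (fun y : W 𝒩 s => h₀ y.seq) x) x :=
  (((h.contDiff s hs).differentiable (by simp)) x).hasFDerivAt

theorem fderiv_unperturbed_basisW (h : PeriodicFlow s₁ h₀ Φ T) {κ : Idx 𝒩 → ℤ}
    (hD : Diagonal s₁ T h₀ Φ κ) (hs : s₁ ≤ s) (x : W 𝒩 s) (n : Idx 𝒩) :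
    fderiv ℂ (fun y : W 𝒩 s => h₀ y.seq) x (basisW s n)
      = -(2 * Real.pi / T * sgn n * κ n.conj * x.seq n.conj) := by
  rw [← partialDeriv_of_diagonal hD (x.memW.mono hs),
    partialDeriv_eq (hasFDerivAt_unperturbed h hs x)]

/-- The differential of `h₀` depends linearly on the base point, as its values on the basis show. So
`h₀` is quadratic up to a constant and the central difference formula has no error. -/
theorem unperturbed_sub (h : PeriodicFlow s₁ h₀ Φ T) {κ : Idx 𝒩 → ℤ}
    (hD : Diagonal s₁ T h₀ Φ κ) (hs : s₁ ≤ s) (x y : W 𝒩 s) :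
    h₀ (x + y).seq - h₀ (x - y).seq = 2 * fderiv ℂ (fun y : W 𝒩 s => h₀ y.seq) x y := by
  set D := fderiv ℂ (fun y : W 𝒩 s => h₀ y.seq) with hDdef
  have hadd : ∀ t : ℂ, D (x + t • y) + D (x - t • y) = (2 : ℂ) • D x := by
    intro t
    refine clm_ext fun n => ?_
    simp only [add_apply, smul_apply, hDdef, fderiv_unperturbed_basisW h hD hs, seq_add, seq_sub,
      Pi.add_apply, Pi.sub_apply, smul_eq_mul]
    ring
  have hd : ∀ t : ℂ, HasDerivAt (fun t : ℂ => h₀ (x + t • y).seq - h₀ (x - t • y).seq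
      - t * (2 * D x y)) 0 t := by
    intro t
    have h1 : HasDerivAt (fun t : ℂ => x + t • y) y t := by
      simpa using ((hasDerivAt_id t).smul_const y).const_add x
    have h2 : HasDerivAt (fun t : ℂ => x - t • y) (-y) t := by
      simpa using ((hasDerivAt_id t).smul_const y).const_sub x
    have h3 := (hasFDerivAt_unperturbed h hs (x + t • y)).comp_hasDerivAt t h1
    have h4 := (hasFDerivAt_unperturbed h hs (x - t • y)).comp_hasDerivAt t h2
    have h5 := (h3.sub h4).sub ((hasDerivAt_id t).mul_const (2 * D x y))
    refine h5.congr_deriv ?_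
    have h6 := congrArg (fun L : W 𝒩 s →L[ℂ] ℂ => L y) (hadd t)
    simp only [add_apply, smul_apply, smul_eq_mul] at h6
    rw [← hDdef, map_neg, ← h6]
    ring
  have h3 := is_const_of_deriv_eq_zero (fun t => (hd t).differentiableAt)
    (fun t => (hd t).deriv) 1 0
  simp only [one_smul, zero_smul, add_zero, sub_zero, sub_self, one_mul, zero_mul] at h3
  exact sub_eq_zero.1 h3

/-- Symmetry of the bilinear form of `h₀`, obtained without a second derivative: `h₀` is even, so
`h₀(e + f) - h₀(e - f)` is symmetric in `e` and `f`. The sign change comes from `sgn n.conj = -sgn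
n`. -/
theorem Diagonal.conj (h : PeriodicFlow s₁ h₀ Φ T) {κ : Idx 𝒩 → ℤ}
    (hD : Diagonal s₁ T h₀ Φ κ) (n : Idx 𝒩) : κ n.conj = -κ n := by
  set D := fderiv ℂ (fun y : W 𝒩 s₁ => h₀ y.seq) with hDdef
  have hD0 : D 0 = 0 := clm_ext fun n => by
    simp [hDdef, fderiv_unperturbed_basisW h hD le_rfl]
  have heven : ∀ y : W 𝒩 s₁, h₀ y.seq = h₀ (-y).seq := fun y => by
    have := unperturbed_sub h hD le_rfl 0 y
    rw [← hDdef, hD0] at this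
    simpa [sub_eq_zero] using this
  have h1 := unperturbed_sub h hD le_rfl (basisW s₁ n) (basisW s₁ n.conj)
  have h2 := unperturbed_sub h hD le_rfl (basisW s₁ n.conj) (basisW s₁ n)
  rw [add_comm, heven (basisW s₁ n.conj - basisW s₁ n), neg_sub, h1,
    fderiv_unperturbed_basisW h hD le_rfl, fderiv_unperturbed_basisW h hD le_rfl, conj_conj,
    sgn_conj] at h2
  have hp : (2 * Real.pi / T : ℂ) ≠ 0 := by
    have := h.period_pos.ne'
    have := Real.pi_ne_zero
    norm_cast
    positivity
  have hsg : sgn n ≠ 0 := fun h0 => by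
    have := sgn_mul_self n
    simp [h0] at this
  have e1 : (basisW s₁ n).seq n = 1 := by simp [basisW_seq]
  have e2 : (basisW s₁ n.conj).seq n.conj = 1 := by simp [basisW_seq]
  rw [e1, e2] at h2
  have h3 : (2 * Real.pi / T * sgn n : ℂ) * (κ n.conj + κ n) = 0 := by
    linear_combination (1 / 2 : ℂ) * h2
  have h4 : ((κ n.conj + κ n : ℤ) : ℂ) = 0 := by
    push_cast
    exact (mul_eq_zero.1 h3).resolve_left (mul_ne_zero hp hsg)
  have h5 : κ n.conj + κ n = 0 := by exact_mod_cast h4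
  linarith

/-- `h₀` is `C¹` near `0` on `𝒲^{s₁}`, so its form is bounded there. Testing it on the basis vectors
of `n` and `n.conj`, each of norm `|n|^{s₁}`, bounds the frequency. -/
theorem Diagonal.growth (h : PeriodicFlow s₁ h₀ Φ T) {κ : Idx 𝒩 → ℤ}
    (hD : Diagonal s₁ T h₀ Φ κ) :
    ∃ C, 0 ≤ C ∧ ∀ n, ‖(2 * Real.pi * Complex.I / T * κ n : ℂ)‖ ≤ C * wt (2 * s₁) n := by
  set D := fderiv ℂ (fun y : W 𝒩 s₁ => h₀ y.seq) with hDdef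
  have hcont : ContinuousAt D 0 := ((h.contDiff s₁ le_rfl).continuous_fderiv (by simp)).continuousAt
  have hD0 : D 0 = 0 := clm_ext fun n => by
    simp [hDdef, fderiv_unperturbed_basisW h hD le_rfl]
  obtain ⟨ε, hε, hball⟩ := Metric.continuousAt_iff.1 hcont 1 one_pos
  refine ⟨2 / ε, by positivity, fun n => ?_⟩
  have hw := wt_pos s₁ n
  -- Scales the basis vector to norm `ε / 2`.
  set c : ℝ := ε / (2 * wt s₁ n) with hc
  have hc0 : 0 < c := by positivity
  have hx : ‖(c : ℂ) • basisW s₁ n‖ < ε := by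
    rw [norm_smul, norm_basisW, Complex.norm_of_nonneg hc0.le, hc]
    field_simp
    linarith
  have h1 := hball (x := (c : ℂ) • basisW s₁ n) (by simpa using hx)
  rw [hD0, dist_zero_right] at h1
  have h2 := (D ((c : ℂ) • basisW s₁ n)).le_of_opNorm_le h1.le (basisW s₁ n.conj)
  rw [hDdef, fderiv_unperturbed_basisW h hD le_rfl, conj_conj, sgn_conj, norm_basisW, one_mul,
    wt_conj, seq_smul, Pi.smul_apply] at h2
  have e1 : (basisW s₁ n).seq n = 1 := by simp [basisW_seq]
  rw [e1, smul_eq_mul, mul_one, norm_neg, norm_mul, norm_mul, norm_mul, norm_neg, norm_sgn,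
    Complex.norm_of_nonneg hc0.le, mul_one] at h2
  have h3 : ‖(2 * Real.pi * Complex.I / T * κ n : ℂ)‖ = ‖(2 * Real.pi / T : ℂ)‖ * ‖(κ n : ℂ)‖ := by
    rw [mul_div_right_comm, norm_mul, norm_mul, Complex.norm_I, mul_one]
  have h4 : wt (2 * s₁) n = wt s₁ n * wt s₁ n := by rw [two_mul, wt_add]
  rw [h3, h4]
  rw [hc, mul_div_assoc', div_le_iff₀ (by positivity)] at h2
  rw [div_mul_eq_mul_div, le_div_iff₀ hε]
  linarith

/-- The linear vector field of the unperturbed Hamiltonian, from `𝒲^{s + 2 s₁}` to `𝒲^s`. -/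
theorem Diagonal.memW_field (h : PeriodicFlow s₁ h₀ Φ T) {κ : Idx 𝒩 → ℤ}
    (hD : Diagonal s₁ T h₀ Φ κ) {ζ : SeqSp 𝒩} (hζ : MemW (s + 2 * s₁) ζ) :
    MemW s (fun n => 2 * Real.pi * Complex.I / T * κ n * ζ n) := by
  obtain ⟨C, hC, hg⟩ := hD.growth h
  refine memW_iff.2 (Summable.of_nonneg_of_le
    (fun n => mul_nonneg (wt_nonneg _ _) (norm_nonneg _)) (fun n => ?_)
    ((memW_iff.1 hζ).mul_left C))
  rw [norm_mul, wt_add]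
  calc _ ≤ wt s n * (C * wt (2 * s₁) n * ‖ζ n‖) := mul_le_mul_of_nonneg_left
        (mul_le_mul_of_nonneg_right (hg n) (norm_nonneg _)) (wt_nonneg _ _)
    _ = _ := by ring

theorem Diagonal.fderiv_eq (h : PeriodicFlow s₁ h₀ Φ T) {κ : Idx 𝒩 → ℤ}
    (hD : Diagonal s₁ T h₀ Φ κ) (hs : s₁ ≤ s) (hs0 : 0 ≤ s) {x : W 𝒩 s}
    (hx : MemW s (fun n => 2 * Real.pi * Complex.I / T * κ n * x.seq n)) :
    fderiv ℂ (fun y : W 𝒩 s => h₀ y.seq) x = sympForm hs0 (toW s _ hx) := by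
  refine clm_ext fun n => ?_
  rw [fderiv_unperturbed_basisW h hD hs, sympForm_basisW, toW_seq]
  linear_combination (-2 * Real.pi / T * sgn n * κ n.conj * x.seq n.conj) * Complex.I_mul_I

end Flow

end

section

variable {d : ℕ} {𝒩 : Set (Fin d → ℤ)}

/-! ### Moduli and momentum -/

theorem modulus_eq_max (n : Fin d → ℤ) :
    modulus n = max 1 ‖(WithLp.toLp 2 (fun i => (n i : ℝ)) : EuclideanSpace ℝ (Fin d))‖ := by
  rw [EuclideanSpace.norm_eq, modulus]
  simp only [Real.norm_eq_abs, sq_abs]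
  rcases le_total 1 (∑ i, (n i : ℝ) ^ 2) with h | h
  · rw [max_eq_right h, max_eq_right (Real.one_le_sqrt.2 h)]
  · rw [max_eq_left h, max_eq_left (Real.sqrt_le_one.2 h), Real.sqrt_one]

theorem modulus_smul_unit (σ : ℤˣ) (n : Fin d → ℤ) : modulus ((σ : ℤ) • n) = modulus n := by
  unfold modulus
  rcases Int.units_eq_one_or σ with rfl | rfl <;> simp

theorem modulus_neg (n : Fin d → ℤ) : modulus (-n) = modulus n := by
  simp [modulus]

theorem one_le_prod_real {ι : Type*} {t : Finset ι} {f : ι → ℝ} (h : ∀ i ∈ t, 1 ≤ f i) :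
    1 ≤ ∏ i ∈ t, f i := by
  have := Finset.prod_le_prod (f := fun _ => (1 : ℝ)) (fun _ _ => zero_le_one) h
  simpa using this

/-- Every modulus is at least one, so each summand is bounded by the product of all the moduli. -/
theorem modulus_sum_le {m : ℕ} (hm : 1 ≤ m) (f : Fin m → Fin d → ℤ) :
    modulus (∑ i, f i) ≤ m * ∏ i, modulus (f i) := by
  have h1 : ∀ i, modulus (f i) ≤ ∏ i, modulus (f i) := fun i => by
    rw [← Finset.mul_prod_erase _ _ (Finset.mem_univ i)]
    exact le_mul_of_one_le_right (modulus_nonneg _)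
      (one_le_prod_real fun _ _ => one_le_modulus _)
  have h2 : (1 : ℝ) ≤ ∏ i, modulus (f i) := one_le_prod_real fun _ _ => one_le_modulus _
  have hm' : (1 : ℝ) ≤ m := by exact_mod_cast hm
  rw [modulus_eq_max]
  refine max_le ?_ ?_
  · nlinarith
  · have e : (WithLp.toLp 2 (fun x => ((∑ i, f i) x : ℝ)) : EuclideanSpace ℝ (Fin d))
        = ∑ i, (WithLp.toLp 2 (fun x => (f i x : ℝ)) : EuclideanSpace ℝ (Fin d)) := by
      ext x
      simp
    rw [e]
    refine (norm_sum_le _ _).trans ?_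
    calc _ ≤ ∑ _i : Fin m, ∏ i, modulus (f i) := Finset.sum_le_sum fun i _ =>
          le_trans (by rw [modulus_eq_max]; exact le_max_right _ _) (h1 i)
      _ = _ := by simp

theorem momentum_conj {m : ℕ} (j : Fin m → Idx 𝒩) :
    momentum (fun i => (j i).conj) = -momentum j := by
  simp [momentum, Idx.conj]

theorem modulus_insertNth_le {m : ℕ} (hm : 1 ≤ m) (i : Fin (m + 1)) (n : Idx 𝒩)
    (j : Fin m → Idx 𝒩) (h : momentum (i.insertNth n j : Fin (m + 1) → Idx 𝒩) = 0) :
    modulus n.1.1 ≤ m * ∏ i', modulus (j i').1.1 := by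
  rw [momentum_insertNth] at h
  have h1 := eq_neg_of_add_eq_zero_left h
  rw [← modulus_smul_unit n.2, h1, modulus_neg, momentum]
  refine (modulus_sum_le hm _).trans (le_of_eq ?_)
  simp only [modulus_smul_unit]

theorem modulus_insertNth_eq (i : Fin 2) (n : Idx 𝒩)
    (j : Fin 1 → Idx 𝒩) (h : momentum (i.insertNth n j : Fin 2 → Idx 𝒩) = 0) :
    modulus n.1.1 = modulus (j 0).1.1 := by
  rw [momentum_insertNth] at h
  have h1 := eq_neg_of_add_eq_zero_left h
  rw [← modulus_smul_unit n.2, h1, modulus_neg, momentum]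
  simp only [Finset.univ_unique, Fin.default_eq_zero, Finset.sum_singleton, modulus_smul_unit]

theorem modulus_pair_eq (j : Fin 2 → Idx 𝒩) (h : momentum j = 0) :
    modulus (j 1).1.1 = modulus (j 0).1.1 := by
  have := modulus_insertNth_eq 1 (j 1) (fun _ => j 0) (by
    rw [momentum_insertNth]
    simp only [momentum, Fin.sum_univ_two, Finset.univ_unique, Finset.sum_singleton] at h ⊢
    rw [add_comm, h])
  exact this

/-! ### Coefficients of the polynomial classes -/

/-- Coefficients of a real polynomial of zero momentum and degree at most `K + 1`. -/
structure RealCoef (K : ℕ) (A : Coef 𝒩) : Prop where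
  zero : HasZeroMomentum A
  support : ∀ m, m ∉ Finset.Icc 1 K → ∀ j, A m j = 0
  conj : ∀ m j, A m (fun i => (j i).conj) = (starRingEnd ℂ) (A m j)

/-- Quadratic coefficients of order `e`. -/
def QuadBound (e C : ℝ) (A : Coef 𝒩) : Prop := ∀ m j, ‖A m j‖ ≤ C * wt e (j 0)

theorem RealCoef.mul {K : ℕ} {A q : Coef 𝒩} (h : RealCoef K A)
    (hq : ∀ m j, q m (fun i => (j i).conj) = (starRingEnd ℂ) (q m j)) :
    RealCoef K (fun m j => A m j * q m j) where
  zero m j hj := by simp only [h.zero m j hj, zero_mul]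
  support m hm j := by simp only [h.support m hm j, zero_mul]
  conj m j := by simp only [h.conj m j, hq m j, map_mul]

/-- Momentum conservation bounds the output mode by `K` times the product of the input modes. The
weight `|n|^s` is thus absorbed by the weights of the inputs, at the cost of `K^s` and with no loss
of derivatives. -/
theorem VecBound.of_bounded {K : ℕ} {A : Coef 𝒩} {s C : ℝ} (hs : 0 ≤ s) (hC : 0 ≤ C)
    (hz : HasZeroMomentum A) (hsupp : ∀ m, m ∉ Finset.Icc 1 K → ∀ j, A m j = 0)
    (hA : ∀ m j, ‖A m j‖ ≤ C) : VecBound s s (C * (K : ℝ) ^ s) A where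
  nonneg := by positivity
  zero := hz
  le m i n j := by
    have hR : 0 ≤ C * (K : ℝ) ^ s * ∏ i', wt s (j i') :=
      mul_nonneg (by positivity) (Finset.prod_nonneg fun _ _ => wt_nonneg _ _)
    by_cases hm : m ∈ Finset.Icc 1 K
    swap
    · rw [hsupp m hm, norm_zero, mul_zero]; exact hR
    by_cases hmom : momentum (i.insertNth n j : Fin (m + 1) → Idx 𝒩) = 0
    swap
    · rw [hz m _ hmom, norm_zero, mul_zero]; exact hR
    rw [Finset.mem_Icc] at hm
    have h1 := modulus_insertNth_le hm.1 i n j hmom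
    have hmK : (m : ℝ) ≤ K := by exact_mod_cast hm.2
    have h2 : wt s n ≤ (K : ℝ) ^ s * ∏ i', wt s (j i') := by
      unfold wt
      rw [Real.finsetProd_rpow _ _ (fun _ _ => modulus_nonneg _),
        ← Real.mul_rpow (by positivity) (Finset.prod_nonneg fun _ _ => modulus_nonneg _)]
      refine Real.rpow_le_rpow (modulus_nonneg _) (h1.trans ?_) hs
      exact mul_le_mul_of_nonneg_right hmK (Finset.prod_nonneg fun _ _ => modulus_nonneg _)
    calc _ ≤ ((K : ℝ) ^ s * ∏ i', wt s (j i')) * C :=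
          mul_le_mul h2 (hA _ _) (norm_nonneg _) ((wt_nonneg _ _).trans h2)
      _ = _ := by ring

theorem FunBound.of_bounded {A : Coef 𝒩} {s C : ℝ} (hs : 0 ≤ s) (hC : 0 ≤ C)
    (hA : ∀ m j, ‖A m j‖ ≤ C) : FunBound s C A := fun m j =>
  (hA m j).trans (le_mul_of_one_le_right hC (one_le_prod_real fun _ _ => one_le_wt hs _))

/-- For quadratic monomials the two modes have equal modulus, so weights pass freely from output to
input and exactly `e` derivatives are lost. -/
theorem VecBound.of_quad {A : Coef 𝒩} {s e C : ℝ} (hC : 0 ≤ C)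
    (hz : HasZeroMomentum A) (hsupp : ∀ m, m ∉ Finset.Icc 1 1 → ∀ j, A m j = 0)
    (hA : QuadBound e C A) : VecBound (s + e) s C A where
  nonneg := hC
  zero := hz
  le m i n j := by
    have hR : 0 ≤ C * ∏ i', wt (s + e) (j i') :=
      mul_nonneg hC (Finset.prod_nonneg fun _ _ => wt_nonneg _ _)
    by_cases hm : m ∈ Finset.Icc 1 1
    swap
    · rw [hsupp m hm, norm_zero, mul_zero]; exact hR
    obtain rfl : m = 1 := by simpa using hm
    by_cases hmom : momentum (i.insertNth n j : Fin (1 + 1) → Idx 𝒩) = 0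
    swap
    · rw [hz 1 _ hmom, norm_zero, mul_zero]; exact hR
    have h1 := modulus_insertNth_eq i n j hmom
    have hn : ∀ s, wt s n = wt s (j 0) := fun s => by rw [wt, wt, h1]
    have h2 := hA 1 (i.insertNth n j : Fin (1 + 1) → Idx 𝒩)
    -- The coefficient bound refers to slot `0`, which holds `n` or `j 0` according to `i`; both
    -- have the same modulus.
    have h3 : wt e ((i.insertNth n j : Fin (1 + 1) → Idx 𝒩) 0) = wt e (j 0) := by
      fin_cases i
      · exact hn e
      · rfl
    rw [h3] at h2
    rw [hn, Finset.univ_unique, Finset.prod_singleton, wt_add]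
    calc _ ≤ wt s (j 0) * (C * wt e (j 0)) := mul_le_mul_of_nonneg_left h2 (wt_nonneg _ _)
      _ = _ := by simp only [Fin.default_eq_zero]; ring

theorem FunBound.of_quad {A : Coef 𝒩} {C : ℝ} (hC : 0 ≤ C)
    (hz : HasZeroMomentum A) (hsupp : ∀ m, m ∉ Finset.Icc 1 1 → ∀ j, A m j = 0)
    (hA : QuadBound 2 C A) : FunBound 1 C A := fun m j => by
  have hR : 0 ≤ C * ∏ i', wt 1 (j i') :=
    mul_nonneg hC (Finset.prod_nonneg fun _ _ => wt_nonneg _ _)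
  by_cases hm : m ∈ Finset.Icc 1 1
  swap
  · rw [hsupp m hm, norm_zero]; exact hR
  obtain rfl : m = 1 := by simpa using hm
  by_cases hmom : momentum j = 0
  swap
  · rw [hz 1 _ hmom, norm_zero]; exact hR
  refine (hA 1 j).trans (le_of_eq ?_)
  have h1 := modulus_pair_eq j hmom
  have h2 : (2 : ℝ) = 1 + 1 := by norm_num
  rw [Fin.prod_univ_two, h2, wt_add]
  simp only [wt, h1]

theorem sum_Icc_succ {k : ℕ} (hk : 2 ≤ k) (g : ℕ → ℂ) :
    ∑ l ∈ Finset.Icc 2 k, g l = ∑ m ∈ Finset.Icc 1 (k - 1), g (m + 1) := by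
  rw [← Finset.sum_image (f := g) (g := fun m => m + 1) (fun a _ b _ h => by simpa using h)]
  congr 1
  ext l
  simp only [Finset.mem_Icc, Finset.mem_image]
  constructor
  · intro h; exact ⟨l - 1, by omega, by omega⟩
  · rintro ⟨m, h, rfl⟩; omega

theorem tsum_zeroMomentum {l : ℕ} {a b : (Fin l → Idx 𝒩) → ℂ}
    (h : ∀ j, momentum j = 0 → a j = b j) (h' : ∀ j, momentum j ≠ 0 → b j = 0) (ζ : SeqSp 𝒩) :
    ∑' j : zeroMomentum 𝒩 l, a j.1 * ∏ i, ζ (j.1 i) = ∑' j, b j * ∏ i, ζ (j i) := by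
  rw [tsum_subtype (zeroMomentum 𝒩 l) (fun j => a j * ∏ i, ζ (j i))]
  refine tsum_congr fun j => ?_
  by_cases hj : momentum j = 0
  · rw [indicator_of_mem (show j ∈ zeroMomentum 𝒩 l from hj), h j hj]
  · rw [indicator_of_notMem (show j ∉ zeroMomentum 𝒩 l from hj), h' j hj, zero_mul]

/-- Coefficients are extended by zero to all multi-indices and all degrees, so that later sums are
unrestricted. Degree `l` becomes `m + 1`, since the field of such a monomial is homogeneous of
degree `m`. -/
theorem PolyClass.exists_coef {k : ℕ} (hk : 2 ≤ k) {P : Ham 𝒩} (h : PolyClass k P) :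
    ∃ (A : Coef 𝒩) (C : ℝ), 0 ≤ C ∧ RealCoef (k - 1) A ∧ (∀ m j, ‖A m j‖ ≤ C) ∧
      ∀ ζ, MemW 1 ζ → P ζ = polyFun (k - 1) A ζ := by
  classical
  obtain ⟨a, hconj, ⟨C, hC⟩, hP⟩ := h
  have hmem : ∀ {m}, m ∈ Finset.Icc 1 (k - 1) → m + 1 ∈ Finset.Icc 2 k := fun {m} hm => by
    rw [Finset.mem_Icc] at hm ⊢; omega
  refine ⟨fun m j => if m ∈ Finset.Icc 1 (k - 1) ∧ momentum j = 0 then a (m + 1) j else 0,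
    max C 0, le_max_right _ _, ⟨fun m j hj => if_neg fun h => hj h.2,
      fun m hm j => if_neg fun h => hm h.1, fun m j => ?_⟩, fun m j => ?_, fun ζ hζ => ?_⟩
  · simp only [momentum_conj, neg_eq_zero]
    split_ifs with h
    · exact hconj _ (hmem h.1) j h.2
    · simp
  · dsimp only
    split_ifs with h
    · exact (hC _ (hmem h.1) j h.2).trans (le_max_left _ _)
    · simp
  · rw [hP ζ hζ, sum_Icc_succ hk (fun l => ∑' j : zeroMomentum 𝒩 l, a l j.1 * ∏ i, ζ (j.1 i)),
      polyFun]
    refine Finset.sum_congr rfl fun m hm => ?_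
    exact tsum_zeroMomentum (fun j hj => by rw [if_pos ⟨hm, hj⟩])
      (fun j hj => if_neg fun h => hj h.2) ζ

theorem RealCoef.polyClass {k : ℕ} (hk : 2 ≤ k) {P : Ham 𝒩} {A : Coef 𝒩} {C : ℝ}
    (h : RealCoef (k - 1) A) (hA : ∀ m j, ‖A m j‖ ≤ C)
    (hP : ∀ ζ, MemW 1 ζ → P ζ = polyFun (k - 1) A ζ) : PolyClass k P := by
  refine ⟨fun l => match l with
    | 0 => 0
    | m + 1 => A m, fun l hl j _ => ?_, ⟨C, fun l hl j _ => ?_⟩, fun ζ hζ => ?_⟩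
  · cases l with
    | zero => simp at hl
    | succ m => exact h.conj m j
  · cases l with
    | zero => simp at hl
    | succ m => exact hA m j
  · rw [hP ζ hζ, sum_Icc_succ hk, polyFun]
    refine Finset.sum_congr rfl fun m hm => ?_
    exact (tsum_zeroMomentum (fun j _ => rfl) (fun j hj => h.zero m j hj) ζ).symm

theorem QuadClass.exists_coef {P : Ham 𝒩} (h : QuadClass 2 P) :
    ∃ (A : Coef 𝒩) (C : ℝ), 0 ≤ C ∧ RealCoef 1 A ∧ QuadBound 2 C A ∧
      ∀ ζ, MemW 1 ζ → P ζ = polyFun 1 A ζ := by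
  classical
  obtain ⟨a, hconj, ⟨C, hC⟩, hP⟩ := h
  refine ⟨fun m => match m with
    | 1 => fun j => if momentum j = 0 then a j else 0
    | _ => fun _ => 0, max C 0, le_max_right _ _, ⟨fun m j hj => ?_, fun m hm j => ?_,
      fun m j => ?_⟩, fun m j => ?_, fun ζ hζ => ?_⟩
  · match m, j, hj with
    | 0, j, hj => rfl
    | 1, j, hj => exact if_neg hj
    | m + 2, j, hj => rfl
  · match m, hm, j with
    | 0, hm, j => rfl
    | 1, hm, j => simp at hm
    | m + 2, hm, j => rfl
  · match m, j with
    | 0, j => simp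
    | 1, j =>
      simp only [momentum_conj, neg_eq_zero]
      split_ifs with h
      · exact hconj j h
      · simp
    | m + 2, j => simp
  · have h0 : ∀ n : Idx 𝒩, 0 ≤ max C 0 * wt 2 n := fun n =>
      mul_nonneg (le_max_right _ _) (wt_nonneg _ _)
    match m, j with
    | 0, j => simpa using h0 (j 0)
    | 1, j =>
      change ‖if momentum j = 0 then a j else 0‖ ≤ _
      split_ifs with h
      · exact (hC j h).trans (mul_le_mul_of_nonneg_right (le_max_left _ _) (wt_nonneg _ _))
      · simpa using h0 (j 0)
    | m + 2, j => simpa using h0 (j 0)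
  · rw [hP ζ (by simpa using hζ), polyFun, Finset.Icc_self, Finset.sum_singleton]
    exact tsum_zeroMomentum (fun j hj => (if_pos hj).symm) (fun j hj => if_neg hj) ζ

theorem RealCoef.quadClass {P : Ham 𝒩} {A : Coef 𝒩} {C : ℝ}
    (h : RealCoef 1 A) (hA : QuadBound 2 C A)
    (hP : ∀ ζ, MemW 1 ζ → P ζ = polyFun 1 A ζ) : QuadClass 2 P := by
  refine ⟨A 1, fun j _ => h.conj 1 j, ⟨C, fun j _ => hA 1 j⟩, fun ζ hζ => ?_⟩
  rw [hP ζ (by simpa using hζ), polyFun, Finset.Icc_self, Finset.sum_singleton]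
  exact (tsum_zeroMomentum (fun j _ => rfl) (fun j hj => h.zero 1 j hj) ζ).symm

end

section

variable {d : ℕ} {𝒩 : Set (Fin d → ℤ)}

/-! ### Averaging and the homological equation -/

/-- The resonance indicator. -/
def resInd (κ : Idx 𝒩 → ℤ) : Coef 𝒩 := fun _ j => if ∑ i, κ (j i) = 0 then 1 else 0

/-- The indicator of the nonresonant monomials. -/
def nonresInd (κ : Idx 𝒩 → ℤ) : Coef 𝒩 := fun _ j => if ∑ i, κ (j i) = 0 then 0 else 1

/-- The multiplier that solves the homological equation. -/
def solMul (κ : Idx 𝒩 → ℤ) (T : ℝ) : Coef 𝒩 := fun _ j =>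
  if ∑ i, κ (j i) = 0 then 0 else (2 * Real.pi * Complex.I / T * (∑ i, κ (j i) : ℤ))⁻¹

open scoped Classical in
/-- The indicator of the monomials whose first mode is at most `M`. -/
def lowInd (𝒩 : Set (Fin d → ℤ)) (M : ℝ) : Coef 𝒩 :=
  fun _ j => if modulus (j 0).1.1 ≤ M then 1 else 0

open scoped Classical in
/-- The indicator of the monomials whose first mode is larger than `M`. -/
def highInd (𝒩 : Set (Fin d → ℤ)) (M : ℝ) : Coef 𝒩 :=
  fun _ j => if modulus (j 0).1.1 ≤ M then 0 else 1

theorem norm_resInd_le (κ : Idx 𝒩 → ℤ) (m : ℕ) (j : Fin (m + 1) → Idx 𝒩) :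
    ‖resInd κ m j‖ ≤ 1 := by
  unfold resInd; split_ifs <;> simp

theorem norm_nonresInd_le (κ : Idx 𝒩 → ℤ) (m : ℕ) (j : Fin (m + 1) → Idx 𝒩) :
    ‖nonresInd κ m j‖ ≤ 1 := by
  unfold nonresInd; split_ifs <;> simp

theorem norm_lowInd_le (M : ℝ) (m : ℕ) (j : Fin (m + 1) → Idx 𝒩) :
    ‖lowInd 𝒩 M m j‖ ≤ 1 := by
  unfold lowInd; split_ifs <;> simp

theorem norm_highInd_le (M : ℝ) (m : ℕ) (j : Fin (m + 1) → Idx 𝒩) :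
    ‖highInd 𝒩 M m j‖ ≤ 1 := by
  unfold highInd; split_ifs <;> simp

/-- A nonzero sum of integers has absolute value at least one, so the divisor is at least `2π/T ≥
1/T`. -/
theorem norm_solMul_le (κ : Idx 𝒩 → ℤ) {T : ℝ} (hT : 0 < T) (m : ℕ) (j : Fin (m + 1) → Idx 𝒩) :
    ‖solMul κ T m j‖ ≤ T := by
  unfold solMul
  split_ifs with h
  · simpa using hT.le
  · have h1 : (1 : ℝ) ≤ |((∑ i, κ (j i) : ℤ) : ℝ)| := by
      exact_mod_cast Int.one_le_abs h
    have h2 : (1 : ℝ) ≤ 2 * Real.pi := by linarith [Real.pi_gt_three]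
    rw [norm_inv, norm_mul, norm_div, norm_mul, norm_mul, Complex.norm_I, mul_one,
      Complex.norm_of_nonneg Real.pi_pos.le, Complex.norm_of_nonneg hT.le, Complex.norm_intCast,
      Complex.norm_two]
    refine inv_le_of_inv_le₀ hT ?_
    rw [inv_eq_one_div]
    calc 1 / T ≤ 2 * Real.pi / T := div_le_div_of_nonneg_right h2 hT.le
      _ ≤ _ := le_mul_of_one_le_right (by positivity) h1

theorem resInd_conj {κ : Idx 𝒩 → ℤ} (hκ : ∀ n, κ n.conj = -κ n) (m : ℕ)
    (j : Fin (m + 1) → Idx 𝒩) :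
    resInd κ m (fun i => (j i).conj) = (starRingEnd ℂ) (resInd κ m j) := by
  simp only [resInd, hκ, Finset.sum_neg_distrib, neg_eq_zero]
  split_ifs <;> simp

theorem resInd_add_nonresInd (κ : Idx 𝒩 → ℤ) (m : ℕ) (j : Fin (m + 1) → Idx 𝒩) :
    resInd κ m j + nonresInd κ m j = 1 := by
  unfold resInd nonresInd; split_ifs <;> simp

theorem lowInd_add_highInd (M : ℝ) (m : ℕ) (j : Fin (m + 1) → Idx 𝒩) :
    lowInd 𝒩 M m j + highInd 𝒩 M m j = 1 := by
  unfold lowInd highInd; split_ifs <;> simp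

theorem solMul_mul (κ : Idx 𝒩 → ℤ) {T : ℝ} (hT : 0 < T) (m : ℕ) (j : Fin (m + 1) → Idx 𝒩) :
    solMul κ T m j * ∑ i, (2 * Real.pi * Complex.I / T * κ (j i)) = nonresInd κ m j := by
  unfold solMul nonresInd
  rw [← Finset.mul_sum, ← Int.cast_sum]
  split_ifs with h
  · simp
  · refine inv_mul_cancel₀ (mul_ne_zero ?_ (Int.cast_ne_zero.2 h))
    have : (T : ℂ) ≠ 0 := Complex.ofReal_ne_zero.2 hT.ne'
    have := Real.pi_ne_zero
    simp [*]

theorem resInd_mul (κ : Idx 𝒩 → ℤ) (T : ℝ) (m : ℕ) (j : Fin (m + 1) → Idx 𝒩) :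
    resInd κ m j * ∑ i, (2 * Real.pi * Complex.I / T * κ (j i)) = 0 := by
  unfold resInd
  rw [← Finset.mul_sum, ← Int.cast_sum]
  split_ifs with h
  · simp [h]
  · simp

theorem QuadBound.mul {e C D : ℝ} {A q : Coef 𝒩} (h : QuadBound e C A)
    (hq : ∀ m j, ‖q m j‖ ≤ D) : QuadBound e (C * D) (fun m j => A m j * q m j) := by
  intro m j
  rw [norm_mul]
  have h1 := h m j
  refine (mul_le_mul h1 (hq _ _) (norm_nonneg _) ((norm_nonneg _).trans h1)).trans (le_of_eq ?_)
  ring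

theorem QuadBound.low {C M : ℝ} (hC : 0 ≤ C) {A : Coef 𝒩} (h : QuadBound 2 C A) :
    QuadBound 0 (C * M ^ 2) (fun m j => A m j * lowInd 𝒩 M m j) := by
  intro m j
  unfold lowInd
  dsimp only
  split_ifs with hM
  · rw [mul_one]
    refine (h m j).trans ?_
    unfold wt
    rw [Real.rpow_zero, mul_one, Real.rpow_two]
    exact mul_le_mul_of_nonneg_left (pow_le_pow_left₀ (modulus_nonneg _) hM 2) hC
  · rw [mul_zero, norm_zero]
    exact mul_nonneg (by positivity) (wt_nonneg _ _)

/-- Above the cutoff `|n|^{s₀-2} M^{-(s₀-2)} ≥ 1`: smallness is bought with extra derivatives. -/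
theorem QuadBound.high {C M s₀ : ℝ} (hC : 0 ≤ C) (hM : 0 < M) (hs₀ : 2 ≤ s₀) {A : Coef 𝒩}
    (h : QuadBound 2 C A) :
    QuadBound s₀ (C * M ^ (-(s₀ - 2))) (fun m j => A m j * highInd 𝒩 M m j) := by
  intro m j
  unfold highInd
  dsimp only
  split_ifs with hle
  · rw [mul_zero, norm_zero]
    exact mul_nonneg (mul_nonneg hC (Real.rpow_nonneg hM.le _)) (wt_nonneg _ _)
  · rw [mul_one]
    refine (h m j).trans ?_
    rw [mul_assoc]
    refine mul_le_mul_of_nonneg_left ?_ hC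
    have h1 : wt s₀ (j 0) = wt 2 (j 0) * wt (s₀ - 2) (j 0) := by
      rw [← wt_add]; congr 1; ring
    have h2 : 1 ≤ M ^ (-(s₀ - 2)) * wt (s₀ - 2) (j 0) := by
      rw [Real.rpow_neg hM.le, inv_mul_eq_div, one_le_div (Real.rpow_pos_of_pos hM _)]
      exact Real.rpow_le_rpow hM.le (not_le.1 hle).le (by linarith)
    rw [h1]
    nlinarith [wt_nonneg 2 (j 0)]

/-- Euler's identity: differentiating along a diagonal linear field multiplies each monomial by the
sum of its eigenvalues. -/
theorem fderiv_polyFun_mul {s C : ℝ} {A B : Coef 𝒩} (h : FunBound s C A) (K : ℕ) {c : Idx 𝒩 → ℂ}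
    {x v : W 𝒩 s} (hv : ∀ n, v.seq n = c n * x.seq n)
    (hB : ∀ m j, B m j = A m j * ∑ i, c (j i)) :
    fderiv ℂ (fun y : W 𝒩 s => polyFun K A y.seq) x v = polyFun K B x.seq := by
  have hd : HasFDerivAt (fun y : W 𝒩 s => polyFun K A y.seq) (∑ m ∈ Finset.Icc 1 K,
      fderiv ℂ (familyPoly (h m)) x) x := by
    simp only [h.map_eq K]
    exact HasFDerivAt.fun_sum fun m _ =>
      (hasFDerivAt_familyPoly (h m) _).differentiableAt.hasFDerivAt
  rw [hd.fderiv, sum_apply, polyFun]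
  refine Finset.sum_congr rfl fun m _ => ?_
  rw [fderiv_familyPoly]
  simp only [familyMap_apply]
  rw [← Summable.tsum_finsetSum fun i _ => summable_family (h m) _]
  refine tsum_congr fun j => ?_
  rw [hB, Finset.mul_sum, Finset.sum_mul]
  refine Finset.sum_congr rfl fun i _ => ?_
  have : ∏ i', (Function.update (fun _ => x) i v i').seq (j i')
      = c (j i) * ∏ i', x.seq (j i') := by
    rw [← Finset.mul_prod_erase _ _ (Finset.mem_univ i), Function.update_self, hv,
      ← Finset.mul_prod_erase _ (fun i' => x.seq (j i')) (Finset.mem_univ i), mul_assoc]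
    congr 2
    refine Finset.prod_congr rfl fun i' hi' => ?_
    rw [Function.update_of_ne (Finset.ne_of_mem_erase hi')]
  rw [this, smul_eq_mul]
  ring

section Flow

variable {s₁ T : ℝ} {h₀ : Ham 𝒩} {Φ : ℝ → SeqSp 𝒩 → SeqSp 𝒩} {κ : Idx 𝒩 → ℤ} {s : ℝ}

/-- The homological operator. By antisymmetry `dh₀(X_A) = -dA(X_{h₀})`, and the latter is diagonal
on monomials. The computation needs `X_{h₀}` in `𝒲^s`, true on `𝒲^{s + 2 s₁}`; both sides are
continuous on `𝒲^s`, so density finishes. -/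
theorem fderiv_unperturbed_field (h : PeriodicFlow s₁ h₀ Φ T) (hD : Diagonal s₁ T h₀ Φ κ)
    (hs : s₁ ≤ s) (hs0 : 0 ≤ s) (hs₁ : 0 ≤ s₁) {A B : Coef 𝒩} {C C' C'' : ℝ} (hA : FunBound s C A)
    (hA' : VecBound s s C' A) (hB : FunBound s C'' B) (K : ℕ)
    (hAB : ∀ m j, B m j = A m j * ∑ i, (2 * Real.pi * Complex.I / T * κ (j i))) (x : W 𝒩 s) :
    fderiv ℂ (fun y : W 𝒩 s => h₀ y.seq) x (hA'.field K x) = -polyFun K B x.seq := by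
  have hle : s ≤ s + 2 * s₁ := by linarith
  have hc1 : Continuous fun x : W 𝒩 s =>
      fderiv ℂ (fun y : W 𝒩 s => h₀ y.seq) x (hA'.field K x) :=
    ((h.contDiff s hs).continuous_fderiv (by simp)).clm_apply (hA'.contDiff_field K).continuous
  have hc2 : Continuous fun x : W 𝒩 s => -polyFun K B x.seq := (hB.contDiff K).continuous.neg
  have heq := (denseRange_incl (𝒩 := 𝒩) hle).equalizer hc1 hc2 (funext fun y => ?_)
  · exact congrFun heq x
  · have hm : MemW s (fun n => 2 * Real.pi * Complex.I / T * κ n * (incl hle y).seq n) := by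
      rw [incl_seq]
      exact hD.memW_field h y.memW
    simp only [Function.comp]
    rw [hD.fderiv_eq h hs hs0 hm, sympForm_antisymm]
    have h1 := hasFDerivAt_polyFun hs0 le_rfl hA hA' K (incl hle y)
    have h2 : incl (le_refl s) (incl hle y) = incl hle y :=
      W.ext_seq (by rw [incl_seq])
    rw [h2] at h1
    rw [← h1.fderiv, fderiv_polyFun_mul hA K (fun n => by rw [toW_seq]) hAB]

/-- The bracket series is the basis expansion of `dZ(X_{h₀})` grouped by modes, which also gives its
convergence. Its sum vanishes because only resonant monomials occur. -/
theorem hasPoissonBracket_zero (h : PeriodicFlow s₁ h₀ Φ T) (hD : Diagonal s₁ T h₀ Φ κ)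
    (hs : s₁ ≤ s) {A : Coef 𝒩} {C : ℝ} (hA : FunBound s C A) {K : ℕ}
    (hres : ∀ m j, A m j * ∑ i, (2 * Real.pi * Complex.I / T * κ (j i)) = 0) {Z : Ham 𝒩}
    (hZ : ∀ ζ, MemW s ζ → Z ζ = polyFun K A ζ) {ζ : SeqSp 𝒩}
    (hζ : MemW s ζ) (hζ' : MemW s (fun n => 2 * Real.pi * Complex.I / T * κ n * ζ n)) :
    HasPoissonBracket Z h₀ ζ 0 := by
  set x := toW s ζ hζ with hx
  set v := toW s _ hζ' with hv
  have hfun : (fun y : W 𝒩 s => Z y.seq) = fun y => polyFun K A y.seq :=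
    funext fun y => hZ _ y.memW
  have hd : HasFDerivAt (fun y : W 𝒩 s => Z y.seq)
      (fderiv ℂ (fun y : W 𝒩 s => polyFun K A y.seq) x) x := by
    rw [hfun]
    exact (((hA.contDiff K).differentiable (by simp)) x).hasFDerivAt
  have h0 : fderiv ℂ (fun y : W 𝒩 s => polyFun K A y.seq) x v = 0 := by
    rw [fderiv_polyFun_mul (B := fun _ _ => 0) hA K (c := fun n => 2 * Real.pi * Complex.I / T * κ n)
      (fun n => rfl) (fun m j => (hres m j).symm)]
    simp [polyFun]
  have h1 := hasSum_apply (fderiv ℂ (fun y : W 𝒩 s => polyFun K A y.seq) x) v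
  rw [h0] at h1
  have h2 := h1.prod_fiberwise (fun a => hasSum_fintype _)
  rw [HasPoissonBracket]
  refine (congrArg (fun f => HasSum f 0) (funext fun a => ?_)).mpr h2
  have hζs := hζ.mono hs
  have e1 : partialDeriv Z (a, 1) ζ = _ := partialDeriv_eq hd (a, 1)
  have e2 : partialDeriv Z (a, -1) ζ = _ := partialDeriv_eq hd (a, -1)
  have c1 : κ (a, -1) = -κ (a, 1) := hD.conj h (a, 1)
  rw [e1, e2, partialDeriv_of_diagonal hD hζs, partialDeriv_of_diagonal hD hζs, units_eq_pair,
    Finset.sum_pair (by decide)]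
  simp only [Idx.conj, neg_neg, hv, toW_seq, sgn, c1, smul_eq_mul]
  push_cast
  ring

theorem integral_exp_freq (hT : 0 < T) (k : ℤ) :
    ∫ τ in (0 : ℝ)..T, Complex.exp (2 * Real.pi * Complex.I * (k * τ / T))
      = T * if k = 0 then 1 else 0 := by
  have hT' : (T : ℂ) ≠ 0 := Complex.ofReal_ne_zero.2 hT.ne'
  split_ifs with hk
  · simp [hk]
  · have hc : (2 * Real.pi * Complex.I * k / T : ℂ) ≠ 0 := by
      have := Real.pi_ne_zero
      simp [*]
    have h1 := integral_exp_mul_complex (a := 0) (b := T) hc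
    have h2 : (2 * Real.pi * Complex.I * k / T : ℂ) * T = k * (2 * Real.pi * Complex.I) := by
      field_simp
    rw [h2, Complex.exp_int_mul_two_pi_mul_I] at h1
    simp only [Complex.ofReal_zero, mul_zero, Complex.exp_zero, sub_self, zero_div] at h1
    rw [mul_zero, ← h1]
    congr 1
    funext τ
    congr 1
    ring

/-- The flow multiplies a monomial by a phase of integer frequency, whose mean over a period is the
resonance indicator. Moduli are conserved, so the series of absolute values at `ζ` dominates and sum
and integral can be exchanged. -/
theorem timeAverage_polyFun (h : PeriodicFlow s₁ h₀ Φ T) (hD : Diagonal s₁ T h₀ Φ κ)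
    {A : Coef 𝒩} {C : ℝ} (hA : FunBound 1 C A) {K : ℕ} {P : Ham 𝒩}
    (hP : ∀ ζ, MemW 1 ζ → P ζ = polyFun K A ζ) {ζ : SeqSp 𝒩} (hζ : MemW 1 ζ) :
    timeAverage Φ T P ζ = polyFun K (fun m j => A m j * resInd κ m j) ζ := by
  have hT := h.period_pos
  have hT' : (T : ℂ) ≠ 0 := Complex.ofReal_ne_zero.2 hT.ne'
  have hterm : ∀ (m : ℕ) (j : Fin (m + 1) → Idx 𝒩) (τ : ℝ), A m j * ∏ i, Φ τ ζ (j i)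
      = (A m j * ∏ i, ζ (j i)) *
        Complex.exp (2 * Real.pi * Complex.I * ((∑ i, κ (j i) : ℤ) * τ / T)) := by
    intro m j τ
    simp only [hD.flow ζ hζ, Finset.prod_mul_distrib, ← Complex.exp_sum]
    rw [← Finset.mul_sum, ← Finset.sum_div, ← Finset.sum_mul]
    push_cast
    ring
  have hsum : ∀ m, Summable fun j : Fin (m + 1) → Idx 𝒩 => ‖A m j * ∏ i, ζ (j i)‖ := by
    intro m
    refine Summable.of_nonneg_of_le (fun _ => norm_nonneg _) (fun j => ?_)
      ((hasSum_prod_norm fun _ : Fin (m + 1) => toW 1 ζ hζ).summable.mul_left C)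
    have := norm_family_le (hA m) (fun _ => toW 1 ζ hζ) j
    rwa [smul_eq_mul, mul_comm] at this
  have hnorm : ∀ (k : ℤ) (τ : ℝ),
      ‖Complex.exp (2 * Real.pi * Complex.I * (k * τ / T))‖ = 1 := by
    intro k τ
    have : (2 * Real.pi * Complex.I * (k * τ / T) : ℂ)
        = ((2 * Real.pi * (k * τ / T) : ℝ) : ℂ) * Complex.I := by
      push_cast; ring
    rw [this, Complex.norm_exp_ofReal_mul_I]
  have hint : ∀ m, HasSum (fun j : Fin (m + 1) → Idx 𝒩 => (A m j * ∏ i, ζ (j i)) *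
      (T * if ∑ i, κ (j i) = 0 then 1 else 0))
      (∫ τ in (0 : ℝ)..T, ∑' j : Fin (m + 1) → Idx 𝒩, A m j * ∏ i, Φ τ ζ (j i)) := by
    intro m
    have h1 := intervalIntegral.hasSum_integral_of_dominated_convergence (μ := MeasureTheory.volume)
      (a := 0) (b := T)
      (F := fun (j : Fin (m + 1) → Idx 𝒩) (τ : ℝ) => A m j * ∏ i, Φ τ ζ (j i))
      (f := fun τ => ∑' j : Fin (m + 1) → Idx 𝒩, A m j * ∏ i, Φ τ ζ (j i))
      (fun j _ => ‖A m j * ∏ i, ζ (j i)‖) (fun j => ?_) (fun j => ?_) ?_ ?_ ?_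
    · refine (congrArg (fun f => HasSum f _) (funext fun j => ?_)).mpr h1
      simp only [hterm]
      rw [intervalIntegral.integral_const_mul, integral_exp_freq hT]
    · simp only [hterm]
      exact (by fun_prop : Continuous _).aestronglyMeasurable
    · refine Eventually.of_forall fun τ _ => ?_
      rw [hterm, norm_mul, hnorm, mul_one]
    · exact Eventually.of_forall fun τ _ => hsum m
    · exact intervalIntegrable_const
    · refine Eventually.of_forall fun τ _ => Summable.hasSum ?_
      refine Summable.of_norm ((hsum m).congr fun j => ?_)
      rw [hterm, norm_mul _ (Complex.exp _), hnorm, mul_one]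
  have hintegrand : ∀ τ, P (Φ τ ζ) = ∑ m ∈ Finset.Icc 1 K,
      ∑' j : Fin (m + 1) → Idx 𝒩, A m j * ∏ i, Φ τ ζ (j i) := fun τ =>
    hP _ (h.mapsTo 1 le_rfl τ ζ hζ)
  unfold timeAverage
  simp only [hintegrand]
  rw [intervalIntegral.integral_finsetSum, polyFun, Finset.mul_sum]
  · refine Finset.sum_congr rfl fun m _ => ?_
    rw [← (hint m).tsum_eq, ← tsum_mul_left]
    refine tsum_congr fun j => ?_
    unfold resInd
    field_simp
  · intro m _
    refine Continuous.intervalIntegrable ?_ _ _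
    refine continuous_tsum (fun j => ?_) (hsum m) (fun j τ => ?_)
    · simp only [hterm]
      fun_prop
    · rw [hterm, norm_mul _ (Complex.exp _), hnorm, mul_one]

end Flow

end

section

variable {d : ℕ} {𝒩 : Set (Fin d → ℤ)}

/-! ### Bounds on large balls from bounds on small balls -/

/-- Lagrange interpolation at `K + 1` distinct nodes of modulus at most `ε`, evaluated at `1`. -/
theorem exists_extrapolation (K : ℕ) {ε : ℝ} (hε : 0 < ε) :
    ∃ t c : Fin (K + 1) → ℂ, (∀ i, ‖t i‖ ≤ ε) ∧ ∀ g : ℕ → ℂ,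
      ∑ m ∈ Finset.Icc 1 K, g m = ∑ i, c i * ∑ m ∈ Finset.Icc 1 K, t i ^ m * g m := by
  classical
  set t : Fin (K + 1) → ℂ := fun i => ((ε * ((i : ℝ) / (K + 1)) : ℝ) : ℂ) with ht
  have hK : (0 : ℝ) < K + 1 := by positivity
  have hinj : Set.InjOn t ↑(Finset.univ : Finset (Fin (K + 1))) := by
    intro i _ i' _ h
    simp only [ht, Complex.ofReal_inj] at h
    have h1 := mul_left_cancel₀ hε.ne' h
    rw [div_left_inj' hK.ne'] at h1
    exact Fin.ext (by exact_mod_cast h1)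
  refine ⟨t, fun i => (Lagrange.basis Finset.univ t i).eval 1, fun i => ?_, fun g => ?_⟩
  · rw [ht, Complex.norm_of_nonneg (by positivity)]
    refine mul_le_of_le_one_right hε.le ((div_le_one hK).2 ?_)
    have : (i : ℕ) ≤ K + 1 := i.2.le
    exact_mod_cast this
  · set p : Polynomial ℂ := ∑ m ∈ Finset.Icc 1 K, Polynomial.C (g m) * Polynomial.X ^ m with hp
    have hdeg : p.degree < (Finset.univ : Finset (Fin (K + 1))).card := by
      rw [Finset.card_univ, Fintype.card_fin, hp]
      refine (Polynomial.degree_sum_le _ _).trans_lt ?_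
      rw [Finset.sup_lt_iff (by exact_mod_cast WithBot.bot_lt_coe (K + 1))]
      intro m hm
      refine (Polynomial.degree_C_mul_X_pow_le m _).trans_lt ?_
      rw [Finset.mem_Icc] at hm
      exact_mod_cast Nat.lt_succ_of_le hm.2
    have heval : ∀ z, p.eval z = ∑ m ∈ Finset.Icc 1 K, z ^ m * g m := fun z => by
      rw [hp, Polynomial.eval_finsetSum]
      refine Finset.sum_congr rfl fun m _ => ?_
      rw [Polynomial.eval_mul, Polynomial.eval_C, Polynomial.eval_pow, Polynomial.eval_X, mul_comm]
    have h1 := congrArg (Polynomial.eval 1) (Lagrange.eq_interpolate hinj hdeg)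
    rw [heval 1, Lagrange.interpolate_apply, Polynomial.eval_finsetSum] at h1
    simp only [one_pow, one_mul] at h1
    rw [h1]
    refine Finset.sum_congr rfl fun i _ => ?_
    rw [Polynomial.eval_mul, Polynomial.eval_C, heval, mul_comm]

theorem polyField_smul (K : ℕ) (A : Coef 𝒩) (ζ : SeqSp 𝒩) (n : Idx 𝒩) :
    ∃ g : ℕ → ℂ, ∀ c : ℂ, polyField K A (c • ζ) n = ∑ m ∈ Finset.Icc 1 K, c ^ m * g m := by
  refine ⟨fun m => Complex.I * sgn n * ∑ i : Fin (m + 1), ∑' j : Fin m → Idx 𝒩,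
    A m (i.insertNth n.conj j : Fin (m + 1) → Idx 𝒩) * ∏ i', ζ (j i'), fun c => ?_⟩
  rw [polyField, polyGrad, Finset.mul_sum]
  refine Finset.sum_congr rfl fun m _ => ?_
  rw [mul_left_comm (c ^ m)]
  refine congrArg _ ?_
  rw [Finset.mul_sum]
  refine Finset.sum_congr rfl fun i _ => ?_
  rw [← tsum_mul_left]
  refine tsum_congr fun j => ?_
  simp only [Pi.smul_apply, smul_eq_mul, Finset.prod_mul_distrib, Finset.prod_const,
    Finset.card_univ, Fintype.card_fin]
  ring

theorem polyField_extrapolate {K K' : ℕ} (hK : K ≤ K') {t c : Fin (K' + 1) → ℂ}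
    (h : ∀ g : ℕ → ℂ,
      ∑ m ∈ Finset.Icc 1 K', g m = ∑ i, c i * ∑ m ∈ Finset.Icc 1 K', t i ^ m * g m)
    (A : Coef 𝒩) (ζ : SeqSp 𝒩) (n : Idx 𝒩) :
    polyField K A ζ n = ∑ i, c i * polyField K A (t i • ζ) n := by
  obtain ⟨g, hg⟩ := polyField_smul K A ζ n
  have hsub : Finset.Icc 1 K ⊆ Finset.Icc 1 K' := Finset.Icc_subset_Icc le_rfl hK
  have key : ∀ z : ℂ, ∑ m ∈ Finset.Icc 1 K, z ^ m * g m
      = ∑ m ∈ Finset.Icc 1 K', z ^ m * (if m ∈ Finset.Icc 1 K then g m else 0) := fun z => by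
    rw [← Finset.sum_subset hsub (fun m _ hm => by rw [if_neg hm, mul_zero])]
    exact Finset.sum_congr rfl fun m hm => by rw [if_pos hm]
  have h1 := hg 1
  rw [one_smul, key] at h1
  simp only [one_pow, one_mul] at h1
  rw [h1, h]
  refine Finset.sum_congr rfl fun i _ => ?_
  rw [hg, key]

/-- The constant depends only on degrees and radii, not on coefficients. This matters because the
coefficients of `F δ` carry no bound uniform in `δ`; only the field bound of the expansion does. -/
theorem field_bound_extend {s s' r ρ : ℝ} (hs : 0 ≤ s) (hss : s ≤ s') (hr : 0 ≤ r) (hρ : 0 < ρ)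
    {K₁ K₂ : ℕ} (hK : K₁ ≤ K₂) :
    ∃ D : ℝ, 0 ≤ D ∧ ∀ {A A₁ A₂ : Coef 𝒩} {C C₁ C₂ E E₁ E₂ : ℝ} (_ : FunBound s C A)
      (_ : FunBound s C₁ A₁) (_ : FunBound s C₂ A₂) (_ : VecBound s' s E A)
      (_ : VecBound s' s E₁ A₁) (_ : VecBound s' s E₂ A₂) (z : ℂ) (P : Ham 𝒩)
      (_ : ∀ ζ, MemW s ζ → P ζ = polyFun K₂ A ζ - (polyFun K₁ A₁ ζ + z * polyFun K₂ A₂ ζ))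
      {B : ℝ} (_ : FieldBound (vectorField P) s' ρ s B) (x : W 𝒩 s') (_ : ‖x‖ ≤ r),
      ∃ X : W 𝒩 s, HasFDerivAt (fun y : W 𝒩 s => P y.seq) (sympForm hs X) (incl hss x) ∧
        ‖X‖ ≤ D * B := by
  -- Nodes of this size send the ball of radius `r` into the ball of radius `ρ`.
  have hε : 0 < ρ / (2 * (r + 1)) := by positivity
  obtain ⟨t, c, ht, hext⟩ := exists_extrapolation K₂ hε
  refine ⟨∑ i, ‖c i‖, by positivity, ?_⟩
  intro A A₁ A₂ C C₁ C₂ E E₁ E₂ hA hA₁ hA₂ hE hE₁ hE₂ z P hP B hB x hx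
  have hd : ∀ y : W 𝒩 s', HasFDerivAt (fun y : W 𝒩 s => P y.seq)
      (sympForm hs (hE.field K₂ y - (hE₁.field K₁ y + z • hE₂.field K₂ y))) (incl hss y) := by
    intro y
    have h1 := (hasFDerivAt_polyFun hs hss hA hE K₂ y).sub
      ((hasFDerivAt_polyFun hs hss hA₁ hE₁ K₁ y).add
        ((hasFDerivAt_polyFun hs hss hA₂ hE₂ K₂ y).const_mul z))
    refine (h1.congr_fderiv ?_).congr_of_eventuallyEq
      (Eventually.of_forall fun u => hP _ u.memW)
    simp only [map_sub, map_add, map_smul]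
  refine ⟨_, hd x, ?_⟩
  have hsmall : ∀ i, ‖hE.field K₂ (t i • x) - (hE₁.field K₁ (t i • x)
      + z • hE₂.field K₂ (t i • x))‖ ≤ B := by
    intro i
    have hmem : (t i • x).seq ∈ ballW 𝒩 s' ρ := by
      refine ⟨(t i • x).memW, fun σ => (compNorm_le_norm _ σ).trans_lt ?_⟩
      rw [norm_smul]
      calc ‖t i‖ * ‖x‖ ≤ ρ / (2 * (r + 1)) * r :=
            mul_le_mul (ht i) hx (norm_nonneg _) hε.le
        _ < ρ := by
          rw [div_mul_eq_mul_div, div_lt_iff₀ (by positivity)]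
          nlinarith
    have h1 := (hB _ hmem).2
    have h2 := vectorField_eq hs (hd (t i • x))
    rw [incl_seq] at h2
    rwa [h2, ← W.norm_eq_normW] at h1
  have heq : hE.field K₂ x - (hE₁.field K₁ x + z • hE₂.field K₂ x) = ∑ i, c i •
      (hE.field K₂ (t i • x) - (hE₁.field K₁ (t i • x) + z • hE₂.field K₂ (t i • x))) := by
    refine W.ext_seq (funext fun n => ?_)
    rw [seq_sum]
    simp only [seq_sub, seq_add, seq_smul, Pi.sub_apply, Pi.add_apply, Pi.smul_apply, smul_eq_mul,
      VecBound.field_seq]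
    rw [polyField_extrapolate le_rfl hext A x.seq n, polyField_extrapolate hK hext A₁ x.seq n,
      polyField_extrapolate le_rfl hext A₂ x.seq n, Finset.mul_sum, ← Finset.sum_add_distrib,
      ← Finset.sum_sub_distrib]
    exact Finset.sum_congr rfl fun i _ => by ring
  rw [heq, Finset.sum_mul]
  refine norm_sum_le_of_le _ fun i _ => ?_
  rw [norm_smul]
  exact mul_le_mul_of_nonneg_left (hsmall i) (norm_nonneg _)

end

section

variable {d : ℕ} {𝒩 : Set (Fin d → ℤ)}

/-! ### The generating vector field -/

theorem VecBound.weaken {s' s C C' : ℝ} {A : Coef 𝒩} (h : VecBound s' s C A) (hC : C ≤ C') :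
    VecBound s' s C' A where
  nonneg := h.nonneg.trans hC
  zero := h.zero
  le m i n j := (h.le m i n j).trans
    (mul_le_mul_of_nonneg_right hC (Finset.prod_nonneg fun _ _ => wt_nonneg _ _))

theorem VecBound.field_seq_congr {s' s t' t C C' : ℝ} {A : Coef 𝒩} (h : VecBound s' s C A)
    (h' : VecBound t' t C' A) (K : ℕ) {x : W 𝒩 s'} {y : W 𝒩 t'} (hxy : x.seq = y.seq) :
    (h.field K x).seq = (h'.field K y).seq := by
  rw [h.field_seq, h'.field_seq, hxy]

theorem VecBound.fderiv_field_one {s' s C : ℝ} {A : Coef 𝒩} (h : VecBound s' s C A)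
    (x v : W 𝒩 s') : fderiv ℂ (h.field 1) x v = h.field 1 v := by
  have hd : HasFDerivAt (h.field 1) (∑ m ∈ Finset.Icc 1 1, ∑ i : Fin (m + 1),
      fderiv ℂ (familyPoly (h.norm_mono_le m i)) x) x :=
    HasFDerivAt.fun_sum fun m _ => HasFDerivAt.fun_sum fun i _ =>
      (hasFDerivAt_familyPoly (h.norm_mono_le m i) x).differentiableAt.hasFDerivAt
  rw [hd.fderiv, VecBound.field, Finset.Icc_self, Finset.sum_singleton, Finset.sum_singleton,
    sum_apply]
  refine Finset.sum_congr rfl fun i _ => ?_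
  rw [fderiv_familyPoly, Finset.univ_unique, Finset.sum_singleton, familyPoly]
  congr 1
  funext i'
  rw [Subsingleton.elim i' default, Function.update_self]

theorem VecBound.norm_field_one_le {s' s C : ℝ} {A : Coef 𝒩} (h : VecBound s' s C A)
    (x : W 𝒩 s') : ‖h.field 1 x‖ ≤ C * 4 * ‖x‖ := by
  rw [VecBound.field, Finset.Icc_self, Finset.sum_singleton]
  refine (norm_sum_le _ _).trans ?_
  calc _ ≤ ∑ _i : Fin (1 + 1), 2 * C * ‖x‖ := Finset.sum_le_sum fun i _ => by
        simpa using norm_familyPoly_le (h.norm_mono_le 1 i) x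
    _ = _ := by simp; ring

/-- The data of the averaging step: coefficients of the two leading terms and frequencies. -/
structure NormalFormData (𝒩 : Set (Fin d → ℤ)) where
  /-- coefficients of the quadratic term -/
  A₁ : Coef 𝒩
  /-- coefficients of the bounded term -/
  A₂ : Coef 𝒩
  /-- normalized frequencies -/
  κ : Idx 𝒩 → ℤ
  /-- period -/
  T : ℝ
  /-- bound of the coefficients -/
  c : ℝ
  /-- one less than the degree of the bounded term -/
  K : ℕ
  T_pos : 0 < T
  c_nonneg : 0 ≤ c
  one_le_K : 1 ≤ K
  real₁ : RealCoef 1 A₁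
  real₂ : RealCoef K A₂
  quad : QuadBound 2 c A₁
  bounded : ∀ m j, ‖A₂ m j‖ ≤ c
  conj : ∀ n, κ n.conj = -κ n

namespace NormalFormData

variable (D : NormalFormData 𝒩)

/-- The resonant part of the quadratic term. -/
def res₁ : Coef 𝒩 := fun m j => D.A₁ m j * resInd D.κ m j

/-- The resonant part of the bounded term. -/
def res₂ : Coef 𝒩 := fun m j => D.A₂ m j * resInd D.κ m j

/-- The nonresonant part of the quadratic term. -/
def non₁ : Coef 𝒩 := fun m j => D.A₁ m j * nonresInd D.κ m j

/-- The nonresonant part of the bounded term. -/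
def non₂ : Coef 𝒩 := fun m j => D.A₂ m j * nonresInd D.κ m j

/-- The low modes of `non₁`. -/
def low₁ (M : ℝ) : Coef 𝒩 := fun m j => D.non₁ m j * lowInd 𝒩 M m j

/-- The high modes of `non₁`. -/
def high₁ (M : ℝ) : Coef 𝒩 := fun m j => D.non₁ m j * highInd 𝒩 M m j

/-- The solution of the homological equation for the quadratic term. -/
def sol₁ : Coef 𝒩 := fun m j => D.A₁ m j * solMul D.κ D.T m j

/-- The truncated solution of the homological equation for the quadratic term. -/
def gen₁ (M : ℝ) : Coef 𝒩 := fun m j => D.sol₁ m j * lowInd 𝒩 M m j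

/-- The solution of the homological equation for the bounded term. -/
def gen₂ : Coef 𝒩 := fun m j => D.A₂ m j * solMul D.κ D.T m j

/-- A common constant for all vector fields with values in `𝒲^σ`. -/
def bd (σ : ℝ) : ℝ := D.c * (1 + D.T) * (D.K : ℝ) ^ σ

theorem one_le_pow {σ : ℝ} (hσ : 0 ≤ σ) : (1 : ℝ) ≤ (D.K : ℝ) ^ σ :=
  Real.one_le_rpow (by exact_mod_cast D.one_le_K) hσ

theorem bd_nonneg (σ : ℝ) : 0 ≤ D.bd σ := by
  have := D.c_nonneg
  have := D.T_pos
  unfold bd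
  positivity

theorem bd_mono {σ τ : ℝ} (h : σ ≤ τ) : D.bd σ ≤ D.bd τ := by
  have := D.c_nonneg
  have := D.T_pos
  unfold bd
  exact mul_le_mul_of_nonneg_left
    (Real.rpow_le_rpow_of_exponent_le (by exact_mod_cast D.one_le_K) h) (by positivity)

theorem le_bd {σ : ℝ} (hσ : 0 ≤ σ) : D.c ≤ D.bd σ := by
  have h1 := D.one_le_pow hσ
  have h2 := D.c_nonneg
  have h3 := D.T_pos
  unfold bd
  rw [mul_assoc]
  refine le_mul_of_one_le_right h2 ?_
  nlinarith

theorem le_bd' {σ : ℝ} (hσ : 0 ≤ σ) : D.c * D.T ≤ D.bd σ := by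
  have h1 := D.one_le_pow hσ
  have h2 := D.c_nonneg
  have h3 := D.T_pos
  unfold bd
  rw [mul_assoc]
  refine mul_le_mul_of_nonneg_left ?_ h2
  nlinarith

theorem zeroMomentum_mul {A q : Coef 𝒩} (h : HasZeroMomentum A) :
    HasZeroMomentum fun m j => A m j * q m j := fun m j hj => by
  simp only [h m j hj, zero_mul]

theorem support_mul {K : ℕ} {A q : Coef 𝒩} (h : ∀ m, m ∉ Finset.Icc 1 K → ∀ j, A m j = 0) :
    ∀ m, m ∉ Finset.Icc 1 K → ∀ j, (fun m j => A m j * q m j : Coef 𝒩) m j = 0 :=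
  fun m hm j => by simp only [h m hm j, zero_mul]

variable {σ : ℝ}

theorem vec_A₁ (hσ : 0 ≤ σ) : VecBound (σ + 2) σ (D.bd σ) D.A₁ :=
  (VecBound.of_quad D.c_nonneg D.real₁.zero D.real₁.support D.quad).weaken (D.le_bd hσ)

theorem vec_A₂ (hσ : 0 ≤ σ) : VecBound σ σ (D.bd σ) D.A₂ :=
  (VecBound.of_bounded hσ D.c_nonneg D.real₂.zero D.real₂.support D.bounded).weaken (by
    have h1 := D.one_le_pow hσ
    have h2 := D.c_nonneg
    have h3 := D.T_pos
    unfold bd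
    exact mul_le_mul_of_nonneg_right (le_mul_of_one_le_right h2 (by linarith)) (by linarith))

theorem vec_res₁ (hσ : 0 ≤ σ) : VecBound (σ + 2) σ (D.bd σ) D.res₁ :=
  ((D.vec_A₁ hσ).mul (norm_resInd_le D.κ) zero_le_one).weaken (mul_one _).le

theorem vec_res₂ (hσ : 0 ≤ σ) : VecBound σ σ (D.bd σ) D.res₂ :=
  ((D.vec_A₂ hσ).mul (norm_resInd_le D.κ) zero_le_one).weaken (mul_one _).le

theorem vec_non₁ (hσ : 0 ≤ σ) : VecBound (σ + 2) σ (D.bd σ) D.non₁ :=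
  ((D.vec_A₁ hσ).mul (norm_nonresInd_le D.κ) zero_le_one).weaken (mul_one _).le

theorem vec_non₂ (hσ : 0 ≤ σ) : VecBound σ σ (D.bd σ) D.non₂ :=
  ((D.vec_A₂ hσ).mul (norm_nonresInd_le D.κ) zero_le_one).weaken (mul_one _).le

theorem vec_low₁ (hσ : 0 ≤ σ) (M : ℝ) : VecBound (σ + 2) σ (D.bd σ) (D.low₁ M) :=
  ((D.vec_non₁ hσ).mul (norm_lowInd_le M) zero_le_one).weaken (mul_one _).le

theorem vec_high₁ (hσ : 0 ≤ σ) (M : ℝ) : VecBound (σ + 2) σ (D.bd σ) (D.high₁ M) :=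
  ((D.vec_non₁ hσ).mul (norm_highInd_le M) zero_le_one).weaken (mul_one _).le

theorem vec_high₁_tail (hσ : 0 ≤ σ) {M s₀ : ℝ} (hM : 0 < M) (hs₀ : 2 ≤ s₀) :
    VecBound (σ + s₀) σ (D.bd σ * M ^ (-(s₀ - 2))) (D.high₁ M) := by
  have hq : QuadBound 2 (D.c * 1) D.non₁ := D.quad.mul (norm_nonresInd_le D.κ)
  rw [mul_one] at hq
  refine (VecBound.of_quad (mul_nonneg D.c_nonneg (Real.rpow_nonneg hM.le _))
    (zeroMomentum_mul (zeroMomentum_mul D.real₁.zero)) (support_mul (support_mul D.real₁.support))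
    (hq.high D.c_nonneg hM hs₀)).weaken ?_
  exact mul_le_mul_of_nonneg_right (D.le_bd hσ) (Real.rpow_nonneg hM.le _)

theorem quad_sol₁ : QuadBound 2 (D.c * D.T) D.sol₁ := D.quad.mul (norm_solMul_le D.κ D.T_pos)

/-- Bound uniform in `M`, with a loss of two derivatives. It gives the sharp estimates at smooth
points, whereas `vec_gen₁_cut` makes the generator act on a single space. -/
theorem vec_gen₁ (hσ : 0 ≤ σ) (M : ℝ) : VecBound (σ + 2) σ (D.bd σ) (D.gen₁ M) :=
  (VecBound.of_quad (mul_nonneg D.c_nonneg D.T_pos.le)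
    (zeroMomentum_mul (zeroMomentum_mul D.real₁.zero)) (support_mul (support_mul D.real₁.support))
    ((mul_one (D.c * D.T)) ▸ D.quad_sol₁.mul (norm_lowInd_le M))).weaken (D.le_bd' hσ)

theorem vec_gen₁_cut (hσ : 0 ≤ σ) (M : ℝ) : VecBound σ σ (D.bd σ * M ^ 2) (D.gen₁ M) := by
  have hcT := mul_nonneg D.c_nonneg D.T_pos.le
  have := VecBound.of_quad (s := σ) (mul_nonneg hcT (sq_nonneg M))
    (zeroMomentum_mul (zeroMomentum_mul D.real₁.zero)) (support_mul (support_mul D.real₁.support))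
    (D.quad_sol₁.low (M := M) hcT)
  rw [add_zero] at this
  exact this.weaken (mul_le_mul_of_nonneg_right (D.le_bd' hσ) (sq_nonneg M))

theorem vec_gen₁_bounded (hσ : 0 ≤ σ) (h : ∀ m j, ‖D.A₁ m j‖ ≤ D.c) (M : ℝ) :
    VecBound σ σ (D.bd σ) (D.gen₁ M) := by
  have h1 : ∀ m j, ‖D.gen₁ M m j‖ ≤ D.c * D.T := fun m j => by
    unfold gen₁ sol₁
    rw [norm_mul, norm_mul]
    have h2 := mul_le_mul (h m j) (norm_solMul_le D.κ D.T_pos m j) (norm_nonneg _) D.c_nonneg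
    have h3 := mul_le_mul h2 (norm_lowInd_le (𝒩 := 𝒩) M m j) (norm_nonneg _)
      (mul_nonneg D.c_nonneg D.T_pos.le)
    rwa [mul_one] at h3
  have h2 := VecBound.of_bounded hσ (mul_nonneg D.c_nonneg D.T_pos.le)
    (zeroMomentum_mul (zeroMomentum_mul D.real₁.zero)) (support_mul (support_mul D.real₁.support))
    h1
  refine h2.weaken ?_
  simpa using D.le_bd' hσ

theorem vec_gen₂ (hσ : 0 ≤ σ) : VecBound σ σ (D.bd σ) D.gen₂ :=
  (VecBound.of_bounded hσ (mul_nonneg D.c_nonneg D.T_pos.le) (zeroMomentum_mul D.real₂.zero)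
    (support_mul D.real₂.support) (fun m j => by
      rw [norm_mul]
      exact mul_le_mul (D.bounded m j) (norm_solMul_le D.κ D.T_pos m j) (norm_nonneg _)
        D.c_nonneg)).weaken (by
    have h1 := D.one_le_pow hσ
    have h2 := D.c_nonneg
    have h3 := D.T_pos
    unfold bd
    exact mul_le_mul_of_nonneg_right (mul_le_mul_of_nonneg_left (by linarith) h2) (by linarith))

theorem fun_A₁ (hσ : 1 ≤ σ) : FunBound σ D.c D.A₁ :=
  (FunBound.of_quad D.c_nonneg D.real₁.zero D.real₁.support D.quad).mono hσ D.c_nonneg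

theorem fun_A₂ (hσ : 1 ≤ σ) : FunBound σ D.c D.A₂ :=
  FunBound.of_bounded (by linarith) D.c_nonneg D.bounded

theorem fun_res₁ (hσ : 1 ≤ σ) : FunBound σ (D.c * 1) D.res₁ :=
  (D.fun_A₁ hσ).mul (norm_resInd_le D.κ)

theorem fun_res₂ (hσ : 1 ≤ σ) : FunBound σ (D.c * 1) D.res₂ :=
  (D.fun_A₂ hσ).mul (norm_resInd_le D.κ)

theorem fun_low₁ (hσ : 1 ≤ σ) (M : ℝ) : FunBound σ (D.c * 1 * 1) (D.low₁ M) :=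
  ((D.fun_A₁ hσ).mul (norm_nonresInd_le D.κ)).mul (norm_lowInd_le M)

theorem fun_non₂ (hσ : 1 ≤ σ) : FunBound σ (D.c * 1) D.non₂ :=
  (D.fun_A₂ hσ).mul (norm_nonresInd_le D.κ)

theorem fun_gen₁ (hσ : 1 ≤ σ) (M : ℝ) : FunBound σ (D.c * D.T * 1) (D.gen₁ M) :=
  ((D.fun_A₁ hσ).mul (norm_solMul_le D.κ D.T_pos)).mul (norm_lowInd_le M)

theorem fun_gen₂ (hσ : 1 ≤ σ) : FunBound σ (D.c * D.T) D.gen₂ :=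
  (D.fun_A₂ hσ).mul (norm_solMul_le D.κ D.T_pos)

/-- Half the Hamiltonian vector field of the generating function. -/
def step (hσ : 0 ≤ σ) (δ ε M : ℝ) (x : W 𝒩 σ) : W 𝒩 σ :=
  (1 / 2 : ℂ) • ((δ : ℂ) • (D.vec_gen₁_cut hσ M).field 1 x
    + (ε : ℂ) • (D.vec_gen₂ hσ).field D.K x)

theorem contDiff_step (hσ : 0 ≤ σ) (δ ε M : ℝ) : ContDiff ℂ ω (D.step hσ δ ε M) :=
  ((((D.vec_gen₁_cut hσ M).contDiff_field 1).const_smul (δ : ℂ)).add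
    (((D.vec_gen₂ hσ).contDiff_field D.K).const_smul (ε : ℂ))).const_smul (1 / 2 : ℂ)

theorem hasFDerivAt_step (hσ : 0 ≤ σ) (δ ε M : ℝ) (x : W 𝒩 σ) :
    HasFDerivAt (D.step hσ δ ε M) ((1 / 2 : ℂ) • ((δ : ℂ) •
      fderiv ℂ ((D.vec_gen₁_cut hσ M).field 1) x
      + (ε : ℂ) • fderiv ℂ ((D.vec_gen₂ hσ).field D.K) x)) x :=
  (((((D.vec_gen₁_cut hσ M).contDiff_field 1).differentiable (by simp)) x).hasFDerivAt.const_smul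
    (δ : ℂ) |>.add (((((D.vec_gen₂ hσ).contDiff_field D.K).differentiable
      (by simp)) x).hasFDerivAt.const_smul (ε : ℂ))).const_smul (1 / 2 : ℂ)

theorem fderiv_step_apply (hσ : 0 ≤ σ) (δ ε M : ℝ) (x v : W 𝒩 σ) :
    fderiv ℂ (D.step hσ δ ε M) x v = (1 / 2 : ℂ) • ((δ : ℂ) • (D.vec_gen₁_cut hσ M).field 1 v
      + (ε : ℂ) • fderiv ℂ ((D.vec_gen₂ hσ).field D.K) x v) := by
  rw [(D.hasFDerivAt_step hσ δ ε M x).fderiv]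
  simp only [smul_apply, add_apply, VecBound.fderiv_field_one]

theorem norm_half_le {E : Type*} [NormedAddCommGroup E] [NormedSpace ℂ E] {δ ε a b : ℝ}
    (hδ : 0 ≤ δ) (hε : 0 ≤ ε) {u v : E} (hu : ‖u‖ ≤ a) (hv : ‖v‖ ≤ b) :
    ‖(1 / 2 : ℂ) • ((δ : ℂ) • u + (ε : ℂ) • v)‖ ≤ (δ * a + ε * b) / 2 := by
  rw [norm_smul]
  have h1 := norm_add_le ((δ : ℂ) • u) ((ε : ℂ) • v)
  rw [norm_smul, norm_smul, Complex.norm_of_nonneg hδ, Complex.norm_of_nonneg hε] at h1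
  have h2 := mul_le_mul_of_nonneg_left hu hδ
  have h3 := mul_le_mul_of_nonneg_left hv hε
  have h4 : ‖(1 / 2 : ℂ)‖ = 1 / 2 := by norm_num
  rw [h4]
  linarith

theorem half_le {b g₁ g₂ δ ε M : ℝ} (hb : 0 ≤ b) (h₁ : 0 ≤ g₁) (h₂ : 0 ≤ g₂) (hδ : 0 ≤ δ)
    (hε : 0 ≤ ε) :
    (δ * (b * M ^ 2 * g₁) + ε * (b * g₂)) / 2 ≤ b * (g₁ + g₂) * (δ * M ^ 2 + ε) := by
  have hM := sq_nonneg M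
  have e1 : 0 ≤ δ * (b * M ^ 2 * g₁) := by positivity
  have e2 : 0 ≤ ε * (b * g₂) := by positivity
  have e3 : 0 ≤ δ * M ^ 2 * b * g₂ := by positivity
  have e4 : 0 ≤ ε * b * g₁ := by positivity
  nlinarith

/-- The constant in the bound of `step` on `‖x‖ ≤ 2 * r`. -/
def stepConst (σ r : ℝ) : ℝ := D.bd σ * (growth 1 (2 * r) + growth D.K (2 * r))

theorem stepConst_nonneg {r : ℝ} (hr : 0 ≤ r) : 0 ≤ D.stepConst σ r :=
  mul_nonneg (D.bd_nonneg σ) (add_nonneg (growth_nonneg 1 (by linarith))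
    (growth_nonneg D.K (by linarith)))

theorem norm_step_le (hσ : 0 ≤ σ) {r δ ε M : ℝ} (hr : 0 ≤ r) (hδ : 0 ≤ δ) (hε : 0 ≤ ε)
    {x : W 𝒩 σ} (hx : ‖x‖ ≤ 2 * r) :
    ‖D.step hσ δ ε M x‖ ≤ D.stepConst σ r * (δ * M ^ 2 + ε) :=
  (norm_half_le hδ hε ((D.vec_gen₁_cut hσ M).norm_field_le 1 hx)
    ((D.vec_gen₂ hσ).norm_field_le D.K hx)).trans
    (half_le (D.bd_nonneg σ) (growth_nonneg 1 (by linarith)) (growth_nonneg D.K (by linarith))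
      hδ hε)

theorem norm_step_le_of_bounded (hσ : 0 ≤ σ) (h : ∀ m j, ‖D.A₁ m j‖ ≤ D.c) {r δ ε M : ℝ}
    (hr : 0 ≤ r) (hδ : 0 ≤ δ) (hδε : δ ≤ ε) {x : W 𝒩 σ} (hx : ‖x‖ ≤ 2 * r) :
    ‖D.step hσ δ ε M x‖ ≤ D.stepConst σ r * ε := by
  have e : (D.vec_gen₁_cut hσ M).field 1 x = (D.vec_gen₁_bounded hσ h M).field 1 x :=
    W.ext_seq (VecBound.field_seq_congr _ _ _ rfl)
  rw [step, e]
  refine (norm_half_le hδ (hδ.trans hδε) ((D.vec_gen₁_bounded hσ h M).norm_field_le 1 hx)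
    ((D.vec_gen₂ hσ).norm_field_le D.K hx)).trans ?_
  have hb := D.bd_nonneg σ
  have g1 := mul_nonneg hb (growth_nonneg 1 (r := 2 * r) (by linarith))
  have g2 := mul_nonneg hb (growth_nonneg D.K (r := 2 * r) (by linarith))
  have g3 := mul_le_mul_of_nonneg_right hδε g1
  have g4 := mul_nonneg (hδ.trans hδε) g1
  have g5 := mul_nonneg (hδ.trans hδε) g2
  calc _ ≤ ε * (D.bd σ * growth 1 (2 * r)) + ε * (D.bd σ * growth D.K (2 * r)) := by linarith
    _ = _ := by rw [stepConst]; ring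

theorem smallField_step (hσ : 0 ≤ σ) {r δ ε M : ℝ} (hr : 0 ≤ r) (hδ : 0 ≤ δ) (hε : 0 ≤ ε)
    (h : D.stepConst σ r * (δ * M ^ 2 + ε) ≤ 1 / 4)
    (h' : D.stepConst σ r * (δ * M ^ 2 + ε) ≤ r / 4) :
    SmallField (D.step hσ δ ε M) r := by
  refine ⟨D.contDiff_step hσ δ ε M, fun x hx => (D.norm_step_le hσ hr hδ hε hx.le).trans h',
    fun x hx => ?_⟩
  rw [(D.hasFDerivAt_step hσ δ ε M x).fderiv]
  exact (norm_half_le hδ hε ((D.vec_gen₁_cut hσ M).norm_fderiv_field_le 1 hx.le)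
    ((D.vec_gen₂ hσ).norm_fderiv_field_le D.K hx.le)).trans
    ((half_le (D.bd_nonneg σ) (growth_nonneg 1 (by linarith)) (growth_nonneg D.K (by linarith))
      hδ hε).trans h)

theorem sympForm_fderiv_step (hσ : 1 ≤ σ) (hσ0 : 0 ≤ σ) (δ ε M : ℝ) (x u v : W 𝒩 σ) :
    sympForm hσ0 (fderiv ℂ (D.step hσ0 δ ε M) x u) v
      = -sympForm hσ0 u (fderiv ℂ (D.step hσ0 δ ε M) x v) := by
  refine sympForm_fderiv hσ0 (f := fun y => (1 / 2 : ℂ) * ((δ : ℂ) * polyFun 1 (D.gen₁ M) y.seq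
    + (ε : ℂ) * polyFun D.K D.gen₂ y.seq)) (fun y => ?_) (D.contDiff_step hσ0 δ ε M) x u v
  have hy : incl (le_refl σ) y = y := W.ext_seq (by rw [incl_seq])
  have h1 := hasFDerivAt_polyFun hσ0 le_rfl (D.fun_gen₁ hσ M) (D.vec_gen₁_cut hσ0 M) 1 y
  have h2 := hasFDerivAt_polyFun hσ0 le_rfl (D.fun_gen₂ hσ) (D.vec_gen₂ hσ0) D.K y
  rw [hy] at h1 h2
  refine (((h1.const_mul (δ : ℂ)).add (h2.const_mul (ε : ℂ))).const_mul (1 / 2 : ℂ)).congr_fderiv ?_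
  simp only [step, map_smul, map_add]

/-- The exact central difference of `h₀` turns the homological equation into an identity: the low
nonresonant terms appear at the midpoint `inv z` with no further error. -/
theorem unperturbed_midpoint {s₁ : ℝ} {h₀ : Ham 𝒩} {Φ : ℝ → SeqSp 𝒩 → SeqSp 𝒩}
    (h : PeriodicFlow s₁ h₀ Φ D.T) (hD : Diagonal s₁ D.T h₀ Φ D.κ) (hs : s₁ ≤ σ) (hs₁ : 1 ≤ s₁)
    (hσ0 : 0 ≤ σ) {δ ε M r : ℝ} (hY : SmallField (D.step hσ0 δ ε M) r) {z : W 𝒩 σ}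
    (hz : ‖z‖ < r) :
    h₀ (hY.midpoint z).seq = h₀ z.seq - (δ * polyFun 1 (D.low₁ M) (hY.inv z).seq
      + ε * polyFun D.K D.non₂ (hY.inv z).seq) := by
  have hσ : 1 ≤ σ := hs₁.trans hs
  have h1 := unperturbed_sub h hD hs (hY.inv z) (D.step hσ0 δ ε M (hY.inv z))
  rw [hY.inv_sub hz] at h1
  have h2 := fderiv_unperturbed_field h hD hs hσ0 (by linarith) (D.fun_gen₁ hσ M)
    (D.vec_gen₁_cut hσ0 M) (D.fun_low₁ hσ M) 1 (fun m j => by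
      rw [low₁, non₁, gen₁, sol₁, ← solMul_mul D.κ D.T_pos]; ring) (hY.inv z)
  have h3 := fderiv_unperturbed_field h hD hs hσ0 (by linarith) (D.fun_gen₂ hσ)
    (D.vec_gen₂ hσ0) (D.fun_non₂ hσ) D.K (fun m j => by
      rw [non₂, gen₂, ← solMul_mul D.κ D.T_pos]; ring) (hY.inv z)
  have h4 : fderiv ℂ (fun y : W 𝒩 σ => h₀ y.seq) (hY.inv z) (D.step hσ0 δ ε M (hY.inv z))
      = (1 / 2 : ℂ) • ((δ : ℂ) • -polyFun 1 (D.low₁ M) (hY.inv z).seq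
        + (ε : ℂ) • -polyFun D.K D.non₂ (hY.inv z).seq) := by
    rw [step, map_smul, map_add, map_smul, map_smul, h2, h3]
  rw [h4] at h1
  rw [SmallField.midpoint, sub_eq_iff_eq_add.1 h1]
  simp only [smul_eq_mul]
  ring

end NormalFormData

end

/-! ### Estimates of the averaging step. -/

section

variable {d : ℕ} {𝒩 : Set (Fin d → ℤ)}

namespace NormalFormData

variable (D : NormalFormData 𝒩) {σ s₀ r δ ε n M : ℝ}

theorem incl_step {σ' : ℝ} (h : σ ≤ σ') (hσ : 0 ≤ σ) (hσ' : 0 ≤ σ') (δ ε M : ℝ) (x : W 𝒩 σ') :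
    incl h (D.step hσ' δ ε M x) = D.step hσ δ ε M (incl h x) := by
  refine W.ext_seq ?_
  rw [incl_seq]
  simp only [step, seq_smul, seq_add, VecBound.field_seq, incl_seq]

/-- The step is given by the same formula on every space of the scale, so uniqueness of preimages
identifies the two inverses. Smooth points therefore have smooth midpoints and images. -/
theorem incl_inv {σ' : ℝ} (h : σ ≤ σ') {hσ : 0 ≤ σ} {hσ' : 0 ≤ σ'}
    (hY : SmallField (D.step hσ δ ε M) r) (hY' : SmallField (D.step hσ' δ ε M) r) {x : W 𝒩 σ'}
    (hx : ‖x‖ < r) : incl h (hY'.inv x) = hY.inv (incl h x) := by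
  have e : incl h (hY'.inv x) - D.step hσ δ ε M (incl h (hY'.inv x)) = incl h x := by
    rw [← D.incl_step h hσ hσ', ← map_sub, hY'.inv_sub hx]
  have := hY.inv_eq ((norm_incl_le h _).trans_lt (hY'.norm_inv_lt hx))
    (by rw [e]; exact (norm_incl_le h x).trans_lt hx)
  rw [← this, e]

theorem incl_midpoint {σ' : ℝ} (h : σ ≤ σ') {hσ : 0 ≤ σ} {hσ' : 0 ≤ σ'}
    (hY : SmallField (D.step hσ δ ε M) r) (hY' : SmallField (D.step hσ' δ ε M) r) {x : W 𝒩 σ'}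
    (hx : ‖x‖ < r) : incl h (hY'.midpoint x) = hY.midpoint (incl h x) := by
  rw [SmallField.midpoint, SmallField.midpoint, map_add, D.incl_step h hσ hσ',
    D.incl_inv h hY hY' hx]

/-- The constant in the estimates of the averaging step. -/
def est (σ r : ℝ) : ℝ := D.bd (σ + 2) * (growth 1 (3 * r) + growth D.K (3 * r) + 4)

theorem bd_mul_growth_le (hr : 0 ≤ r) {τ : ℝ} (hτ : τ ≤ σ + 2) :
    D.bd τ * growth 1 (3 * r) ≤ D.est σ r ∧ D.bd τ * growth D.K (3 * r) ≤ D.est σ r ∧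
      D.bd τ * 4 ≤ D.est σ r := by
  have h1 := growth_nonneg 1 (r := 3 * r) (by linarith)
  have h2 := growth_nonneg D.K (r := 3 * r) (by linarith)
  have h3 := D.bd_mono hτ
  have h4 := D.bd_nonneg τ
  unfold est
  -- The spare term `4` in `est` covers the linear field; `bd` is taken at the largest regularity `σ
  -- + 2`.
  refine ⟨?_, ?_, ?_⟩ <;> refine mul_le_mul h3 (by linarith) (by linarith) (by linarith)

theorem est_nonneg (hr : 0 ≤ r) : 0 ≤ D.est σ r :=
  (mul_nonneg (D.bd_nonneg σ) (by norm_num)).trans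
    (D.bd_mul_growth_le (σ := σ) hr (τ := σ) (by linarith)).2.2

/-- At smooth points the step has size `ε` in `𝒲^{σ+2}` with no factor `M²`. The target regularity
and the loss in `vec_gen₁` together require `s₀ ≥ 4`. -/
theorem exists_loss_step (hσ : 0 ≤ σ) (hs₀ : 4 ≤ s₀) (hr : 0 ≤ r) (hδ : 0 ≤ δ) (hδε : δ ≤ ε)
    (M : ℝ) (hσ' : 0 ≤ σ + s₀) {x : W 𝒩 (σ + s₀)} (hx : ‖x‖ ≤ 3 * r) :
    ∃ y : W 𝒩 (σ + 2), y.seq = (D.step hσ' δ ε M x).seq ∧ ‖y‖ ≤ ε * D.est σ r := by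
  have hσ2 : 0 ≤ σ + 2 := by linarith
  have i2 : σ + 2 ≤ σ + s₀ := by linarith
  have i4 : σ + 2 + 2 ≤ σ + s₀ := by linarith
  refine ⟨(1 / 2 : ℂ) • ((δ : ℂ) • (D.vec_gen₁ hσ2 M).field 1 (incl i4 x)
    + (ε : ℂ) • (D.vec_gen₂ hσ2).field D.K (incl i2 x)), ?_, ?_⟩
  · simp only [step, seq_smul, seq_add, VecBound.field_seq, incl_seq]
  · obtain ⟨b1, b2, -⟩ := D.bd_mul_growth_le (σ := σ) hr (le_refl (σ + 2))
    have h1 := ((D.vec_gen₁ hσ2 M).norm_field_le 1 ((norm_incl_le i4 x).trans hx)).trans b1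
    have h2 := ((D.vec_gen₂ hσ2).norm_field_le D.K ((norm_incl_le i2 x).trans hx)).trans b2
    refine (norm_half_le hδ (hδ.trans hδε) h1 h2).trans ?_
    have := mul_le_mul_of_nonneg_right hδε (D.est_nonneg (σ := σ) hr)
    linarith

theorem norm_fderiv_step_loss_le (hσ : 0 ≤ σ) (hr : 0 ≤ r) (hδ : 0 ≤ δ) (hδε : δ ≤ ε) (M : ℝ)
    {x : W 𝒩 σ} (hx : ‖x‖ ≤ 3 * r) (j : σ ≤ σ + 2) (u : W 𝒩 (σ + 2)) :
    ‖fderiv ℂ (D.step hσ δ ε M) x (incl j u)‖ ≤ ε * D.est σ r * ‖u‖ := by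
  obtain ⟨-, b2, b3⟩ := D.bd_mul_growth_le (σ := σ) (τ := σ) hr j
  rw [fderiv_step_apply]
  have e : (D.vec_gen₁_cut hσ M).field 1 (incl j u) = (D.vec_gen₁ hσ M).field 1 u :=
    W.ext_seq (VecBound.field_seq_congr _ _ _ (incl_seq j u))
  rw [e]
  have h1 := (D.vec_gen₁ hσ M).norm_field_one_le u
  have h2 : ‖fderiv ℂ ((D.vec_gen₂ hσ).field D.K) x (incl j u)‖ ≤ D.est σ r * ‖u‖ :=
    (ContinuousLinearMap.le_of_opNorm_le _ (((D.vec_gen₂ hσ).norm_fderiv_field_le D.K hx).trans b2)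
      _).trans (mul_le_mul_of_nonneg_left (norm_incl_le j u) (D.est_nonneg hr))
  have h3 := h1.trans (mul_le_mul_of_nonneg_right b3 (norm_nonneg u))
  refine (norm_half_le hδ (hδ.trans hδε) h3 h2).trans ?_
  have := mul_le_mul_of_nonneg_right hδε
    (mul_nonneg (D.est_nonneg (σ := σ) hr) (norm_nonneg u))
  linarith

/-- The size of the error field, assembled from the bounds of its parts. -/
theorem norm_error_le {E : Type*} [NormedAddCommGroup E] [NormedSpace ℂ E] (A : E →L[ℂ] E)
    {U V L X a₁ a₂ a₃ a₄ a₅ : E} {G : ℝ} (hδ : 0 < δ) (hn : 1 ≤ n) (hε : ε = δ * n) (hG : 0 ≤ G)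
    (hU : ‖A U‖ ≤ 2 * (n * ε * G ^ 2)) (hV : ‖A V‖ ≤ 2 * (n * ε * G ^ 2))
    (hX : ‖A X‖ ≤ 1 / 4 * ‖X‖) (hd : U - V - L = a₁ + a₂ + a₃ + (n : ℂ) • (a₄ + a₅))
    (h₁ : ‖a₁‖ ≤ 2 * (ε * G ^ 2)) (h₂ : ‖a₂‖ ≤ ε * G ^ 2) (h₃ : ‖a₃‖ ≤ G * δ)
    (h₄ : ‖a₄‖ ≤ 2 * (ε * G ^ 2)) (h₅ : ‖a₅‖ ≤ ε * G ^ 2) :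
    ‖(δ : ℂ) • ((U - V - L) - A U - A V + X - A X)‖
      ≤ (10 * G ^ 2 + G) * ε ^ 2 + 2 * δ * ‖X‖ := by
  have hn0 : 0 ≤ n := by linarith
  have hδε : δ ≤ ε := by rw [hε]; exact le_mul_of_one_le_right hδ.le hn
  have hε0 : 0 ≤ ε := hδ.le.trans hδε
  have k1 : ‖(n : ℂ) • (a₄ + a₅)‖ ≤ n * (3 * (ε * G ^ 2)) := by
    rw [norm_smul, Complex.norm_of_nonneg hn0]
    refine mul_le_mul_of_nonneg_left ?_ hn0
    have := norm_add_le a₄ a₅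
    linarith
  have k2 : ‖U - V - L‖ ≤ 6 * (n * ε * G ^ 2) + G * δ := by
    rw [hd]
    have e1 := norm_add_le (a₁ + a₂ + a₃) ((n : ℂ) • (a₄ + a₅))
    have e2 := norm_add₃_le (a := a₁) (b := a₂) (c := a₃)
    have e3 : ε * G ^ 2 ≤ n * (ε * G ^ 2) := le_mul_of_one_le_left (by positivity) hn
    have e4 : n * (ε * G ^ 2) = n * ε * G ^ 2 := by ring
    have e5 : n * (3 * (ε * G ^ 2)) = 3 * (n * ε * G ^ 2) := by ring
    linarith
  have k3 : ‖(U - V - L) - A U - A V + X - A X‖ ≤ 10 * (n * ε * G ^ 2) + G * δ + 2 * ‖X‖ := by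
    have e1 := norm_sub_le ((U - V - L) - A U - A V + X) (A X)
    have e2 := norm_add_le ((U - V - L) - A U - A V) X
    have e3 := norm_sub_le ((U - V - L) - A U) (A V)
    have e4 := norm_sub_le (U - V - L) (A U)
    have e5 := norm_nonneg X
    linarith
  rw [norm_smul, Complex.norm_of_nonneg hδ.le]
  refine (mul_le_mul_of_nonneg_left k3 hδ.le).trans ?_
  have k4 : G * (δ * δ) ≤ G * (ε * ε) :=
    mul_le_mul_of_nonneg_left (mul_le_mul hδε hδε hδ.le hε0) hG
  have k5 : δ * (n * ε * G ^ 2) = G ^ 2 * ε ^ 2 := by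
    rw [hε]
    ring
  calc δ * (10 * (n * ε * G ^ 2) + G * δ + 2 * ‖X‖)
      = 10 * (δ * (n * ε * G ^ 2)) + G * (δ * δ) + 2 * δ * ‖X‖ := by ring
    _ ≤ 10 * (δ * (n * ε * G ^ 2)) + G * (ε * ε) + 2 * δ * ‖X‖ := by linarith
    _ = _ := by rw [k5]; ring

/-- The field of the quadratic term lies in `𝒲^{σ+2}` at points of `𝒲^{σ+4}`; the remaining two
derivatives pay for the differential of the step uniformly in `M`. -/
theorem norm_fderiv_step_field_le (hσ : 0 ≤ σ) (hs₀ : 4 ≤ s₀) (hr : 0 ≤ r) (hδ : 0 ≤ δ)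
    (hδε : δ ≤ ε) (hn : 1 ≤ n) (M : ℝ) {m : W 𝒩 σ} (hm : ‖m‖ ≤ 3 * r) {B₁ B₂ : Coef 𝒩}
    (v₁ : VecBound (σ + 2) σ (D.bd σ) B₁) (v₂ : VecBound σ σ (D.bd σ) B₂)
    (w₁ : VecBound (σ + 2 + 2) (σ + 2) (D.bd (σ + 2)) B₁)
    (w₂ : VecBound (σ + 2) (σ + 2) (D.bd (σ + 2)) B₂) (i0 : σ ≤ σ + s₀) (i2 : σ + 2 ≤ σ + s₀)
    {w : W 𝒩 (σ + s₀)} (hw : ‖w‖ ≤ 3 * r) :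
    ‖fderiv ℂ (D.step hσ δ ε M) m (v₁.field 1 (incl i2 w) + (n : ℂ) • v₂.field D.K (incl i0 w))‖
      ≤ 2 * (n * ε * D.est σ r ^ 2) := by
  have j : σ ≤ σ + 2 := by linarith
  have i4 : σ + 2 + 2 ≤ σ + s₀ := by linarith
  have hn0 : 0 ≤ n := by linarith
  have hG : 0 ≤ D.est σ r := D.est_nonneg hr
  obtain ⟨c1, c2, -⟩ := D.bd_mul_growth_le (σ := σ) hr (le_refl (σ + 2))
  have e : v₁.field 1 (incl i2 w) + (n : ℂ) • v₂.field D.K (incl i0 w)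
      = incl j (w₁.field 1 (incl i4 w) + (n : ℂ) • w₂.field D.K (incl i2 w)) := by
    refine W.ext_seq ?_
    rw [incl_seq]
    simp only [seq_add, seq_smul, VecBound.field_seq, incl_seq]
  rw [e]
  refine (D.norm_fderiv_step_loss_le hσ hr hδ hδε M hm j _).trans ?_
  have h1 := (w₁.norm_field_le 1 ((norm_incl_le i4 w).trans hw)).trans c1
  have h2 := (w₂.norm_field_le D.K ((norm_incl_le i2 w).trans hw)).trans c2
  have h3 : ‖w₁.field 1 (incl i4 w) + (n : ℂ) • w₂.field D.K (incl i2 w)‖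
      ≤ 2 * (n * D.est σ r) := by
    refine (norm_add_le _ _).trans ?_
    rw [norm_smul, Complex.norm_of_nonneg hn0]
    have h4 := mul_le_mul_of_nonneg_left h2 hn0
    have h5 := le_mul_of_one_le_left hG hn
    linarith
  refine (mul_le_mul_of_nonneg_left h3 (mul_nonneg (hδ.trans hδε) hG)).trans (le_of_eq ?_)
  ring

/-- Split `A₁` into resonant, low and high parts and `A₂` into resonant and nonresonant parts.
Resonant parts are compared between image and initial point, nonresonant ones between image and
midpoint, all `O(ε)` apart in `𝒲^{σ+2}`; the high part is `O(δ)` by the cutoff. The products with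
the differential of the step are of the same order. -/
theorem norm_pullback_le (hσ : 0 ≤ σ) (hσ' : 0 ≤ σ + s₀) (hs₀ : 4 ≤ s₀) (hr : 0 ≤ r) (hδ : 0 < δ)
    (hn : 1 ≤ n) (hε : ε = δ * n) (hM : 0 < M) (hMδ : M ^ (-(s₀ - 2)) ≤ δ)
    (hY : SmallField (D.step hσ δ ε M) r) (hY' : SmallField (D.step hσ' δ ε M) r)
    (i0 : σ ≤ σ + s₀) (i2 : σ + 2 ≤ σ + s₀)
    {x : W 𝒩 (σ + s₀)} (hx : ‖x‖ < r) (XP Xa Xb Xc : W 𝒩 σ)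
    (hXa : Xa = (δ : ℂ) • ((D.vec_A₁ hσ).field 1 (incl i2 (hY'.midpoint x))
      + (n : ℂ) • (D.vec_A₂ hσ).field D.K (hY.midpoint (incl i0 x)) + XP))
    (hXb : Xb = (δ : ℂ) • ((D.vec_res₁ hσ).field 1 (incl i2 x)
      + (n : ℂ) • (D.vec_res₂ hσ).field D.K (incl i0 x)))
    (hXc : Xc = (δ : ℂ) • ((D.vec_low₁ hσ M).field 1 (incl i2 (hY'.inv x))
      + (n : ℂ) • (D.vec_non₂ hσ).field D.K (hY.inv (incl i0 x)))) :
    ‖Xa - fderiv ℂ (D.step hσ δ ε M) (hY.inv (incl i0 x)) Xa - Xb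
      - fderiv ℂ (D.step hσ δ ε M) (hY.inv (incl i0 x)) Xb - Xc‖
      ≤ (10 * D.est σ r ^ 2 + D.est σ r) * ε ^ 2 + 2 * δ * ‖XP‖ := by
  set G := D.est σ r with hG
  have hG0 : 0 ≤ G := D.est_nonneg hr
  have hδε : δ ≤ ε := by rw [hε]; exact le_mul_of_one_le_right hδ.le hn
  have hε0 : 0 ≤ ε := hδ.le.trans hδε
  have j : σ ≤ σ + 2 := by linarith
  have i4 : σ + 2 + 2 ≤ σ + s₀ := by linarith
  have hσ2 : 0 ≤ σ + 2 := by linarith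
  set z := incl i0 x with hz
  have hzr : ‖z‖ < r := (norm_incl_le i0 x).trans_lt hx
  set q := hY'.inv x with hq
  set p := hY'.midpoint x with hp
  set m := hY.inv z with hm
  set A := fderiv ℂ (D.step hσ δ ε M) m with hA
  have hq2 : ‖q‖ < 2 * r := hY'.norm_inv_lt hx
  have hq3 : ‖q‖ ≤ 3 * r := by linarith
  have hx3 : ‖x‖ ≤ 3 * r := by linarith
  -- `2r + r/4 ≤ 3r`, the radius built into `est`.
  have hp3 : ‖p‖ ≤ 3 * r := by
    have h1 := norm_add_le q (D.step hσ' δ ε M q)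
    have h2 := hY'.norm_le q hq2
    have h3 : p = q + D.step hσ' δ ε M q := rfl
    rw [h3]
    linarith
  have hmq : incl i0 q = m := D.incl_inv i0 hY hY' hx
  have hpz : incl i0 p = hY.midpoint z := D.incl_midpoint i0 hY hY' hx
  have hm3 : ‖m‖ ≤ 3 * r := by rw [← hmq]; exact (norm_incl_le i0 q).trans hq3
  obtain ⟨y, hys, hyn⟩ := D.exists_loss_step hσ hs₀ hr hδ.le hδε M hσ' hq3
  have hpq : p - q = D.step hσ' δ ε M q := by
    rw [hp, SmallField.midpoint]; abel
  have hpx : p - x = (2 : ℂ) • D.step hσ' δ ε M q := hY'.midpoint_sub hx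
  have e1 : incl i2 p - incl i2 q = y := by
    rw [← map_sub, hpq]
    exact W.ext_seq (by rw [incl_seq, hys])
  have e2 : incl i2 p - incl i2 x = (2 : ℂ) • y := by
    rw [← map_sub, hpx]
    exact W.ext_seq (by rw [incl_seq, seq_smul, seq_smul, hys])
  have e3 : incl i0 p - incl i0 q = incl j y := by
    rw [← map_sub, hpq]
    exact W.ext_seq (by rw [incl_seq, incl_seq, hys])
  have e4 : incl i0 p - z = (2 : ℂ) • incl j y := by
    rw [hz, ← map_sub, hpx]
    exact W.ext_seq (by rw [incl_seq, seq_smul, seq_smul, incl_seq, hys])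
  have n2 : ‖(2 : ℂ) • y‖ ≤ 2 * (ε * G) := by
    rw [norm_smul, Complex.norm_two]; linarith
  have n3 : ‖incl j y‖ ≤ ε * G := (norm_incl_le j y).trans hyn
  have n4 : ‖(2 : ℂ) • incl j y‖ ≤ 2 * (ε * G) := by
    rw [norm_smul, Complex.norm_two]; linarith
  obtain ⟨b1, b2, -⟩ := D.bd_mul_growth_le (σ := σ) (τ := σ) hr j
  have le2 : ∀ {w : W 𝒩 (σ + s₀)}, ‖w‖ ≤ 3 * r → ‖incl i2 w‖ ≤ 3 * r :=
    fun h => (norm_incl_le i2 _).trans h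
  have le0 : ∀ {w : W 𝒩 (σ + s₀)}, ‖w‖ ≤ 3 * r → ‖incl i0 w‖ ≤ 3 * r :=
    fun h => (norm_incl_le i0 _).trans h
  -- the differences of the fields
  have t1 : ‖(D.vec_res₁ hσ).field 1 (incl i2 p) - (D.vec_res₁ hσ).field 1 (incl i2 x)‖
      ≤ G * (2 * (ε * G)) := by
    have := (D.vec_res₁ hσ).norm_field_sub_le 1 (le2 hp3) (le2 hx3)
    rw [e2] at this
    exact this.trans (mul_le_mul b1 n2 (norm_nonneg _) hG0)
  have t2 : ‖(D.vec_low₁ hσ M).field 1 (incl i2 p) - (D.vec_low₁ hσ M).field 1 (incl i2 q)‖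
      ≤ G * (ε * G) := by
    have := (D.vec_low₁ hσ M).norm_field_sub_le 1 (le2 hp3) (le2 hq3)
    rw [e1] at this
    exact this.trans (mul_le_mul b1 hyn (norm_nonneg _) hG0)
  have t3 : ‖(D.vec_high₁ hσ M).field 1 (incl i2 p)‖ ≤ G * δ := by
    have hs₀' : 2 ≤ s₀ := by linarith
    have e : (D.vec_high₁ hσ M).field 1 (incl i2 p) = (D.vec_high₁_tail hσ hM hs₀').field 1 p :=
      W.ext_seq (VecBound.field_seq_congr _ _ _ (incl_seq i2 p))
    rw [e]
    refine ((D.vec_high₁_tail hσ hM hs₀').norm_field_le 1 hp3).trans ?_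
    rw [mul_right_comm]
    exact mul_le_mul b1 hMδ (Real.rpow_nonneg hM.le _) hG0
  have t4 : ‖(D.vec_res₂ hσ).field D.K (incl i0 p) - (D.vec_res₂ hσ).field D.K z‖
      ≤ G * (2 * (ε * G)) := by
    have := (D.vec_res₂ hσ).norm_field_sub_le D.K (le0 hp3) (le0 hx3)
    rw [← hz, e4] at this
    exact this.trans (mul_le_mul b2 n4 (norm_nonneg _) hG0)
  have t5 : ‖(D.vec_non₂ hσ).field D.K (incl i0 p) - (D.vec_non₂ hσ).field D.K m‖
      ≤ G * (ε * G) := by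
    have := (D.vec_non₂ hσ).norm_field_sub_le D.K (le0 hp3) (le0 hq3)
    rw [e3, hmq] at this
    exact this.trans (mul_le_mul b2 n3 (norm_nonneg _) hG0)
  have t6 := D.norm_fderiv_step_field_le hσ hs₀ hr hδ.le hδε hn M hm3 (D.vec_A₁ hσ) (D.vec_A₂ hσ)
    (D.vec_A₁ hσ2) (D.vec_A₂ hσ2) i0 i2 hp3
  have t7 := D.norm_fderiv_step_field_le hσ hs₀ hr hδ.le hδε hn M hm3 (D.vec_res₁ hσ)
    (D.vec_res₂ hσ) (D.vec_res₁ hσ2) (D.vec_res₂ hσ2) i0 i2 hx3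
  have t8 : ‖A XP‖ ≤ 1 / 4 * ‖XP‖ :=
    A.le_of_opNorm_le (hY.norm_fderiv_le m (hY.norm_inv_lt hzr)) XP
  -- decomposition of the field
  have d1 : (D.vec_A₁ hσ).field 1 (incl i2 p) = (D.vec_res₁ hσ).field 1 (incl i2 p)
      + ((D.vec_low₁ hσ M).field 1 (incl i2 p) + (D.vec_high₁ hσ M).field 1 (incl i2 p)) := by
    rw [← VecBound.field_add (D.vec_low₁ hσ M) (D.vec_high₁ hσ M) (D.vec_non₁ hσ)
      (fun m j => by rw [low₁, high₁, ← mul_add, lowInd_add_highInd, mul_one]),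
      ← VecBound.field_add (D.vec_res₁ hσ) (D.vec_non₁ hσ) (D.vec_A₁ hσ)
      (fun m j => by rw [res₁, non₁, ← mul_add, resInd_add_nonresInd, mul_one])]
  have d2 : (D.vec_A₂ hσ).field D.K (incl i0 p) = (D.vec_res₂ hσ).field D.K (incl i0 p)
      + (D.vec_non₂ hσ).field D.K (incl i0 p) :=
    VecBound.field_add (D.vec_res₂ hσ) (D.vec_non₂ hσ) (D.vec_A₂ hσ)
      (fun m j => by rw [res₂, non₂, ← mul_add, resInd_add_nonresInd, mul_one]) _ _
  set U := (D.vec_A₁ hσ).field 1 (incl i2 p) + (n : ℂ) • (D.vec_A₂ hσ).field D.K (incl i0 p)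
    with hU
  set V := (D.vec_res₁ hσ).field 1 (incl i2 x) + (n : ℂ) • (D.vec_res₂ hσ).field D.K z with hV
  set L := (D.vec_low₁ hσ M).field 1 (incl i2 q) + (n : ℂ) • (D.vec_non₂ hσ).field D.K m with hL
  have d3 : U - V - L =
      ((D.vec_res₁ hσ).field 1 (incl i2 p) - (D.vec_res₁ hσ).field 1 (incl i2 x))
      + ((D.vec_low₁ hσ M).field 1 (incl i2 p) - (D.vec_low₁ hσ M).field 1 (incl i2 q))
      + (D.vec_high₁ hσ M).field 1 (incl i2 p)
      + (n : ℂ) • (((D.vec_res₂ hσ).field D.K (incl i0 p) - (D.vec_res₂ hσ).field D.K z)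
      + ((D.vec_non₂ hσ).field D.K (incl i0 p) - (D.vec_non₂ hσ).field D.K m)) := by
    rw [hU, hV, hL, d1, d2]
    module
  have d4 : Xa - A Xa - Xb - A Xb - Xc
      = (δ : ℂ) • ((U - V - L) - A U - A V + XP - A XP) := by
    have hXa' : Xa = (δ : ℂ) • (U + XP) := by rw [hXa, ← hpz]
    rw [hXa', hXb, hXc, map_smul, map_smul, map_add]
    clear_value U V L
    module
  rw [d4]
  exact norm_error_le A hδ hn hε hG0 t6 t7 t8 d3 (t1.trans_eq (by ring)) (t2.trans_eq (by ring))
    t3 (t4.trans_eq (by ring)) (t5.trans_eq (by ring))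

end NormalFormData

end

/-! ### Coefficient data of the two leading terms, and the field of the error. -/

section

variable {d : ℕ} {𝒩 : Set (Fin d → ℤ)}

theorem VecBound.of_le {s' s t C : ℝ} {A : Coef 𝒩} (h : VecBound s' s C A) (hst : s' ≤ t) :
    VecBound t s C A where
  nonneg := h.nonneg
  zero := h.zero
  le m i n j := (h.le m i n j).trans (mul_le_mul_of_nonneg_left
    (Finset.prod_le_prod (fun _ _ => wt_nonneg _ _) fun i' _ => wt_mono hst (j i')) h.nonneg)

theorem fieldBound_of_polyFun {s t s' R C C' : ℝ} (hs : 0 ≤ s) (hst : s ≤ t) (ht : t ≤ s')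
    {A : Coef 𝒩} (hA : FunBound s C A) (hA' : VecBound t s C' A) {K : ℕ} {Z : Ham 𝒩}
    (hZ : ∀ ζ, MemW s ζ → Z ζ = polyFun K A ζ) :
    FieldBound (vectorField Z) s' R s (C' * growth K (2 * R)) := by
  intro ζ hζ
  set x : W 𝒩 t := incl ht (toW s' ζ hζ.1) with hx
  have hxs : x.seq = ζ := by rw [hx, incl_seq, toW_seq]
  have h1 : HasFDerivAt (fun y : W 𝒩 s => Z y.seq) (sympForm hs (hA'.field K x)) (incl hst x) :=
    (hasFDerivAt_polyFun hs hst hA hA' K x).congr_of_eventuallyEq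
      (Eventually.of_forall fun u => hZ _ u.memW)
  have h2 := vectorField_eq hs h1
  rw [incl_seq, hxs] at h2
  rw [h2]
  refine ⟨(hA'.field K x).memW, ?_⟩
  rw [← W.norm_eq_normW]
  have hmem : toW s' ζ hζ.1 ∈ openBallW 𝒩 s' R := by
    change (toW s' ζ hζ.1).seq ∈ ballW 𝒩 s' R
    rwa [toW_seq]
  exact hA'.norm_field_le K ((norm_incl_le ht _).trans (norm_lt_of_mem_openBallW hmem).le)

theorem exists_normalFormData {s₁ T : ℝ} {h₀ : Ham 𝒩} {Φ : ℝ → SeqSp 𝒩 → SeqSp 𝒩} {k : ℕ}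
    (hk : 2 ≤ k) (h : PeriodicFlow s₁ h₀ Φ T) (hI : FlowInvariance Φ) (hs₁ : 1 ≤ s₁)
    {P Q : Ham 𝒩} (hP : QuadClass 2 P) (hQ : PolyClass k Q) :
    ∃ D : NormalFormData 𝒩, D.T = T ∧ D.K = k - 1 ∧ Diagonal s₁ T h₀ Φ D.κ ∧
      (∀ ζ, MemW 1 ζ → P ζ = polyFun 1 D.A₁ ζ) ∧ (∀ ζ, MemW 1 ζ → Q ζ = polyFun D.K D.A₂ ζ) ∧
      (PolyClass 2 P → ∀ m j, ‖D.A₁ m j‖ ≤ D.c) := by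
  obtain ⟨κ, hκ⟩ := exists_diagonal h hI hs₁
  obtain ⟨A₂, C₂, hC₂, r₂, b₂, e₂⟩ := hQ.exists_coef hk
  obtain ⟨A₁, C₁, hC₁, r₁, q₁, b₁, e₁⟩ : ∃ (A : Coef 𝒩) (C : ℝ), 0 ≤ C ∧ RealCoef 1 A ∧
      QuadBound 2 C A ∧ (PolyClass 2 P → ∀ m j, ‖A m j‖ ≤ C) ∧
      ∀ ζ, MemW 1 ζ → P ζ = polyFun 1 A ζ := by
    -- If the quadratic term has bounded coefficients, those are the ones to choose: the same family
    -- then serves for the normal form and for the estimate on all of `𝒲^s`.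
    by_cases hP' : PolyClass 2 P
    · obtain ⟨A, C, hC, hA, hAC, e⟩ := hP'.exists_coef le_rfl
      exact ⟨A, C, hC, hA, fun m j => (hAC m j).trans
        (le_mul_of_one_le_right hC (one_le_wt (by norm_num) _)), fun _ => hAC, e⟩
    · obtain ⟨A, C, hC, hA, hAC, e⟩ := hP.exists_coef
      exact ⟨A, C, hC, hA, hAC, fun h' => absurd h' hP', e⟩
  refine ⟨⟨A₁, A₂, κ, T, max C₁ C₂, k - 1, h.period_pos, hC₁.trans (le_max_left _ _), by omega,
    r₁, r₂, fun m j => (q₁ m j).trans (mul_le_mul_of_nonneg_right (le_max_left _ _)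
      (wt_nonneg _ _)), fun m j => (b₂ m j).trans (le_max_right _ _), hκ.conj h⟩,
    rfl, rfl, hκ, e₁, e₂, fun h' m j => (b₁ h' m j).trans (le_max_left _ _)⟩

namespace NormalFormData

variable (D : NormalFormData 𝒩) {σ s₀ r δ ε n M : ℝ}

theorem fieldBound_pullback (hσ1 : 1 ≤ σ) (hσ : 0 ≤ σ) (hσ' : 0 ≤ σ + s₀) (hs₀ : 4 ≤ s₀)
    (hr : 0 ≤ r) (hδ : 0 < δ) (hn : 1 ≤ n) (hε : ε = δ * n) (hM : 0 < M)
    (hMδ : M ^ (-(s₀ - 2)) ≤ δ) (hY : SmallField (D.step hσ δ ε M) r)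
    (hY' : SmallField (D.step hσ' δ ε M) r) (i0 : σ ≤ σ + s₀) {x : W 𝒩 (σ + s₀)} (hx : ‖x‖ < r)
    {F P G : Ham 𝒩} (hF : ∀ ζ, MemW σ ζ →
      F ζ = polyFun 1 D.A₁ ζ + n * polyFun D.K D.A₂ ζ + P ζ) {XP : W 𝒩 σ}
    (hXP : HasFDerivAt (fun y : W 𝒩 σ => P y.seq) (sympForm hσ XP) (hY.midpoint (incl i0 x)))
    {Λ : ℂ} (hG : ∀ y : W 𝒩 σ, ‖y‖ < r → G y.seq = Λ * (δ * F (hY.midpoint y).seq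
      - δ * (polyFun 1 D.res₁ y.seq + n * polyFun D.K D.res₂ y.seq)
      - δ * (polyFun 1 (D.low₁ M) (hY.inv y).seq + n * polyFun D.K D.non₂ (hY.inv y).seq))) :
    MemW σ (vectorField G x.seq) ∧ normW σ (vectorField G x.seq)
      ≤ ‖Λ‖ * (2 * ((10 * D.est σ r ^ 2 + D.est σ r) * ε ^ 2 + 2 * δ * ‖XP‖)) := by
  have i2 : σ + 2 ≤ σ + s₀ := by linarith
  have j : σ ≤ σ + 2 := by linarith
  have hz : ‖incl i0 x‖ < r := (norm_incl_le i0 x).trans_lt hx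
  have hself : ∀ y : W 𝒩 σ, incl (le_refl σ) y = y := fun y => W.ext_seq (by rw [incl_seq])
  have htwo : ∀ y : W 𝒩 (σ + s₀), incl j (incl i2 y) = incl i0 y :=
    fun y => W.ext_seq (by rw [incl_seq, incl_seq, incl_seq])
  have a1 := hasFDerivAt_polyFun hσ j (D.fun_A₁ hσ1) (D.vec_A₁ hσ) 1 (incl i2 (hY'.midpoint x))
  rw [htwo, D.incl_midpoint i0 hY hY' hx] at a1
  have a2 := hasFDerivAt_polyFun hσ le_rfl (D.fun_A₂ hσ1) (D.vec_A₂ hσ) D.K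
    (hY.midpoint (incl i0 x))
  rw [hself] at a2
  have b1 := hasFDerivAt_polyFun hσ j (D.fun_res₁ hσ1) (D.vec_res₁ hσ) 1 (incl i2 x)
  rw [htwo] at b1
  have b2 := hasFDerivAt_polyFun hσ le_rfl (D.fun_res₂ hσ1) (D.vec_res₂ hσ) D.K (incl i0 x)
  rw [hself] at b2
  have c1 := hasFDerivAt_polyFun hσ j (D.fun_low₁ hσ1 M) (D.vec_low₁ hσ M) 1
    (incl i2 (hY'.inv x))
  rw [htwo, D.incl_inv i0 hY hY' hx] at c1
  have c2 := hasFDerivAt_polyFun hσ le_rfl (D.fun_non₂ hσ1) (D.vec_non₂ hσ) D.K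
    (hY.inv (incl i0 x))
  rw [hself] at c2
  have ha : HasFDerivAt (fun y : W 𝒩 σ => (δ : ℂ) * F y.seq) (sympForm hσ ((δ : ℂ) •
      ((D.vec_A₁ hσ).field 1 (incl i2 (hY'.midpoint x))
      + (n : ℂ) • (D.vec_A₂ hσ).field D.K (hY.midpoint (incl i0 x)) + XP)))
      (hY.midpoint (incl i0 x)) := by
    refine ((((a1.add (a2.const_mul (n : ℂ))).add hXP).const_mul (δ : ℂ)).congr_fderiv
      ?_).congr_of_eventuallyEq (Eventually.of_forall fun u => ?_)
    · simp only [map_smul, map_add]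
    · simp only [hF _ u.memW]
      rfl
  have hb : HasFDerivAt (fun y : W 𝒩 σ => (δ : ℂ) * (polyFun 1 D.res₁ y.seq
      + n * polyFun D.K D.res₂ y.seq)) (sympForm hσ ((δ : ℂ) •
      ((D.vec_res₁ hσ).field 1 (incl i2 x)
      + (n : ℂ) • (D.vec_res₂ hσ).field D.K (incl i0 x)))) (incl i0 x) := by
    refine ((b1.add (b2.const_mul (n : ℂ))).const_mul (δ : ℂ)).congr_fderiv ?_
    simp only [map_smul, map_add]
  have hc : HasFDerivAt (fun y : W 𝒩 σ => (δ : ℂ) * (polyFun 1 (D.low₁ M) y.seq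
      + n * polyFun D.K D.non₂ y.seq)) (sympForm hσ ((δ : ℂ) •
      ((D.vec_low₁ hσ M).field 1 (incl i2 (hY'.inv x))
      + (n : ℂ) • (D.vec_non₂ hσ).field D.K (hY.inv (incl i0 x))))) (hY.inv (incl i0 x)) := by
    refine ((c1.add (c2.const_mul (n : ℂ))).const_mul (δ : ℂ)).congr_fderiv ?_
    simp only [map_smul, map_add]
  obtain ⟨w, hw, hwn⟩ := hY.hasFDerivAt_pullback hσ (D.sympForm_fderiv_step hσ1 hσ δ ε M) hz
    ha hb hc
  have hwn' := hwn.trans (mul_le_mul_of_nonneg_left (D.norm_pullback_le hσ hσ' hs₀ hr hδ hn hε hM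
    hMδ hY hY' i0 i2 hx XP _ _ _ rfl rfl rfl) (by norm_num : (0 : ℝ) ≤ 2))
  have hGd : HasFDerivAt (fun y : W 𝒩 σ => G y.seq) (sympForm hσ (Λ • w)) (incl i0 x) := by
    refine ((hw.const_mul Λ).congr_fderiv (map_smul _ _ _).symm).congr_of_eventuallyEq ?_
    filter_upwards [(isOpen_lt continuous_norm continuous_const).mem_nhds hz] with y hy
    exact hG y hy
  have h1 := vectorField_eq hσ hGd
  rw [incl_seq] at h1
  rw [h1]
  refine ⟨(Λ • w).memW, ?_⟩
  rw [← W.norm_eq_normW, norm_smul]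
  exact mul_le_mul_of_nonneg_left hwn' (norm_nonneg _)

end NormalFormData

end

/-! ### The cutoff and the remainder Hamiltonian. -/

section

variable {d : ℕ} {𝒩 : Set (Fin d → ℤ)}

/-- `M = δ^{-α}` with `α = (1 - β)/2` gives `δ M² = δ^β`. For `ν < 0` the choice `β = 1 + ν` matches
the other term of the step. At `ν = 0` it would give `α = 0` and no decay of the tail, so `β = 1/2`.
The summand `1/α` in `s₀` ensures `α (s₀ - 2) ≥ 1`. -/
theorem exists_cutoff {ν c : ℝ} (hν : -1 < ν) (hc : 0 ≤ c) :
    ∃ (s₀ : ℝ) (M : ℝ → ℝ), 4 ≤ s₀ ∧ c ≤ s₀ ∧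
      (∀ δ, 0 < δ → δ < 1 → 0 < M δ ∧ M δ ^ (-(s₀ - 2)) ≤ δ) ∧
      (ν < 0 → ∀ δ, 0 < δ → δ * M δ ^ 2 = δ ^ (1 + ν)) ∧
      Tendsto (fun δ => δ * M δ ^ 2 + δ ^ (1 + ν)) (𝓝[>] 0) (𝓝 0) := by
  obtain ⟨β, hβ0, hβ1, hβν⟩ : ∃ β : ℝ, 0 < β ∧ β < 1 ∧ (ν < 0 → β = 1 + ν) := by
    by_cases h : ν < 0
    · exact ⟨1 + ν, by linarith, by linarith, fun _ => rfl⟩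
    · exact ⟨1 / 2, by norm_num, by norm_num, fun h' => absurd h' h⟩
  set α := (1 - β) / 2 with hα
  have hα0 : 0 < α := by rw [hα]; linarith
  have hinv : 0 < 1 / α := by positivity
  have hM : ∀ δ : ℝ, 0 < δ → δ * (δ ^ (-α)) ^ 2 = δ ^ β := fun δ hδ => by
    rw [← Real.rpow_natCast, ← Real.rpow_mul hδ.le]
    nth_rw 1 [← Real.rpow_one δ]
    rw [← Real.rpow_add hδ, hα]
    congr 1
    push_cast
    ring
  refine ⟨4 + 1 / α + c, fun δ => δ ^ (-α), by linarith, by linarith, fun δ hδ hδ1 =>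
    ⟨Real.rpow_pos_of_pos hδ _, ?_⟩, fun h δ hδ => by rw [hM δ hδ, hβν h], ?_⟩
  · rw [← Real.rpow_mul hδ.le]
    nth_rw 2 [← Real.rpow_one δ]
    refine Real.rpow_le_rpow_of_exponent_ge hδ hδ1.le ?_
    have h1 : α * (1 / α) = 1 := by field_simp
    have h2 : 0 ≤ α * c := by positivity
    have h3 : -α * -(4 + 1 / α + c - 2) = 2 * α + α * (1 / α) + α * c := by ring
    rw [h3, h1]
    linarith
  · have hlim : ∀ e : ℝ, 0 < e → Tendsto (fun δ : ℝ => δ ^ e) (𝓝[>] 0) (𝓝 0) := fun e he => by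
      have := (Real.continuousAt_rpow_const 0 e (Or.inr he.le)).tendsto
      rw [Real.zero_rpow he.ne'] at this
      exact this.mono_left nhdsWithin_le_nhds
    have h1 := (hlim β hβ0).add (hlim (1 + ν) (by linarith))
    rw [add_zero] at h1
    refine h1.congr' ?_
    filter_upwards [self_mem_nhdsWithin] with δ hδ
    rw [hM δ hδ]

namespace NormalFormData

variable (D : NormalFormData 𝒩) {σ s₀ s₁ r δ ε n M : ℝ} {h₀ F Z₁ Z₂ : Ham 𝒩}

theorem norm_step_inv_le (hσ : 0 ≤ σ) (hσ' : 0 ≤ σ + s₀) (hs₀ : 4 ≤ s₀) (hr : 0 ≤ r)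
    (hδ : 0 ≤ δ) (hδε : δ ≤ ε) (hY : SmallField (D.step hσ δ ε M) r)
    (hY' : SmallField (D.step hσ' δ ε M) r) (i0 : σ ≤ σ + s₀) {x : W 𝒩 (σ + s₀)} (hx : ‖x‖ < r) :
    ‖D.step hσ δ ε M (hY.inv (incl i0 x))‖ ≤ ε * D.est σ r := by
  have j : σ ≤ σ + 2 := by linarith
  obtain ⟨y, hy, hyn⟩ := D.exists_loss_step hσ hs₀ hr hδ hδε M hσ' (x := hY'.inv x)
    (by linarith [hY'.norm_inv_lt hx])
  have e : D.step hσ δ ε M (hY.inv (incl i0 x)) = incl j y := by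
    rw [← D.incl_inv i0 hY hY' hx, ← D.incl_step i0 hσ hσ']
    exact W.ext_seq (by rw [incl_seq, incl_seq, hy])
  rw [e]
  exact (norm_incl_le j y).trans hyn

open scoped Classical in
/-- The remainder of the averaging step, multiplied by `Λ`. -/
def remainder {Y : W 𝒩 σ → W 𝒩 σ} (hY : SmallField Y r) (δ ε : ℝ) (Λ : ℂ)
    (h₀ F Z₁ Z₂ : Ham 𝒩) : Ham 𝒩 := fun ζ =>
  if hζ : MemW σ ζ then
    Λ * (h₀ (hY.midpoint (toW σ ζ hζ)).seq + δ * F (hY.midpoint (toW σ ζ hζ)).seq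
      - h₀ ζ - δ * Z₁ ζ - ε * Z₂ ζ)
  else 0

theorem remainder_seq {Y : W 𝒩 σ → W 𝒩 σ} (hY : SmallField Y r) (δ ε : ℝ) (Λ : ℂ) (y : W 𝒩 σ) :
    remainder hY δ ε Λ h₀ F Z₁ Z₂ y.seq = Λ * (h₀ (hY.midpoint y).seq
      + δ * F (hY.midpoint y).seq - h₀ y.seq - δ * Z₁ y.seq - ε * Z₂ y.seq) := by
  rw [remainder, dif_pos y.memW]
  rfl

/-- Substituting the exact formula for `h₀` at the image removes `h₀` altogether. Only polynomials
composed with analytic maps remain, whence analyticity and the field bound. -/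
theorem remainder_eq {Φ : ℝ → SeqSp 𝒩 → SeqSp 𝒩} (h : PeriodicFlow s₁ h₀ Φ D.T)
    (hD : Diagonal s₁ D.T h₀ Φ D.κ) (hs : s₁ ≤ σ) (hs₁ : 1 ≤ s₁) (hσ : 0 ≤ σ) (hε : ε = δ * n)
    (hY : SmallField (D.step hσ δ ε M) r)
    (hZ₁ : ∀ ζ, MemW 1 ζ → Z₁ ζ = polyFun 1 D.res₁ ζ)
    (hZ₂ : ∀ ζ, MemW 1 ζ → Z₂ ζ = polyFun D.K D.res₂ ζ) (Λ : ℂ) {y : W 𝒩 σ} (hy : ‖y‖ < r) :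
    remainder hY δ ε Λ h₀ F Z₁ Z₂ y.seq = Λ * (δ * F (hY.midpoint y).seq
      - δ * (polyFun 1 D.res₁ y.seq + n * polyFun D.K D.res₂ y.seq)
      - δ * (polyFun 1 (D.low₁ M) (hY.inv y).seq + n * polyFun D.K D.non₂ (hY.inv y).seq)) := by
  have hm : MemW 1 y.seq := y.memW.mono (hs₁.trans hs)
  rw [remainder_seq, D.unperturbed_midpoint h hD hs hs₁ hσ hY hy, hZ₁ _ hm, hZ₂ _ hm]
  have hc : (ε : ℂ) = δ * n := by rw [hε]; push_cast; rfl
  linear_combination -Λ * (polyFun D.K D.non₂ (hY.inv y).seq + polyFun D.K D.res₂ y.seq) * hc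

theorem analyticAt_remainder {Φ : ℝ → SeqSp 𝒩 → SeqSp 𝒩} (h : PeriodicFlow s₁ h₀ Φ D.T)
    (hD : Diagonal s₁ D.T h₀ Φ D.κ) (hs : s₁ ≤ σ) (hs₁ : 1 ≤ s₁) (hσ : 0 ≤ σ) (hε : ε = δ * n)
    (hY : SmallField (D.step hσ δ ε M) r)
    (hZ₁ : ∀ ζ, MemW 1 ζ → Z₁ ζ = polyFun 1 D.res₁ ζ)
    (hZ₂ : ∀ ζ, MemW 1 ζ → Z₂ ζ = polyFun D.K D.res₂ ζ) (Λ : ℂ) {A : Coef 𝒩} {C : ℝ} {K : ℕ}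
    (hA : FunBound σ C A) (hF : ∀ ζ, MemW 1 ζ → F ζ = polyFun K A ζ) {z : W 𝒩 σ} (hz : ‖z‖ < r) :
    AnalyticAt ℂ (fun y : W 𝒩 σ => remainder hY δ ε Λ h₀ F Z₁ Z₂ y.seq) z := by
  have hσ1 : 1 ≤ σ := hs₁.trans hs
  have poly : ∀ {B : Coef 𝒩} {E : ℝ} (_ : FunBound σ E B) (N : ℕ) (y : W 𝒩 σ),
      AnalyticAt ℂ (fun y : W 𝒩 σ => polyFun N B y.seq) y := fun hB N y =>
    (hB.contDiff N).analyticOnNhd (s := univ) _ (mem_univ _)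
  have a1 : AnalyticAt ℂ (fun y : W 𝒩 σ => polyFun K A (hY.midpoint y).seq) z :=
    AnalyticAt.comp (g := fun y : W 𝒩 σ => polyFun K A y.seq) (poly hA K _)
      (hY.analyticAt_midpoint hz)
  have a2 : AnalyticAt ℂ (fun y : W 𝒩 σ => polyFun 1 (D.low₁ M) (hY.inv y).seq) z :=
    AnalyticAt.comp (g := fun y : W 𝒩 σ => polyFun 1 (D.low₁ M) y.seq)
      (poly (D.fun_low₁ hσ1 M) 1 _) (hY.analyticAt_inv hz)
  have a3 : AnalyticAt ℂ (fun y : W 𝒩 σ => polyFun D.K D.non₂ (hY.inv y).seq) z :=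
    AnalyticAt.comp (g := fun y : W 𝒩 σ => polyFun D.K D.non₂ y.seq)
      (poly (D.fun_non₂ hσ1) D.K _) (hY.analyticAt_inv hz)
  have a4 := poly (D.fun_res₁ hσ1) 1 z
  have a5 := poly (D.fun_res₂ hσ1) D.K z
  have hall : AnalyticAt ℂ (fun y : W 𝒩 σ => Λ * (δ * polyFun K A (hY.midpoint y).seq
      - δ * (polyFun 1 D.res₁ y.seq + n * polyFun D.K D.res₂ y.seq)
      - δ * (polyFun 1 (D.low₁ M) (hY.inv y).seq
        + n * polyFun D.K D.non₂ (hY.inv y).seq))) z :=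
    analyticAt_const.mul (((analyticAt_const.mul a1).sub (analyticAt_const.mul
      (a4.add (analyticAt_const.mul a5)))).sub (analyticAt_const.mul
      (a2.add (analyticAt_const.mul a3))))
  refine hall.congr ?_
  filter_upwards [(isOpen_lt continuous_norm continuous_const).mem_nhds hz] with y hy
  rw [D.remainder_eq h hD hs hs₁ hσ hε hY hZ₁ hZ₂ Λ hy,
    hF _ ((hY.midpoint y).memW.mono hσ1)]

end NormalFormData

theorem norm_midpoint_sub_le {s r B : ℝ} {Y : W 𝒩 s → W 𝒩 s} (hY : SmallField Y r) {z : W 𝒩 s}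
    (hz : ‖z‖ < r) (hB : ‖Y (hY.inv z)‖ ≤ B) : ‖hY.midpoint z - z‖ ≤ 2 * B := by
  rw [hY.midpoint_sub hz, norm_smul, Complex.norm_two]
  linarith

theorem norm_toW_lt {s R : ℝ} {ζ : SeqSp 𝒩} (h : ζ ∈ ballW 𝒩 s R) : ‖toW s ζ h.1‖ < 2 * R :=
  norm_lt_of_mem_openBallW (show (toW s ζ h.1).seq ∈ ballW 𝒩 s R by rwa [toW_seq])

theorem mem_openBallW_of_norm_sub_le {s R R' : ℝ} {z w : W 𝒩 s} (hz : z ∈ openBallW 𝒩 s R)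
    (h : ‖w - z‖ ≤ R') : w ∈ openBallW 𝒩 s (R + R') := by
  refine ⟨w.memW, fun σ => ?_⟩
  have h1 := compNorm_add_le (w - z).memW z.memW σ
  have h2 : (w - z).seq + z.seq = w.seq := by rw [seq_sub, sub_add_cancel]
  rw [h2] at h1
  have h3 := compNorm_le_norm (w - z) σ
  have h4 := hz.2 σ
  linarith

end

end GalerkinAveraging

end

/-! ### Choice of the parameters and assembly. -/

open GalerkinAveraging.NormalFormData

theorem theorem3p6 {d : ℕ} (𝒩 : Set (Fin d → ℤ))
    (R s₁ : ℝ) (hR : 0 < R) (hs₁ : 1 ≤ s₁)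
    (ν : ℝ) (hν : (-3 + Real.sqrt 5) / 2 < ν) (hν' : ν ≤ 0) (k : ℕ) (hk : 3 ≤ k)
    (h₀ : Ham 𝒩)
    (Φ : ℝ → SeqSp 𝒩 → SeqSp 𝒩) (T : ℝ)
    (hPER : PeriodicFlow s₁ h₀ Φ T)
    (hINV : FlowInvariance Φ)
    (δ₀ : ℝ) (hδ₀ : 0 < δ₀)
    (F : ℝ → Ham 𝒩) (F₁ F₂ : ℕ → Ham 𝒩)
    (Rs : ℝ) (deg : ℕ → ℕ)
    (hHVF : AsymptoticExpansion s₁ ν δ₀ k F F₁ F₂ Rs deg) :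
    ∃ s₀ : ℝ, 0 < s₀ ∧ ∀ s : ℝ, s₁ ≤ s →
      ∃ δs C : ℝ, 0 < δs ∧ δs ≤ δ₀ ∧ 0 < C ∧ ∀ δ : ℝ, 0 < δ → δ < δs →
        ∃ (𝒯 : W 𝒩 s → W 𝒩 s)
          (Z₁ Z₂ Rem : Ham 𝒩),
          -- the canonical transformation
          IsCanonical 𝒯 (openBallW 𝒩 s R) ∧
          MapsTo 𝒯 (openBallW 𝒩 s R)
            (openBallW 𝒩 s (2 * R)) ∧
          -- the transformed Hamiltonian
          AnalyticOnNhd ℂ (fun ζ : W 𝒩 s => Rem ζ.seq)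
            (openBallW 𝒩 s R) ∧
          (∀ ζ ∈ openBallW 𝒩 s R,
            h₀ (𝒯 ζ).seq + (δ : ℂ) * F δ (𝒯 ζ).seq =
              h₀ ζ.seq + (δ : ℂ) * Z₁ ζ.seq + ((δ ^ (1 + ν) : ℝ) : ℂ) * Z₂ ζ.seq
                + ((δ ^ ((2 + ν) * (1 + ν)) : ℝ) : ℂ) * Rem ζ.seq) ∧
          -- the normal form terms
          QuadClass 2 Z₁ ∧
          (PolyClass 2 (F₁ 1) → PolyClass 2 Z₁) ∧
          PolyClass k Z₂ ∧
          (∀ ζ : SeqSp 𝒩, MemW (s + s₀) ζ →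
            HasPoissonBracket Z₁ h₀ ζ 0 ∧
            HasPoissonBracket Z₂ h₀ ζ 0) ∧
          (∀ ζ : SeqSp 𝒩, MemW 1 ζ →
            Z₁ ζ = timeAverage Φ T (F₁ 1) ζ ∧
            Z₂ ζ = timeAverage Φ T (F₂ 1) ζ) ∧
          -- the estimates
          FieldBound (vectorField Z₁) (s + s₀) R s C ∧
          FieldBound (vectorField Z₂) (s + s₀) R s C ∧
          FieldBound (vectorField Rem) (s + s₀) R s C ∧
          (∀ ζ ∈ openBallW 𝒩 s R,
            ζ.seq ∈ ballW 𝒩 (s + s₀) R → ‖𝒯 ζ - ζ‖ ≤ C * δ ^ (1 + ν)) ∧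
          ((ν < 0 ∨ PolyClass 2 (F₁ 1)) →
            ∀ ζ ∈ openBallW 𝒩 s R, ‖𝒯 ζ - ζ‖ ≤ C * δ ^ (1 + ν)) := by
  have hν1 : -1 < ν := by
    have := Real.one_le_sqrt.2 (by norm_num : (1 : ℝ) ≤ 5)
    linarith
  have hquad : QuadClass 2 (F₁ 1) := by simpa using hHVF.quadratic₁ 1 le_rfl
  have hpoly : PolyClass k (F₂ 1) := hHVF.deg_one ▸ hHVF.polynomial₂ 1 le_rfl
  obtain ⟨D, rfl, hDK, hD, hP, hQ, hbd⟩ :=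
    exists_normalFormData (by omega) hPER hINV hs₁ hquad hpoly
  -- `s₀ ≥ 2 s₁` puts `X_{h₀}(ζ)` in `𝒲^s` for the Poisson brackets, and `s₀ ≥ 4` covers the loss in
  -- the one-term expansion.
  obtain ⟨s₀, M, hs₀, hs₀', hM, hMν, hlim⟩ :=
    exists_cutoff (c := 2 * s₁) hν1 (by linarith)
  refine ⟨s₀, by linarith, fun s hs => ?_⟩
  have hs1 : 1 ≤ s := hs₁.trans hs
  have hσ : 0 ≤ s := by linarith
  have hσ' : 0 ≤ s + s₀ := by linarith
  have i0 : s ≤ s + s₀ := by linarith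
  have hZ₁ : ∀ ζ : SeqSp 𝒩, MemW 1 ζ →
      timeAverage Φ D.T (F₁ 1) ζ = polyFun 1 D.res₁ ζ := fun ζ hζ =>
    timeAverage_polyFun hPER hD (D.fun_A₁ le_rfl) hP hζ
  have hZ₂ : ∀ ζ : SeqSp 𝒩, MemW 1 ζ →
      timeAverage Φ D.T (F₂ 1) ζ = polyFun D.K D.res₂ ζ := fun ζ hζ =>
    timeAverage_polyFun hPER hD (D.fun_A₂ le_rfl) hQ hζ
  -- `ℬ_s(R)` lies in `‖z‖ < 2R` and points move by at most `R`, so images stay in `‖z‖ < r`.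
  set r := 3 * R with hrR
  have hr : 0 ≤ r := by linarith
  obtain ⟨Cb, εb, hεb, hbr⟩ := hHVF.bound_remainder 1 le_rfl s hs
  have hss : s ≤ s + 2 * (((1 : ℕ) : ℝ) + 1) := by push_cast; linarith
  obtain ⟨De, hDe, hext⟩ := field_bound_extend (𝒩 := 𝒩) (r := 3 * r) hσ hss (by linarith)
    hHVF.radius_pos D.one_le_K
  have hκ := D.stepConst_nonneg (σ := s) hr
  have hG := D.est_nonneg (σ := s) hr
  -- the range of the small parameter
  have hev : ∀ᶠ δ in 𝓝[>] (0 : ℝ), δ < 1 ∧ δ < εb ∧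
      D.stepConst s r * (δ * M δ ^ 2 + δ ^ (1 + ν)) < min (1 / 4) (R / 2) ∧
      D.stepConst (s + s₀) r * (δ * M δ ^ 2 + δ ^ (1 + ν)) < min (1 / 4) (R / 2) := by
    -- A step below `R/2` moves points by less than `R`, the displacement being twice the step, and
    -- `R/2 ≤ r/4`. Both regularities `s` and `s + s₀` are needed, since the map also has to act on
    -- smooth points.
    have hmin : 0 < min (1 / 4) (R / 2) := lt_min (by norm_num) (by linarith)
    have small : ∀ c : ℝ, ∀ᶠ δ in 𝓝[>] (0 : ℝ),
        c * (δ * M δ ^ 2 + δ ^ (1 + ν)) < min (1 / 4) (R / 2) := fun c => by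
      have := hlim.const_mul c
      rw [mul_zero] at this
      exact this.eventually_lt_const hmin
    filter_upwards [small (D.stepConst s r), small (D.stepConst (s + s₀) r),
      nhdsWithin_le_nhds (Iio_mem_nhds one_pos), nhdsWithin_le_nhds (Iio_mem_nhds hεb)]
      with δ h1 h2 h3 h4 using ⟨h3, h4, h1, h2⟩
  obtain ⟨δ₁, hδ₁, hsub⟩ := mem_nhdsGT_iff_exists_Ioo_subset.1 hev
  obtain ⟨C, hC0, hC₁, hC₂, hC₃, hC₄, hC₅⟩ : ∃ C : ℝ, 0 < C ∧ D.bd s * growth 1 (2 * R) ≤ C ∧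
      D.bd s * growth D.K (2 * R) ≤ C ∧
      2 * (10 * D.est s r ^ 2 + D.est s r + 2 * (De * |Cb|)) ≤ C ∧ 2 * D.est s r ≤ C ∧
      4 * D.stepConst s r ≤ C := by
    have h1 := mul_nonneg (D.bd_nonneg s) (growth_nonneg 1 (r := 2 * R) (by linarith))
    have h2 := mul_nonneg (D.bd_nonneg s) (growth_nonneg D.K (r := 2 * R) (by linarith))
    have h3 : 0 ≤ 2 * (10 * D.est s r ^ 2 + D.est s r + 2 * (De * |Cb|)) := by positivity
    refine ⟨1 + D.bd s * growth 1 (2 * R) + D.bd s * growth D.K (2 * R)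
      + 2 * (10 * D.est s r ^ 2 + D.est s r + 2 * (De * |Cb|)) + 2 * D.est s r
      + 4 * D.stepConst s r, ?_, ?_, ?_, ?_, ?_, ?_⟩ <;> linarith
  refine ⟨min δ₁ δ₀, C, lt_min hδ₁ hδ₀, min_le_right _ _, hC0, fun δ hδ hδs => ?_⟩
  obtain ⟨hδ1, hδb, hsm, hsm'⟩ := hsub ⟨hδ, hδs.trans_le (min_le_left _ _)⟩
  have hδδ₀ : δ < δ₀ := hδs.trans_le (min_le_right _ _)
  obtain ⟨hMδ0, hMδ⟩ := hM δ hδ hδ1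
  have hn : 1 ≤ δ ^ ν := Real.one_le_rpow_of_pos_of_le_one_of_nonpos hδ hδ1.le hν'
  have hε : δ ^ (1 + ν) = δ * δ ^ ν := by rw [Real.rpow_add hδ, Real.rpow_one]
  have hε0 : 0 < δ ^ (1 + ν) := Real.rpow_pos_of_pos hδ _
  have hδε : δ ≤ δ ^ (1 + ν) := by rw [hε]; exact le_mul_of_one_le_right hδ.le hn
  have hY : SmallField (D.step hσ δ (δ ^ (1 + ν)) (M δ)) r :=
    D.smallField_step hσ hr hδ.le hε0.le (hsm.le.trans (min_le_left _ _))
      ((hsm.le.trans (min_le_right _ _)).trans (by linarith))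
  have hY' : SmallField (D.step hσ' δ (δ ^ (1 + ν)) (M δ)) r :=
    D.smallField_step hσ' hr hδ.le hε0.le (hsm'.le.trans (min_le_left _ _))
      ((hsm'.le.trans (min_le_right _ _)).trans (by linarith))
  have hball : ∀ z ∈ openBallW 𝒩 s R, ‖z‖ < r := fun z hz => by
    have := norm_lt_of_mem_openBallW hz
    linarith
  have hdev : ∀ z ∈ openBallW 𝒩 s R, ‖hY.midpoint z - z‖
      ≤ 2 * (D.stepConst s r * (δ * M δ ^ 2 + δ ^ (1 + ν))) := fun z hz =>
    norm_midpoint_sub_le hY (hball z hz)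
      (D.norm_step_le hσ hr hδ.le hε0.le (hY.norm_inv_lt (hball z hz)).le)
  have hdevR : ∀ z ∈ openBallW 𝒩 s R, ‖hY.midpoint z - z‖ ≤ R := fun z hz => by
    have := hsm.le.trans (min_le_right _ _)
    linarith [hdev z hz]
  have hmaps : MapsTo hY.midpoint (openBallW 𝒩 s R) (openBallW 𝒩 s (2 * R)) := fun z hz => by
    rw [two_mul]
    exact mem_openBallW_of_norm_sub_le hz (hdevR z hz)
  have hTr : ∀ z ∈ openBallW 𝒩 s R, ‖hY.midpoint z‖ < r := fun z hz => by
    have h1 := norm_lt_of_mem_openBallW hz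
    have h2 := norm_add_le (hY.midpoint z - z) z
    rw [sub_add_cancel] at h2
    linarith [hdevR z hz]
  obtain ⟨A, CA, hCA, hAr, hAb, hAF⟩ := (hHVF.polynomial δ hδ hδδ₀).exists_coef (by omega)
  rw [← hDK] at hAr hAF
  have hp0 : (0 : ℝ) < δ ^ ((2 + ν) * (1 + ν)) := Real.rpow_pos_of_pos hδ _
  -- The remainder is defined by solving the claimed identity for it, so that identity is immediate
  -- and the work lies in the bounds.
  set Λ : ℂ := ((δ ^ ((2 + ν) * (1 + ν)) : ℝ) : ℂ)⁻¹ with hΛ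
  refine ⟨hY.midpoint, timeAverage Φ D.T (F₁ 1), timeAverage Φ D.T (F₂ 1),
    remainder hY δ (δ ^ (1 + ν)) Λ h₀ (F δ) (timeAverage Φ D.T (F₁ 1))
      (timeAverage Φ D.T (F₂ 1)), ?_, hmaps, ?_, ?_, ?_, ?_, ?_, ?_, ?_, ?_, ?_, ?_, ?_, ?_⟩
  · exact hY.isCanonical hσ (D.sympForm_fderiv_step hs1 hσ δ _ _) (isOpen_openBallW s R) hball hTr
  · exact fun z hz => D.analyticAt_remainder hPER hD hs hs₁ hσ hε hY hZ₁ hZ₂ Λ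
      (FunBound.of_bounded hσ hCA hAb) hAF (hball z hz)
  · intro ζ _
    rw [remainder_seq, hΛ, mul_inv_cancel_left₀ (Complex.ofReal_ne_zero.2 hp0.ne')]
    ring
  · exact (D.real₁.mul (resInd_conj D.conj)).quadClass (D.quad.mul (norm_resInd_le D.κ)) hZ₁
  · exact fun h => (D.real₁.mul (resInd_conj D.conj)).polyClass le_rfl
      (fun m j => (norm_mul_le _ _).trans (mul_le_mul (hbd h m j) (norm_resInd_le D.κ m j)
        (norm_nonneg _) D.c_nonneg)) hZ₁
  · have hr₂ := D.real₂.mul (resInd_conj D.conj)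
    rw [hDK] at hr₂ hZ₂
    exact hr₂.polyClass (by omega) (fun m j => (norm_mul_le _ _).trans (mul_le_mul
      (D.bounded m j) (norm_resInd_le D.κ m j) (norm_nonneg _) D.c_nonneg)) hZ₂
  · intro ζ hζ
    have hζs : MemW s ζ := hζ.mono i0
    have hζf := hD.memW_field (s := s) hPER (hζ.mono (by linarith))
    constructor
    · exact hasPoissonBracket_zero hPER hD hs (D.fun_res₁ hs1)
        (fun m j => by rw [res₁, mul_assoc, resInd_mul, mul_zero])
        (fun ζ hζ => hZ₁ ζ (hζ.mono hs1)) hζs hζf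
    · exact hasPoissonBracket_zero hPER hD hs (D.fun_res₂ hs1)
        (fun m j => by rw [res₂, mul_assoc, resInd_mul, mul_zero])
        (fun ζ hζ => hZ₂ ζ (hζ.mono hs1)) hζs hζf
  · exact fun ζ _ => ⟨rfl, rfl⟩
  · exact fun ζ hζ => (fieldBound_of_polyFun hσ (by linarith) (by linarith) (D.fun_res₁ hs1)
      (D.vec_res₁ hσ) (fun ζ hζ => hZ₁ ζ (hζ.mono hs1)) ζ hζ).imp_right fun h => h.trans hC₁
  · exact fun ζ hζ => (fieldBound_of_polyFun hσ le_rfl i0 (D.fun_res₂ hs1)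
      (D.vec_res₂ hσ) (fun ζ hζ => hZ₂ ζ (hζ.mono hs1)) ζ hζ).imp_right fun h => h.trans hC₂
  · intro ζ hζ
    have hx : ‖toW (s + s₀) ζ hζ.1‖ < r := by linarith [norm_toW_lt hζ]
    set x := toW (s + s₀) ζ hζ.1 with hxdef
    have hFP : ∀ ζ : SeqSp 𝒩, MemW s ζ → expansionRemainder ν F F₁ F₂ 1 δ ζ
        = polyFun D.K A ζ - (polyFun 1 D.A₁ ζ + ((δ ^ ν : ℝ) : ℂ) * polyFun D.K D.A₂ ζ) :=
      fun ζ hζ => by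
        have hζ1 := hζ.mono hs1
        simp [expansionRemainder, hAF ζ hζ1, hP ζ hζ1, hQ ζ hζ1]
    have i4 : s + 2 * (((1 : ℕ) : ℝ) + 1) ≤ s + s₀ := by push_cast; linarith
    have hmid : ‖hY'.midpoint x‖ ≤ 3 * r := by
      have h1 := hY'.norm_inv_lt hx
      have h2 := hY'.norm_le _ h1
      have h3 := norm_add_le (hY'.inv x) (D.step hσ' δ (δ ^ (1 + ν)) (M δ) (hY'.inv x))
      rw [SmallField.midpoint]
      linarith
    obtain ⟨XP, hXP, hXPn⟩ := hext (FunBound.of_bounded hσ hCA hAb) (D.fun_A₁ hs1) (D.fun_A₂ hs1)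
      ((VecBound.of_bounded hσ hCA hAr.zero hAr.support hAb).of_le hss)
      ((D.vec_A₁ hσ).of_le (by push_cast; linarith)) ((D.vec_A₂ hσ).of_le hss) _ _ hFP
      (hbr δ hδ hδb) (incl i4 (hY'.midpoint x)) ((norm_incl_le i4 _).trans hmid)
    have e : incl hss (incl i4 (hY'.midpoint x)) = hY.midpoint (incl i0 x) := by
      rw [← D.incl_midpoint i0 hY hY' hx]
      exact W.ext_seq (by rw [incl_seq, incl_seq, incl_seq])
    rw [e] at hXP
    have key := D.fieldBound_pullback (F := F δ) hs1 hσ hσ' hs₀ hr hδ hn hε hMδ0 hMδ hY hY' i0 hx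
      (fun ζ hζ => by rw [hFP ζ hζ, hAF ζ (hζ.mono hs1)]; ring) hXP
      (fun y hy => D.remainder_eq hPER hD hs hs₁ hσ hε hY hZ₁ hZ₂ Λ hy)
    refine ⟨key.1, key.2.trans ?_⟩
    have hXP' : ‖XP‖ ≤ De * |Cb| * δ ^ (1 + ν) := by
      refine hXPn.trans ?_
      rw [mul_assoc, Nat.cast_one]
      exact mul_le_mul_of_nonneg_left
        (mul_le_mul_of_nonneg_right (le_abs_self _) hε0.le) hDe
    have hδXP : δ * ‖XP‖ ≤ De * |Cb| * (δ ^ (1 + ν)) ^ 2 := by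
      calc δ * ‖XP‖ ≤ δ ^ (1 + ν) * (De * |Cb| * δ ^ (1 + ν)) :=
            mul_le_mul hδε hXP' (norm_nonneg _) hε0.le
        _ = _ := by ring
    -- `2(1 + ν) ≥ (2 + ν)(1 + ν)` because `ν ≤ 0`, and `δ < 1`.
    have hpow : (δ ^ (1 + ν)) ^ 2 ≤ δ ^ ((2 + ν) * (1 + ν)) := by
      rw [← Real.rpow_natCast, ← Real.rpow_mul hδ.le]
      refine Real.rpow_le_rpow_of_exponent_ge hδ hδ1.le ?_
      have := mul_nonneg (neg_nonneg.2 hν') (by linarith : 0 ≤ 1 + ν)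
      push_cast
      linarith
    have hΛn : ‖Λ‖ = (δ ^ ((2 + ν) * (1 + ν)))⁻¹ := by
      rw [hΛ, norm_inv, Complex.norm_of_nonneg hp0.le]
    rw [hΛn, inv_mul_le_iff₀ hp0]
    calc _ ≤ 2 * (10 * D.est s r ^ 2 + D.est s r + 2 * (De * |Cb|)) * (δ ^ (1 + ν)) ^ 2 := by
          linarith
      _ ≤ C * δ ^ ((2 + ν) * (1 + ν)) := mul_le_mul hC₃ hpow (sq_nonneg _) hC0.le
      _ = _ := mul_comm _ _
  · intro ζ hζ hζ'
    have hx : ‖toW (s + s₀) ζ.seq hζ'.1‖ < r := by linarith [norm_toW_lt hζ']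
    have e : incl i0 (toW (s + s₀) ζ.seq hζ'.1) = ζ := W.ext_seq (by rw [incl_seq, toW_seq])
    have h1 := D.norm_step_inv_le hσ hσ' hs₀ hr hδ.le hδε hY hY' i0 hx
    rw [e] at h1
    refine (norm_midpoint_sub_le hY (hball ζ hζ) h1).trans ?_
    have := mul_le_mul_of_nonneg_right hC₄ hε0.le
    linarith
  · intro h ζ hζ
    have h4 := mul_le_mul_of_nonneg_right hC₅ hε0.le
    have h5 := mul_nonneg hκ hε0.le
    -- For `ν < 0` the cutoff gives `δ M² = δ^{1+ν}`. With bounded coefficients the cut generator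
    -- needs no factor `M²`.
    rcases h with h | h
    · have h3 := hdev ζ hζ
      rw [hMν h δ hδ] at h3
      linarith
    · have h3 := norm_midpoint_sub_le hY (hball ζ hζ) (D.norm_step_le_of_bounded hσ (hbd h) hr
        hδ.le hδε (hY.norm_inv_lt (hball ζ hζ)).le)
      linarith
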